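/- Let $\Gamma$ be a finite graph (a finite 1-dimensional CW complex; multiple edges are allowed), each edge being parametrized by $[0,1]$, and let $v$ be a vertex at which no edge is a loop. A half-edge $h$ at $v$ is an incident pair $(v,e)$; put $e(h)=e$, and regard $h$ also as the subspace $(0,1/2)$ of $e(h)$, where $e(h)$ is parametrized so that $v$ is $0$. Let $H$ be a set of half-edges at $v$, let $\cup H\subseteq\Gamma$ be their union, let $U$ be the open ball of radius $1/2$ around $v$ (edges having length $1$), and let $n\ge 1$. Write $UConf_n(A)$ for the space of unordered configurations of $n$ distinct points in $A\subseteq\Gamma$ (the orbit space of the ordered configuration space $Conf_n(A)\subseteq A^n$), and $UConf_{n,1}(A,B)$ for the subspace of configurations with at most one point in $B$. For a space $X$ let $\tilde\Sigma X_+$ be $X\times[0,1]$ with $X\times\{0,1\}$ collapsed to the base point (a point if $X=\emptyset$). For a map $f:X\to Y$ let $Cone(f)$ be its mapping cone, pointed by the tip $(x,0)$, with $(x,1)$ glued to $f(x)$, and let $\partial: Cone(f)\to\tilde\Sigma X_+$, $(x,t)\mapsto[x,t]$, be the boundary map, which collapses $Y$ to the base point. Let $\iota_H: UConf_n(\Gamma\setminus\cup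 H)\hookrightarrow UConf_n(\Gamma)$ and $\iota_{H,1}:UConf_{n,1}(\Gamma\setminus\cup H,U\setminus\cup H)\hookrightarrow UConf_{n,1}(\Gamma,U)$ be the inclusions, and $J:Cone(\iota_{H,1})\to Cone(\iota_H)$ the induced map. Let $$P: Cone(\iota_{H,1})\to \bigvee_{h\in H}\tilde\Sigma\, UConf_{n-1}(\Gamma\setminus\{v\})_+$$ send a configuration $c\in UConf_{n,1}(\Gamma,U)$ that has a point $x$ on some $h\in H$ to $[c\setminus\{x\},\,2d(x,v)]$ in the summand labelled $h$, and all configurations without such a point, as well as the cone, to the base point. Let $s:\Gamma\setminus\{v\}\to\Gamma$ be the embedding that maps every edge at $v$, parametrized so that $v$ is $0$, by $r\mapsto(1+r)/2$ and is the identity elsewhere. Let $add_v, add_h: UConf_{n-1}(\Gamma\setminus\{v\})\to UConf_n(\Gamma\setminus\cup H)$ be the maps $add_v(z)=s(z)\cup\{v\}$ and $add_h(z)=s(z)\cup\{m_h\}$, where $m_h$ is the midpoint of $e(h)$; thus $add_v$ adds the vertex $v$, and $add_h$ adds a new point on $e(h)$ closer to $v$ than all other points on $e(h)$. Then $P$ is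 well defined and continuous, $P$ and $J$ are pointed homotopy equivalences, and hence there is a pointed homotopy equivalence (the identification) $$\varphi:\bigvee_{h\in H}\tilde\Sigma\, UConf_{n-1}(\Gamma\setminus\{v\})_+\to Cone(\iota_H),\qquad \varphi\circ P\simeq J,$$ unique up to pointed homotopy. The maps $add_v$ and $add_h$ are continuous, and for every $h\in H$ the restriction of $\partial\circ\varphi$ to the wedge summand labelled $h$ is pointed homotopic to $$\tilde\Sigma add_v-\tilde\Sigma add_h,$$ the difference being taken with the cogroup structure of the suspension: $[z,t]\mapsto[add_v(z),2t]$ for $t\le 1/2$ and $[z,t]\mapsto[add_h(z),2-2t]$ for $t\ge1/2$. The same holds for ordered configurations of points labelled by $[n]=\{1,\dots,n\}$, with the wedge indexed by $(i,h)\in[n]\times H$ and the summand $(i,h)$ equal to $\tilde\Sigma Conf_{[n]\setminus\{i\}}(\Gamma\setminus\{v\})_+$ (configurations labelled by $[n]\setminus\{i\}$), where $i$ is the label of the point on $h$ that is forgotten, respectively of the point that is added; all homotopy equivalences and homotopies can then be taken $S_n$-equivariant, where $\sigma\in S_n$ carries the summand $(i,h)$ to $(\sigma(i),h)$ by relabelling.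 -/

import Mathlib

open Set Function

noncomputable section

namespace GraphConf

/-- A chosen base point of a space. -/
class BasePt (A : Type*) where
  pt : A

/-- The base point. -/
def pt {A : Type*} [BasePt A] : A := BasePt.pt

section Homotopy

variable {A B : Type*} [TopologicalSpace A] [TopologicalSpace B] [BasePt A] [BasePt B]

/-- `f` and `g` are pointed maps that are joined by a continuous pointed homotopy
(this contains the continuity of `f` and `g`). -/
def PtdHomotopic (f g : A → B) : Prop :=
  ∃ F : A × unitInterval → B, Continuous F ∧ (∀ a, F (a, 0) = f a) ∧ (∀ a, F (a, 1) = g a) ∧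
    ∀ t, F (pt, t) = pt

/-- `f` is a pointed homotopy equivalence. -/
def IsPtdHomotopyEquiv (f : A → B) : Prop :=
  Continuous f ∧ f pt = pt ∧ ∃ g : B → A, Continuous g ∧ g pt = pt ∧
    PtdHomotopic (g ∘ f) id ∧ PtdHomotopic (f ∘ g) id

variable {S : Type*}

/-- `f` commutes with the operators `ρA s`, `ρB s`. -/
def IsEquivariant (ρA : S → A → A) (ρB : S → B → B) (f : A → B) : Prop :=
  ∀ s a, f (ρA s a) = ρB s (f a)

/-- `f` and `g` are joined by a continuous pointed equivariant homotopy. -/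
def EqPtdHomotopic (ρA : S → A → A) (ρB : S → B → B) (f g : A → B) : Prop :=
  ∃ F : A × unitInterval → B, Continuous F ∧ (∀ a, F (a, 0) = f a) ∧ (∀ a, F (a, 1) = g a) ∧
    (∀ t, F (pt, t) = pt) ∧ ∀ t, IsEquivariant ρA ρB (fun a => F (a, t))

/-- `f` is a pointed equivariant homotopy equivalence. -/
def IsEqPtdHomotopyEquiv (ρA : S → A → A) (ρB : S → B → B) (f : A → B) : Prop :=
  Continuous f ∧ f pt = pt ∧ IsEquivariant ρA ρB f ∧
    ∃ g : B → A, Continuous g ∧ g pt = pt ∧ IsEquivariant ρB ρA g ∧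
      EqPtdHomotopic ρA ρA (g ∘ f) id ∧ EqPtdHomotopic ρB ρB (f ∘ g) id

end Homotopy

section Susp

/-- The gluing that defines the reduced suspension of `X₊`. -/
inductive SuspRel (X : Type*) : Unit ⊕ X × unitInterval → Unit ⊕ X × unitInterval → Prop
  | bot (x : X) : SuspRel X (Sum.inr (x, 0)) (Sum.inl ())
  | top (x : X) : SuspRel X (Sum.inr (x, 1)) (Sum.inl ())

/-- The reduced suspension of `X₊` (`X` with a disjoint base point): `X × [0,1]` with
`X × {0,1}` collapsed to the base point; a single point when `X` is empty. -/
def Susp (X : Type*) : Type _ := Quot (SuspRel X)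

instance (X : Type*) [TopologicalSpace X] : TopologicalSpace (Susp X) :=
  inferInstanceAs (TopologicalSpace (Quot (SuspRel X)))

instance (X : Type*) : BasePt (Susp X) := ⟨Quot.mk _ (Sum.inl ())⟩

namespace Susp

/-- The point `[x, t]` of the suspension. -/
def mk {X : Type*} (x : X) (t : unitInterval) : Susp X := Quot.mk _ (Sum.inr (x, t))

theorem mk_zero {X : Type*} (x : X) : mk x 0 = pt := Quot.sound (SuspRel.bot x)

theorem mk_one {X : Type*} (x : X) : mk x 1 = pt := Quot.sound (SuspRel.top x)

/-- The suspension of (the pointed extension of) a map: `[x, t] ↦ [f x, t]`. -/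
def map {X Y : Type*} (f : X → Y) : Susp X → Susp Y :=
  Quot.lift (Sum.elim (fun _ => pt) (fun p => mk (f p.1) p.2)) (by
    rintro _ _ (x | x)
    · exact mk_zero (f x)
    · exact mk_one (f x))

/-- The difference `α - β` of two pointed maps out of a suspension, with respect to the
cogroup structure of the suspension: run through `α`, then backwards through `β`. -/
def sub {X B : Type*} [BasePt B] (α β : Susp X → B) (hα : α pt = pt) (hβ : β pt = pt) :
    Susp X → B :=
  Quot.lift (Sum.elim (fun _ => pt) (fun p =>
      if (p.2 : ℝ) ≤ 1 / 2 then α (mk p.1 (projIcc 0 1 zero_le_one (2 * (p.2 : ℝ))))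
      else β (mk p.1 (projIcc 0 1 zero_le_one (2 - 2 * (p.2 : ℝ)))))) (by
    rintro _ _ (x | x)
    · have h : (projIcc (0 : ℝ) 1 zero_le_one (2 * ((0 : unitInterval) : ℝ))) = 0 := by
        simp [projIcc]
      have h' : ((0 : unitInterval) : ℝ) ≤ 1 / 2 := by simp
      simp only [Sum.elim_inr, Sum.elim_inl]
      rw [if_pos h', h, mk_zero, hα]
    · have h : (projIcc (0 : ℝ) 1 zero_le_one (2 - 2 * ((1 : unitInterval) : ℝ))) = 0 := by
        simp [projIcc]
      have h' : ¬ ((1 : unitInterval) : ℝ) ≤ 1 / 2 := by norm_num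
      simp only [Sum.elim_inr, Sum.elim_inl]
      rw [if_neg h', h, mk_zero, hβ])

end Susp

end Susp

section Wedge

variable {κ : Type*} (A : κ → Type*) [∀ k, BasePt (A k)]

/-- The gluing that defines the wedge. -/
inductive WedgeRel : Unit ⊕ (Σ k, A k) → Unit ⊕ (Σ k, A k) → Prop
  | glue (k : κ) : WedgeRel (Sum.inr ⟨k, pt⟩) (Sum.inl ())

/-- The wedge of a family of pointed spaces (a point for the empty family). -/
def Wedge : Type _ := Quot (WedgeRel A)

instance [∀ k, TopologicalSpace (A k)] : TopologicalSpace (Wedge A) :=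
  inferInstanceAs (TopologicalSpace (Quot (WedgeRel A)))

instance : BasePt (Wedge A) := ⟨Quot.mk _ (Sum.inl ())⟩

/-- The inclusion of a wedge summand. -/
def Wedge.incl (k : κ) (a : A k) : Wedge A := Quot.mk _ (Sum.inr ⟨k, a⟩)

theorem Wedge.incl_pt (k : κ) : Wedge.incl A k pt = pt := Quot.sound (WedgeRel.glue k)

variable {A}

/-- The map out of a wedge that is `f k` on the summand labelled by `k`. -/
def Wedge.desc {B : Type*} [BasePt B] (f : ∀ k, A k → B) (hf : ∀ k, f k pt = pt) :
    Wedge A → B :=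
  Quot.lift (Sum.elim (fun _ => pt) (fun p => f p.1 p.2)) (by
    rintro _ _ ⟨k⟩
    exact hf k)

end Wedge

section Cone

/-- The gluing that defines the mapping cone: `(x, 0)` is the tip and `(x, 1)` is `f x`. -/
inductive ConeRel {X Y : Type*} (f : X → Y) :
    Unit ⊕ (X × unitInterval ⊕ Y) → Unit ⊕ (X × unitInterval ⊕ Y) → Prop
  | tip (x : X) : ConeRel f (Sum.inr (Sum.inl (x, 0))) (Sum.inl ())
  | base (x : X) : ConeRel f (Sum.inr (Sum.inl (x, 1))) (Sum.inr (Sum.inr (f x)))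

/-- The mapping cone of `f`, pointed by the tip of the cone; it is `Y` with a disjoint
base point when `X` is empty. -/
def Cone {X Y : Type*} (f : X → Y) : Type _ := Quot (ConeRel f)

instance {X Y : Type*} [TopologicalSpace X] [TopologicalSpace Y] (f : X → Y) :
    TopologicalSpace (Cone f) := inferInstanceAs (TopologicalSpace (Quot (ConeRel f)))

instance {X Y : Type*} (f : X → Y) : BasePt (Cone f) := ⟨Quot.mk _ (Sum.inl ())⟩

namespace Cone

variable {X Y : Type*} (f : X → Y)

/-- The point `(x, t)` on the cone over `X`. -/
def mk (x : X) (t : unitInterval) : Cone f := Quot.mk _ (Sum.inr (Sum.inl (x, t)))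

/-- The base `Y` of the mapping cone. -/
def base (y : Y) : Cone f := Quot.mk _ (Sum.inr (Sum.inr y))

theorem mk_zero (x : X) : mk f x 0 = pt := Quot.sound (ConeRel.tip x)

theorem mk_one (x : X) : mk f x 1 = base f (f x) := Quot.sound (ConeRel.base x)

/-- The boundary map: it collapses the base `Y` of the mapping cone to the base point. -/
def boundary : Cone f → Susp X :=
  Quot.lift (Sum.elim (fun _ => pt) (Sum.elim (fun p => Susp.mk p.1 p.2) (fun _ => pt))) (by
    rintro _ _ (x | x)
    · exact Susp.mk_zero x
    · exact Susp.mk_one x)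

variable {f}

/-- The map of mapping cones induced by a commutative square. -/
def map {X' Y' : Type*} {f' : X' → Y'} (a : X → X') (b : Y → Y')
    (h : ∀ x, b (f x) = f' (a x)) : Cone f → Cone f' :=
  Quot.lift (Sum.elim (fun _ => pt) (Sum.elim (fun p => mk f' (a p.1) p.2)
      (fun y => base f' (b y)))) (by
    rintro _ _ (x | x)
    · exact mk_zero f' (a x)
    · exact (mk_one f' (a x)).trans (congrArg _ (h x).symm))

end Cone

end Cone

/-- A graph (multiple edges and loops are allowed) with vertices `V` and edges `E`; each edge
is parametrized by `[0,1]`, running from `ends e false` to `ends e true`. -/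
structure MGraph (V E : Type*) where
  ends : E → Bool → V

namespace MGraph

variable {V E : Type*} (G : MGraph V E)

/-- The points of the geometric realization: vertices, and interior points of edges. -/
inductive Point {V E : Type*} (G : MGraph V E) : Type _
  | vert (w : V) : Point G
  | inner (e : E) (s : Ioo (0 : ℝ) 1) : Point G

/-- The characteristic map `[0,1] → Γ` of the edge `e`. -/
def edgeMap (e : E) (s : unitInterval) : G.Point :=
  if h0 : (s : ℝ) = 0 then Point.vert (G.ends e false)
  else if h1 : (s : ℝ) = 1 then Point.vert (G.ends e true)
  else Point.inner e ⟨s, lt_of_le_of_ne s.2.1 (Ne.symm h0), lt_of_le_of_ne s.2.2 h1⟩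

/-- The topology of the CW complex: a set is open iff its preimage under every
characteristic map is open in `[0,1]`. -/
instance : TopologicalSpace G.Point :=
  ⨆ e, TopologicalSpace.coinduced (G.edgeMap e) inferInstance

/-- No edge is a loop at `v`. -/
def NoLoopAt (v : V) : Prop := ∀ e, ¬ (G.ends e false = v ∧ G.ends e true = v)

/-- A half-edge at `v`: an incident pair `(v, e)`. -/
def HalfEdge (v : V) : Type _ := {e : E // ∃ b, G.ends e b = v}

/-- The edge `e(h)` of a half-edge. -/
def HalfEdge.edge {G : MGraph V E} {v : V} (h : G.HalfEdge v) : E := h.1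

open Classical in
/-- The distance to `v`, cut off at `1`, where all edges have length `1`. -/
def dist (v : V) : G.Point → ℝ
  | Point.vert w => if w = v then 0 else 1
  | Point.inner e s => min (if G.ends e false = v then (s : ℝ) else 1)
      (if G.ends e true = v then 1 - (s : ℝ) else 1)

/-- The open ball of radius `1/2` around `v`. -/
def ball (v : V) : Set G.Point := {x | G.dist v x < 1 / 2}

variable {G} {v : V}

/-- The half-edge `h` as a subspace of `Γ`: the points in the interior of `e(h)` at distance
less than `1/2` from `v`. -/
def HalfEdge.carrier (h : G.HalfEdge v) : Set G.Point :=
  {x | (∃ s, x = Point.inner h.edge s) ∧ G.dist v x < 1 / 2}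

/-- The midpoint of the edge `e(h)`: the point of `e(h)` outside `h` closest to `v`. -/
def HalfEdge.mid (h : G.HalfEdge v) : G.Point := Point.inner h.edge ⟨1 / 2, by norm_num, by norm_num⟩

/-- The union of the half-edges in `H`. -/
def cup (H : Set (G.HalfEdge v)) : Set G.Point := ⋃ h ∈ H, h.carrier

open Classical in
/-- The parameter on `e` after `e` has been scaled down, away from `v`, to the half of `e`
that is far from `v`; edges not incident to `v` are not changed. -/
def pushParam (G : MGraph V E) (v : V) (e : E) (s : Ioo (0 : ℝ) 1) : Ioo (0 : ℝ) 1 :=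
  if G.ends e false = v then ⟨(1 + s) / 2, by constructor <;> linarith [s.2.1, s.2.2]⟩
  else if G.ends e true = v then ⟨s / 2, by constructor <;> linarith [s.2.1, s.2.2]⟩
  else s

/-- The embedding of `Γ ∖ {v}` into the complement of the closed ball of radius `1/2`
around `v` that scales all edges at `v` away from `v` (its value at `v` is irrelevant). -/
def push (G : MGraph V E) (v : V) : G.Point → G.Point
  | Point.vert w => Point.vert w
  | Point.inner e s => Point.inner e (pushParam G v e s)

theorem push_injective : Injective (push G v) := by
  rintro (w | ⟨e, s⟩) (w' | ⟨e', s'⟩) h <;> simp only [push, Point.vert.injEq, reduceCtorEq,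
    Point.inner.injEq] at h ⊢
  · exact h
  · obtain ⟨rfl, h⟩ := h
    refine ⟨rfl, ?_⟩
    unfold pushParam at h
    split_ifs at h
    · rw [Subtype.ext_iff] at h ⊢; simp only at h; linarith
    · rw [Subtype.ext_iff] at h ⊢; simp only at h; linarith
    · exact h

theorem lt_dist_push (hv : G.NoLoopAt v) {x : G.Point} (hx : x ≠ Point.vert v) :
    1 / 2 < G.dist v (push G v x) := by
  rcases x with w | ⟨e, s⟩
  · have : w ≠ v := fun h => hx (by rw [h])
    simp only [push, dist, if_neg this]; norm_num
  · have h0 := s.2.1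
    have h1 := s.2.2
    have := hv e
    simp only [push, dist, pushParam]
    by_cases ha : G.ends e false = v <;> by_cases hb : G.ends e true = v
    · exact absurd ⟨ha, hb⟩ this
    · simp only [ha, hb, if_true, if_false, lt_min_iff]; constructor <;> linarith
    · simp only [ha, hb, if_true, if_false, lt_min_iff]; constructor <;> linarith
    · simp only [ha, hb, if_false, lt_min_iff]; norm_num

theorem dist_vert_self : G.dist v (Point.vert v) = 0 := by simp [dist]

theorem dist_mid (hv : G.NoLoopAt v) (h : G.HalfEdge v) : G.dist v h.mid = 1 / 2 := by
  obtain ⟨e, b, hb⟩ := h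
  have := hv e
  simp only [HalfEdge.mid, HalfEdge.edge, dist]
  cases b
  · rw [if_pos hb, if_neg (fun h => this ⟨hb, h⟩)]; norm_num
  · rw [if_pos hb, if_neg (fun h => this ⟨h, hb⟩)]; norm_num

theorem mem_compl_cup {H : Set (G.HalfEdge v)} {x : G.Point} (hx : 1 / 2 ≤ G.dist v x) :
    x ∈ (cup H)ᶜ := by
  simp only [cup, mem_compl_iff, mem_iUnion, not_exists]
  intro h _ hm
  exact absurd hm.2 (not_lt.mpr hx)

theorem vert_mem_compl_cup {H : Set (G.HalfEdge v)} : (Point.vert v : G.Point) ∈ (cup H)ᶜ := by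
  simp only [cup, mem_compl_iff, mem_iUnion, not_exists]
  rintro h _ ⟨⟨s, hs⟩, _⟩
  cases hs

theorem vert_mem_ball : (Point.vert v : G.Point) ∈ G.ball v := by
  simp only [ball, mem_ofPred_eq, dist_vert_self]; norm_num

section Conf

variable (ι : Type*)

/-- Ordered configurations in the subspace `A`, with labels in `ι`. -/
def conf (A : Set G.Point) : Set (ι → G.Point) := {c | Injective c ∧ ∀ i, c i ∈ A}

/-- Ordered configurations in the subspace `A` with no more than one point in `U`. -/
def confOne (A U : Set G.Point) : Set (ι → G.Point) :=
  {c | c ∈ conf ι A ∧ ∀ i j, c i ∈ U → c j ∈ U → i = j}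

variable {ι}

/-- The action of relabellings on configurations. -/
def relabel {κ : Type*} {A : Set G.Point} (f : ι ≃ κ) (c : conf ι A) : conf κ A :=
  ⟨fun k => c.1 (f.symm k), c.2.1.comp f.symm.injective, fun _ => c.2.2 _⟩

/-- The action of relabellings on configurations with no more than one point in `U`. -/
def relabelOne {κ : Type*} {A U : Set G.Point} (f : ι ≃ κ) (c : confOne ι A U) :
    confOne κ A U :=
  ⟨fun k => c.1 (f.symm k), ⟨c.2.1.1.comp f.symm.injective, fun _ => c.2.1.2 _⟩,
    fun _ _ hi hj => f.symm.injective (c.2.2 _ _ hi hj)⟩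

/-- The configuration that remains of `c` when only the labels `f k` are kept, where the
points at the labels `f k` differ from the point `c i` in the ball. -/
def forget {κ : Type*} (c : confOne ι (univ : Set G.Point) (G.ball v)) (i : ι)
    (hi : c.1 i ∈ G.ball v) (f : κ → ι) (hf : Injective f) (hfi : ∀ k, f k ≠ i) :
    conf κ ({Point.vert v}ᶜ : Set G.Point) :=
  ⟨fun k => c.1 (f k), c.2.1.1.comp hf, fun k hk => hfi k
    (c.2.2 _ _ (by
      have hk' : c.1 (f k) = Point.vert v := hk
      rw [hk']; exact vert_mem_ball) hi)⟩

end Conf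

variable (H : Set (G.HalfEdge v))

section Inclusions

variable (ι : Type*)

theorem conf_sub : conf ι (cup H)ᶜ ⊆ conf ι (univ : Set G.Point) :=
  fun _ hc => ⟨hc.1, fun _ => mem_univ _⟩

theorem confOne_sub :
    confOne ι (cup H)ᶜ (G.ball v \ cup H) ⊆ confOne ι (univ : Set G.Point) (G.ball v) :=
  fun _ hc => ⟨conf_sub H ι hc.1,
    fun i j hi hj => hc.2 i j ⟨hi, hc.1.2 i⟩ ⟨hj, hc.1.2 j⟩⟩

theorem confOne_sub_conf (A U : Set G.Point) : confOne ι A U ⊆ conf ι A := fun _ hc => hc.1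

end Inclusions

section Ordered

variable (ι : Type*)

/-- `ι_H : Conf(Γ ∖ ∪H) → Conf(Γ)`, for ordered configurations labelled by `ι`. -/
def incl : conf ι (cup H)ᶜ → conf ι (univ : Set G.Point) := inclusion (conf_sub H ι)

/-- `Conf_{-,1}(Γ ∖ ∪H, U ∖ ∪H) → Conf_{-,1}(Γ, U)`, with `U` the ball of radius `1/2`. -/
def inclOne : confOne ι (cup H)ᶜ (G.ball v \ cup H) → confOne ι (univ : Set G.Point) (G.ball v) :=
  inclusion (confOne_sub H ι)

/-- The inclusion of the mapping cone of configurations with at most one point in `U`. -/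
def coneIncl : Cone (inclOne H ι) → Cone (incl H ι) :=
  Cone.map (inclusion (confOne_sub_conf ι _ _)) (inclusion (confOne_sub_conf ι _ _))
    (fun _ => rfl)

open Classical in
/-- Put the new point `x` at the label `i`, after scaling the configuration `z` in `Γ ∖ {v}`
away from `v`. -/
def addAt (hv : G.NoLoopAt v) {ι : Type*} (i : ι) (x : G.Point) (hx : x ∈ (cup H)ᶜ)
    (hd : G.dist v x ≤ 1 / 2) (z : conf {j : ι // j ≠ i} ({Point.vert v}ᶜ : Set G.Point)) :
    conf ι (cup H)ᶜ :=
  ⟨fun j => if h : j = i then x else push G v (z.1 ⟨j, h⟩), by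
    have hp : ∀ j, 1 / 2 < G.dist v (push G v (z.1 j)) := fun j => lt_dist_push hv (z.2.2 j)
    constructor
    · intro j k hjk
      simp only at hjk
      split_ifs at hjk with h1 h2 h2
      · exact h1.trans h2.symm
      · have := hp ⟨k, h2⟩; rw [← hjk] at this; exact absurd hd (not_le.mpr this)
      · have := hp ⟨j, h1⟩; rw [hjk] at this; exact absurd hd (not_le.mpr this)
      · exact congrArg Subtype.val (z.2.1 (push_injective hjk))
    · intro j
      simp only
      split_ifs with h1
      · exact hx
      · exact mem_compl_cup (hp _).le⟩

/-- `add_v`: add the vertex `v`, with label `i`. -/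
def addV (hv : G.NoLoopAt v) {ι : Type*} (i : ι) :
    conf {j : ι // j ≠ i} ({Point.vert v}ᶜ : Set G.Point) → conf ι (cup H)ᶜ :=
  addAt H hv i (Point.vert v) vert_mem_compl_cup (by rw [dist_vert_self]; norm_num)

/-- `add_h`: add a new point on `e(h)`, closer to `v` than all other points on `e(h)`,
with label `i`. -/
def addH (hv : G.NoLoopAt v) {ι : Type*} (i : ι) (h : G.HalfEdge v) :
    conf {j : ι // j ≠ i} ({Point.vert v}ᶜ : Set G.Point) → conf ι (cup H)ᶜ :=
  addAt H hv i h.mid (mem_compl_cup (dist_mid hv h).ge) (dist_mid hv h).le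

/-- The wedge, over a label `i` and `h ∈ H`, of the reduced suspensions of `Z₊`, where `Z` is the
space of ordered configurations in `Γ ∖ {v}` labelled by `ι ∖ {i}`. For `ι = [n]` this is the
wedge over `H` of the suspensions of `Conf_{n-1}(Γ ∖ {v})₊`, induced from `S_{n-1}` to `S_n`. -/
abbrev SuspWedge : Type _ :=
  Wedge (fun k : ι × H => Susp (conf {j : ι // j ≠ k.1} ({Point.vert v}ᶜ : Set G.Point)))

/-- The map that forgets the point on a half-edge of `H` and makes twice its distance to `v` the
suspension parameter; configurations without such a point, and the cone, go to the base point. -/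
def IsForgetMap (P : Cone (inclOne H ι) → SuspWedge H ι) : Prop :=
  P pt = pt ∧ (∀ c t, P (Cone.mk _ c t) = pt) ∧
  (∀ c, (∀ i, c.1 i ∉ cup H) → P (Cone.base _ c) = pt) ∧
  ∀ (c : confOne ι (univ : Set G.Point) (G.ball v)) (i : ι) (h : H)
    (hi : c.1 i ∈ h.1.carrier) (t : unitInterval), (t : ℝ) = 2 * G.dist v (c.1 i) →
    P (Cone.base _ c) =
      Wedge.incl _ (i, h) (Susp.mk (forget c i hi.2 (fun j : {j : ι // j ≠ i} => (j : ι))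
        Subtype.val_injective (fun j => j.2)) t)

/-- The action of permutations of the labels on `Cone(ι_H)`. -/
def permCone (σ : Equiv.Perm ι) : Cone (incl H ι) → Cone (incl H ι) :=
  Cone.map (relabel σ) (relabel σ) (fun _ => rfl)

/-- The action of permutations on the cone of `Conf_{-,1}`. -/
def permConeOne (σ : Equiv.Perm ι) : Cone (inclOne H ι) → Cone (inclOne H ι) :=
  Cone.map (relabelOne σ) (relabelOne σ) (fun _ => rfl)

/-- The action of permutations on the suspension of `Conf(Γ ∖ ∪H)₊`. -/
def permSusp (σ : Equiv.Perm ι) : Susp (conf ι (cup H)ᶜ) → Susp (conf ι (cup H)ᶜ) :=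
  Susp.map (relabel σ)

/-- The action of permutations on the wedge: `σ` takes the summand `(i, h)` to `(σ i, h)`. -/
def permWedge (σ : Equiv.Perm ι) : SuspWedge H ι → SuspWedge H ι :=
  Wedge.desc (fun k z => Wedge.incl _ (σ k.1, k.2)
      (Susp.map (relabel (σ.subtypeEquiv (fun j => (σ.injective.ne_iff (x := j)).symm))) z))
    (fun k => Wedge.incl_pt _ (σ k.1, k.2))

/-- The map that is `Σ add_v - Σ add_h` on the wedge summand `(i, h)`. -/
def diffMap (hv : G.NoLoopAt v) : SuspWedge H ι → Susp (conf ι (cup H)ᶜ) :=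
  Wedge.desc (fun k => Susp.sub (Susp.map (addV H hv k.1)) (Susp.map (addH H hv k.1 k.2.1))
    rfl rfl) (fun _ => rfl)

end Ordered

section Unordered

/-- Two ordered configurations differ by a permutation of the labels. -/
def permSetoid {ι : Type*} (S : Set (ι → G.Point)) : Setoid S where
  r c c' := ∃ σ : Equiv.Perm ι, ∀ i, c'.1 i = c.1 (σ i)
  iseqv := ⟨fun _ => ⟨1, fun _ => rfl⟩,
    fun ⟨σ, h⟩ => ⟨σ⁻¹, fun i => by simp [h]⟩,
    fun ⟨σ, h⟩ ⟨τ, h'⟩ => ⟨σ * τ, fun i => by simp [h, h']⟩⟩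

/-- The unordered version of a space of ordered configurations: the orbit space of the
permutations of the labels. -/
def Unord {ι : Type*} (S : Set (ι → G.Point)) : Type _ := Quotient (permSetoid S)

instance {ι : Type*} (S : Set (ι → G.Point)) : TopologicalSpace (Unord S) :=
  inferInstanceAs (TopologicalSpace (Quotient (permSetoid S)))

/-- The unordered configuration underlying an ordered one. -/
def Unord.mk {ι : Type*} {S : Set (ι → G.Point)} (c : S) : Unord S := Quotient.mk (permSetoid S) c

/-- The inclusion of spaces of unordered configurations. -/
def Unord.incl {ι : Type*} {S T : Set (ι → G.Point)} (h : S ⊆ T) : Unord S → Unord T :=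
  Quotient.lift (fun c => Unord.mk (inclusion h c))
    (fun _ _ ⟨σ, hσ⟩ => Quotient.sound ⟨σ, hσ⟩)

variable (n : ℕ)

/-- `ι_H : UConf_n(Γ ∖ ∪H) → UConf_n(Γ)`. -/
def uincl : Unord (conf (Fin n) (cup H)ᶜ) → Unord (conf (Fin n) (univ : Set G.Point)) :=
  Unord.incl (conf_sub H (Fin n))

/-- `UConf_{n,1}(Γ ∖ ∪H, U ∖ ∪H) → UConf_{n,1}(Γ, U)`, with `U` the ball of radius `1/2`. -/
def uinclOne : Unord (confOne (Fin n) (cup H)ᶜ (G.ball v \ cup H)) →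
    Unord (confOne (Fin n) (univ : Set G.Point) (G.ball v)) :=
  Unord.incl (confOne_sub H (Fin n))

/-- The inclusion of the mapping cone of configurations with at most one point in `U`. -/
def uconeIncl : Cone (uinclOne H n) → Cone (uincl H n) :=
  Cone.map (Unord.incl (confOne_sub_conf (Fin n) _ _)) (Unord.incl (confOne_sub_conf (Fin n) _ _))
    (fun x => Quotient.inductionOn x (fun _ => rfl))

/-- Add the new point `x` to an unordered configuration, after scaling the configuration in
`Γ ∖ {v}` away from `v`. -/
def uaddAt (hv : G.NoLoopAt v) (x : G.Point) (hx : x ∈ (cup H)ᶜ) (hd : G.dist v x ≤ 1 / 2) :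
    Unord (conf (Fin n) ({Point.vert v}ᶜ : Set G.Point)) → Unord (conf (Fin (n + 1)) (cup H)ᶜ) :=
  Quotient.lift (fun z => Unord.mk ⟨Fin.cons x (fun j => push G v (z.1 j)), by
    have hp : ∀ j, 1 / 2 < G.dist v (push G v (z.1 j)) := fun j => lt_dist_push hv (z.2.2 j)
    constructor
    · rw [Fin.cons_injective_iff]
      refine ⟨?_, push_injective.comp z.2.1⟩
      rintro ⟨j, hj⟩
      have := hp j
      simp only at hj
      rw [hj] at this
      exact absurd hd (not_le.mpr this)
    · intro j
      refine Fin.cases ?_ (fun j => ?_) j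
      · exact hx
      · exact mem_compl_cup (hp j).le⟩)
    (fun _ _ ⟨σ, hσ⟩ => Quotient.sound ⟨Equiv.Perm.decomposeFin.symm (0, σ), fun j => by
      refine Fin.cases ?_ (fun j => ?_) j
      · simp
      · simp [hσ]⟩)

/-- `add_v`: add the vertex `v`. -/
def uaddV (hv : G.NoLoopAt v) :
    Unord (conf (Fin n) ({Point.vert v}ᶜ : Set G.Point)) → Unord (conf (Fin (n + 1)) (cup H)ᶜ) :=
  uaddAt H n hv (Point.vert v) vert_mem_compl_cup (by rw [dist_vert_self]; norm_num)

/-- `add_h`: add a new point on `e(h)`, closer to `v` than all other points on `e(h)`. -/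
def uaddH (hv : G.NoLoopAt v) (h : G.HalfEdge v) :
    Unord (conf (Fin n) ({Point.vert v}ᶜ : Set G.Point)) → Unord (conf (Fin (n + 1)) (cup H)ᶜ) :=
  uaddAt H n hv h.mid (mem_compl_cup (dist_mid hv h).ge) (dist_mid hv h).le

/-- The wedge over `h ∈ H` of the reduced suspensions of `UConf_n(Γ ∖ {v})₊`. -/
abbrev USuspWedge : Type _ :=
  Wedge (fun _ : H => Susp (Unord (conf (Fin n) ({Point.vert v}ᶜ : Set G.Point))))

/-- The map that forgets the point on a half-edge of `H` and makes twice its distance to `v` the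
suspension parameter; configurations without such a point, and the cone, go to the base point. -/
def IsUForgetMap (P : Cone (uinclOne H (n + 1)) → USuspWedge H n) : Prop :=
  P pt = pt ∧ (∀ c t, P (Cone.mk _ c t) = pt) ∧
  (∀ c : confOne (Fin (n + 1)) (univ : Set G.Point) (G.ball v),
    (∀ i, c.1 i ∉ cup H) → P (Cone.base _ (Unord.mk c)) = pt) ∧
  ∀ (c : confOne (Fin (n + 1)) (univ : Set G.Point) (G.ball v)) (i : Fin (n + 1)) (h : H)
    (hi : c.1 i ∈ h.1.carrier) (t : unitInterval), (t : ℝ) = 2 * G.dist v (c.1 i) →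
    P (Cone.base _ (Unord.mk c)) =
      Wedge.incl _ h (Susp.mk (Unord.mk (forget c i hi.2 i.succAbove
        i.succAbove_right_injective (fun j => i.succAbove_ne j))) t)

end Unordered

end MGraph

end GraphConf

end

/-! Everything is done with ordered configurations, equivariantly under relabelling; the unordered
statement follows by passing to orbit spaces (`EqPtdHomotopic.descend`,
`IsEqPtdHomotopyEquiv.descend`), once the cones and the wedge of unordered configurations are known
to be orbit spaces of the ordered ones (`Cone.isOrbitMap_map`, `isOrbitMap_wedgeToUnord`).

All movements are radial. As no edge is a loop at `v`, a point inside an edge at `v` is given by a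
half-edge and a distance, and `place` changes the distance only. A function with `IsProfile` may
crush the ball of radius `1/2`, but keeps the points outside it apart from each other and from the
ball; hence it acts on configurations with at most one point in the ball (`radial_mem_confOne`) and
preserves the complement of `∪H`.

`J` is an equivalence because a configuration can be expanded away from `v` until at most one point
is left in the ball. The amount is controlled by `gap`, a continuous symmetric positive function
that bounds the second smallest distance to `v` from below (`isEqPtdHomotopyEquiv_coneIncl`).

`P` is an equivalence because a configuration with at most one point in the ball that meets `∪H`
consists of one point on one half-edge `h ∈ H` and a configuration in `Γ ∖ {v}`, while the
configurations that miss `∪H` are coned off. The homotopy inverse `insertMap` is explicit. At `[z,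
t]` the points of `z` are pushed out of the ball and a new point is added: it waits at `v` while the
cone parameter rises from `0` to `1`, runs along `h` from `v` to the midpoint, and waits there while
the cone parameter falls back to `0`. The profile `outward` gives the position of the new point and
`bump` gives the cone parameter. Both composites are homotopic to the identity by linear
interpolation of distances and parameters (`forgetMap_comp_insertMap`, `insertMap_comp_forgetMap`).

With the identification `φ = J ∘ insertMap`, the boundary formula can be read off: the boundary map
forgets the stage inside `h` and keeps the two waiting stages, which are the suspension of `add_v`
run forwards and that of `add_h` run backwards. Only the speed has to be adjusted
(`boundary_comp_insertMap`). -/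

noncomputable section

namespace GraphConf

open Topology

/-! ### Equivariant pointed homotopies and their descent to orbit spaces -/

section Homotopy

variable {S A B C : Type*} [TopologicalSpace A] [TopologicalSpace B] [TopologicalSpace C]
  [BasePt A] [BasePt B] [BasePt C] {ρA : S → A → A} {ρB : S → B → B} {ρC : S → C → C}

namespace EqPtdHomotopic

theorem symm {f g : A → B} (h : EqPtdHomotopic ρA ρB f g) : EqPtdHomotopic ρA ρB g f := by
  obtain ⟨F, hF, h0, h1, hp, he⟩ := h
  refine ⟨fun p => F (p.1, unitInterval.symm p.2), by fun_prop, fun a => ?_, fun a => ?_,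
    fun t => hp _, fun t => he (unitInterval.symm t)⟩
  · simp [h1]
  · simp [h0]

theorem trans {f g k : A → B} (h : EqPtdHomotopic ρA ρB f g) (h' : EqPtdHomotopic ρA ρB g k) :
    EqPtdHomotopic ρA ρB f k := by
  obtain ⟨F, hF, h0, h1, hp, he⟩ := h
  obtain ⟨F', hF', h0', h1', hp', he'⟩ := h'
  refine ⟨fun p => if (p.2 : ℝ) ≤ 1 / 2 then F (p.1, projIcc 0 1 zero_le_one (2 * (p.2 : ℝ)))
    else F' (p.1, projIcc 0 1 zero_le_one (2 * (p.2 : ℝ) - 1)), ?_, fun a => ?_, fun a => ?_,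
    fun t => ?_, fun t s a => ?_⟩
  · refine Continuous.if_le ?_ ?_ (by fun_prop) continuous_const ?_
    · exact hF.comp (continuous_fst.prodMk (continuous_projIcc.comp (by fun_prop)))
    · exact hF'.comp (continuous_fst.prodMk (continuous_projIcc.comp (by fun_prop)))
    · rintro ⟨a, t⟩ ht
      simp only at ht ⊢
      rw [ht, projIcc_of_right_le _ (by norm_num), projIcc_of_le_left _ (by norm_num)]
      exact (h1 a).trans (h0' a).symm
  · simp only [Icc.coe_zero]
    rw [if_pos (by norm_num), projIcc_of_le_left _ (by norm_num)]
    exact h0 a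
  · simp only [Icc.coe_one]
    rw [if_neg (by norm_num), projIcc_of_right_le _ (by norm_num)]
    exact h1' a
  · simp only
    split_ifs
    · exact hp _
    · exact hp' _
  · simp only
    split_ifs
    · exact he _ s a
    · exact he' _ s a

theorem comp_left {f g : A → B} (h : EqPtdHomotopic ρA ρB f g) {k : B → C} (hk : Continuous k)
    (hp : k pt = pt) (he : IsEquivariant ρB ρC k) : EqPtdHomotopic ρA ρC (k ∘ f) (k ∘ g) := by
  obtain ⟨F, hF, h0, h1, hFp, hFe⟩ := h
  refine ⟨k ∘ F, hk.comp hF, fun a => by simp [h0], fun a => by simp [h1], fun t => ?_,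
    fun t s a => ?_⟩
  · simp only [comp_apply, hFp, hp]
  · have := hFe t s a
    simp only [comp_apply] at this ⊢
    rw [this, he]

theorem comp_right {f g : B → C} (h : EqPtdHomotopic ρB ρC f g) {k : A → B} (hk : Continuous k)
    (hp : k pt = pt) (he : IsEquivariant ρA ρB k) : EqPtdHomotopic ρA ρC (f ∘ k) (g ∘ k) := by
  obtain ⟨F, hF, h0, h1, hFp, hFe⟩ := h
  refine ⟨fun p => F (k p.1, p.2), by fun_prop, fun a => by simp [h0], fun a => by simp [h1],
    fun t => by simp only [hp, hFp], fun t s a => ?_⟩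
  have := hFe t s (k a)
  simp only at this ⊢
  rw [he, this]

end EqPtdHomotopic

theorem IsEqPtdHomotopyEquiv.comp {f : A → B} {k : B → C} (hk : IsEqPtdHomotopyEquiv ρB ρC k)
    (hf : IsEqPtdHomotopyEquiv ρA ρB f) : IsEqPtdHomotopyEquiv ρA ρC (k ∘ f) := by
  obtain ⟨hfc, hfp, hfe, g, hgc, hgp, hge, hgf, hfg⟩ := hf
  obtain ⟨hkc, hkp, hke, l, hlc, hlp, hle, hlk, hkl⟩ := hk
  refine ⟨hkc.comp hfc, by simp [hfp, hkp], fun s a => by simp [hfe s, hke s], g ∘ l,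
    hgc.comp hlc, by simp [hgp, hlp], fun s a => by simp [hle s, hge s], ?_, ?_⟩
  · exact ((hlk.comp_right hfc hfp hfe).comp_left hgc hgp hge).trans hgf
  · exact ((hfg.comp_right hlc hlp hle).comp_left hkc hkp hke).trans hkl

/-- `q` is a continuous pointed map that is invariant under the operators `ρA s`. -/
structure IsInvariant {A' : Type*} [TopologicalSpace A'] [BasePt A'] (ρA : S → A → A)
    (q : A → A') : Prop where
  continuous : Continuous q
  map_pt : q pt = pt
  map_op : ∀ s a, q (ρA s a) = q a

/-- `q` exhibits `A'` as the orbit space of `A` under the operators `ρA s`. -/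
structure IsOrbitMap {A' : Type*} [TopologicalSpace A'] [BasePt A'] (ρA : S → A → A)
    (q : A → A') : Prop extends IsInvariant ρA q where
  isQuotientMap : IsQuotientMap q
  exists_op : ∀ a b, q a = q b → ∃ s, ρA s a = b

section Orbit

variable {A' B' : Type*} [TopologicalSpace A'] [BasePt A'] [TopologicalSpace B'] [BasePt B']
  {qA : A → A'} {qB : B → B'}

/-- Two points of a fibre of `qA` differ by an operator, which `f` carries to an operator on `B`,
and `qB` does not see it. So `qB ∘ f` is constant on the fibres of a quotient map. -/
theorem IsOrbitMap.exists_descent (hA : IsOrbitMap ρA qA) (hB : IsInvariant ρB qB) {f : A → B}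
    (hf : Continuous f) (hp : f pt = pt) (he : IsEquivariant ρA ρB f) :
    ∃ f' : A' → B', Continuous f' ∧ f' pt = pt ∧ ∀ a, f' (qA a) = qB (f a) := by
  have key : ∀ a, (qB ∘ f) (surjInv hA.isQuotientMap.surjective (qA a)) = qB (f a) := fun a => by
    obtain ⟨s, hs⟩ := hA.exists_op _ _ (surjInv_eq hA.isQuotientMap.surjective (qA a))
    rw [comp_apply, ← hB.map_op s, ← he s, hs]
  refine ⟨fun a => qB (f (surjInv hA.isQuotientMap.surjective a)), ?_, ?_, key⟩
  · rw [hA.isQuotientMap.continuous_iff]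
    exact (hB.continuous.comp hf).congr fun a => (key a).symm
  · rw [← hA.map_pt]
    exact (key pt).trans (by rw [hp, hB.map_pt])

/-- Each stage of the homotopy is constant, after `qB`, on the fibres of `qA`. Joint continuity
holds because the product of `qA` with the locally compact interval is again a quotient map. On the
target side invariance suffices, so the suspension that receives the boundary map need not be shown
to be an orbit space. -/
theorem EqPtdHomotopic.descend (hA : IsOrbitMap ρA qA) (hB : IsInvariant ρB qB) {f g : A → B}
    (h : EqPtdHomotopic ρA ρB f g) {f' g' : A' → B'} (hf : ∀ a, f' (qA a) = qB (f a))
    (hg : ∀ a, g' (qA a) = qB (g a)) : PtdHomotopic f' g' := by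
  obtain ⟨F, hF, h0, h1, hp, he⟩ := h
  have hs := hA.isQuotientMap.surjective
  have key : ∀ a t, qB (F (surjInv hs (qA a), t)) = qB (F (a, t)) := fun a t => by
    obtain ⟨s, h⟩ := hA.exists_op _ _ (surjInv_eq hs (qA a))
    have := he t s (surjInv hs (qA a))
    simp only at this
    rw [h] at this
    rw [this, hB.map_op]
  refine ⟨fun p => qB (F (surjInv hs p.1, p.2)), ?_, hs.forall.2 fun a => ?_,
    hs.forall.2 fun a => ?_, fun t => ?_⟩
  · refine hA.isQuotientMap.continuous_lift_prod_left ?_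
    simp only [key]
    exact hB.continuous.comp hF
  · exact (key a 0).trans (by rw [h0, hf])
  · exact (key a 1).trans (by rw [h1, hg])
  · rw [← hA.map_pt]
    exact (key pt t).trans (by rw [hp, hB.map_pt])

theorem IsEqPtdHomotopyEquiv.descend (hA : IsOrbitMap ρA qA) (hB : IsOrbitMap ρB qB) {f : A → B}
    (h : IsEqPtdHomotopyEquiv ρA ρB f) {f' : A' → B'} (hf : ∀ a, f' (qA a) = qB (f a)) :
    IsPtdHomotopyEquiv f' := by
  obtain ⟨hfc, hfp, hfe, g, hgc, hgp, hge, hgf, hfg⟩ := h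
  obtain ⟨g', hgc', hgp', hg'⟩ := hB.exists_descent hA.toIsInvariant hgc hgp hge
  refine ⟨?_, ?_, g', hgc', hgp', hgf.descend hA hA.toIsInvariant ?_ ?_,
    hfg.descend hB hB.toIsInvariant ?_ ?_⟩
  · rw [hA.isQuotientMap.continuous_iff]
    exact (hB.isQuotientMap.continuous.comp hfc).congr fun a => (hf a).symm
  · rw [← hA.map_pt, hf, hfp, hB.map_pt]
  · intro a; simp [hf, hg']
  · intro a; simp
  · intro a; simp [hf, hg']
  · intro a; simp

end Orbit

theorem PtdHomotopic.comp_right {f g : B → C} (h : PtdHomotopic f g) {k : A → B}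
    (hk : Continuous k) (hp : k pt = pt) : PtdHomotopic (f ∘ k) (g ∘ k) := by
  obtain ⟨F, hF, h0, h1, hFp⟩ := h
  exact ⟨fun p => F (k p.1, p.2), by fun_prop, fun a => by simp [h0], fun a => by simp [h1],
    fun t => by simp only [hp, hFp]⟩

end Homotopy

/-! ### Continuity on closed covers and on sums -/

section Gluing

theorem continuous_of_finite_closed_cover {κ A B : Type*} [Finite κ] [TopologicalSpace A]
    [TopologicalSpace B] {f : A → B} (C : κ → Set A) (hC : ∀ k, IsClosed (C k))
    (hcov : ∀ a, ∃ k, a ∈ C k) (h : ∀ k, Continuous fun a : C k => f a) : Continuous f :=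
  (locallyFinite_of_finite C).continuous (eq_univ_of_forall fun a => mem_iUnion.2 (hcov a)) hC
    fun k => continuousOn_iff_continuous_domRestrict.2 (h k)

theorem continuous_of_two_closed {A B : Type*} [TopologicalSpace A]
    [TopologicalSpace B] {f : A → B} {C D : Set A} (hC : IsClosed C) (hD : IsClosed D)
    (hcov : ∀ a, a ∈ C ∨ a ∈ D) (h : Continuous fun a : C => f a)
    (h' : Continuous fun a : D => f a) : Continuous f :=
  continuous_of_finite_closed_cover (fun b : Bool => cond b C D) (Bool.forall_bool.2 ⟨hD, hC⟩)
    (fun a => (hcov a).elim (fun h => ⟨true, h⟩) fun h => ⟨false, h⟩)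
    (Bool.forall_bool.2 ⟨h', h⟩)

theorem continuous_sum_prod {A A' T B : Type*} [TopologicalSpace A] [TopologicalSpace A']
    [TopologicalSpace T] [TopologicalSpace B] {f : (A ⊕ A') × T → B}
    (h : Continuous fun p : A × T => f (Sum.inl p.1, p.2))
    (h' : Continuous fun p : A' × T => f (Sum.inr p.1, p.2)) : Continuous f := by
  rw [← Homeomorph.sumProdDistrib.symm.isQuotientMap.continuous_iff.symm.eq]
  exact continuous_sum_dom.2 ⟨h, h'⟩

theorem continuous_sigma_prod {κ T B : Type*} {A : κ → Type*} [∀ k, TopologicalSpace (A k)]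
    [TopologicalSpace T] [TopologicalSpace B] {f : (Σ k, A k) × T → B}
    (h : ∀ k, Continuous fun p : A k × T => f (⟨k, p.1⟩, p.2)) : Continuous f := by
  rw [← Homeomorph.sigmaProdDistrib.symm.isQuotientMap.continuous_iff.symm.eq]
  exact continuous_sigma_iff.2 h

end Gluing

/-! ### Maps out of suspensions, wedges and mapping cones -/

section Pieces

variable {T B : Type*} [TopologicalSpace T] [LocallyCompactSpace T] [TopologicalSpace B]

namespace Susp

variable {X : Type*}

theorem cases {p : Susp X → Prop} (h : p pt) (hm : ∀ x t, p (mk x t)) (a : Susp X) : p a := by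
  induction a using Quot.ind with
  | mk a =>
    rcases a with ⟨⟨⟩⟩ | ⟨x, t⟩
    · exact h
    · exact hm x t

/-- The map out of a suspension with prescribed values. -/
def desc (b : B) (F : X → unitInterval → B) (h0 : ∀ x, F x 0 = b) (h1 : ∀ x, F x 1 = b) :
    Susp X → B :=
  Quot.lift (Sum.elim (fun _ => b) fun p => F p.1 p.2) (by
    rintro _ _ (x | x)
    · exact h0 x
    · exact h1 x)

variable [TopologicalSpace X]

theorem isQuotientMap : IsQuotientMap (Quot.mk (SuspRel X)) := isQuotientMap_quot_mk

theorem continuous_mk : Continuous fun p : X × unitInterval => mk p.1 p.2 :=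
  isQuotientMap.continuous.comp continuous_inr

/-- Local compactness of `T` keeps the gluing map a quotient map after taking the product with `T`.
For `T = [0,1]` this is the continuity test for homotopies; the wedge and the cone are treated in
the same way. -/
theorem continuous_prod {F : Susp X × T → B} (h : Continuous fun t => F (pt, t))
    (hm : Continuous fun p : (X × unitInterval) × T => F (mk p.1.1 p.1.2, p.2)) :
    Continuous F :=
  isQuotientMap.continuous_lift_prod_left
    (continuous_sum_prod (h.comp continuous_snd) hm)

theorem continuous_of_mk {F : Susp X → B}
    (hm : Continuous fun p : X × unitInterval => F (mk p.1 p.2)) : Continuous F :=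
  isQuotientMap.continuous_iff.2 (continuous_sum_dom.2 ⟨continuous_of_discreteTopology, hm⟩)

end Susp

namespace Wedge

variable {κ : Type*} {A : κ → Type*} [∀ k, BasePt (A k)]

theorem cases {p : Wedge A → Prop} (h : p pt) (hm : ∀ k a, p (incl A k a)) (a : Wedge A) :
    p a := by
  induction a using Quot.ind with
  | mk a =>
    rcases a with ⟨⟨⟩⟩ | ⟨k, a⟩
    · exact h
    · exact hm k a

variable [∀ k, TopologicalSpace (A k)]

theorem isQuotientMap : IsQuotientMap (Quot.mk (WedgeRel A)) := isQuotientMap_quot_mk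

theorem continuous_incl (k : κ) : Continuous (incl A k) :=
  isQuotientMap.continuous.comp (continuous_inr.comp continuous_sigmaMk)

theorem continuous_prod {F : Wedge A × T → B} (h : Continuous fun t => F (pt, t))
    (hm : ∀ k, Continuous fun p : A k × T => F (incl A k p.1, p.2)) : Continuous F :=
  isQuotientMap.continuous_lift_prod_left
    (continuous_sum_prod (h.comp continuous_snd) (continuous_sigma_prod hm))

theorem continuous_of_incl {F : Wedge A → B} (hm : ∀ k, Continuous fun a => F (incl A k a)) :
    Continuous F :=
  isQuotientMap.continuous_iff.2
    (continuous_sum_dom.2 ⟨continuous_of_discreteTopology, continuous_sigma_iff.2 hm⟩)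

end Wedge

namespace Cone

variable {X Y : Type*} {f : X → Y}

theorem cases {p : Cone f → Prop} (h : p pt) (hm : ∀ x t, p (mk f x t))
    (hb : ∀ y, p (base f y)) (a : Cone f) : p a := by
  induction a using Quot.ind with
  | mk a =>
    rcases a with ⟨⟨⟩⟩ | ⟨x, t⟩ | y
    · exact h
    · exact hm x t
    · exact hb y

variable (f) in
/-- The map out of a mapping cone with prescribed values. -/
def desc (b : B) (F : X → unitInterval → B) (g : Y → B) (h0 : ∀ x, F x 0 = b)
    (h1 : ∀ x, F x 1 = g (f x)) : Cone f → B :=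
  Quot.lift (Sum.elim (fun _ => b) (Sum.elim (fun p => F p.1 p.2) g)) (by
    rintro _ _ (x | x)
    · exact h0 x
    · exact h1 x)

variable [TopologicalSpace X] [TopologicalSpace Y]

theorem isQuotientMap : IsQuotientMap (Quot.mk (ConeRel f)) := isQuotientMap_quot_mk

theorem continuous_mk : Continuous fun p : X × unitInterval => mk f p.1 p.2 :=
  isQuotientMap.continuous.comp (continuous_inr.comp continuous_inl)

theorem continuous_base : Continuous (base f) :=
  isQuotientMap.continuous.comp (continuous_inr.comp continuous_inr)

theorem continuous_prod {F : Cone f × T → B} (h : Continuous fun t => F (pt, t))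
    (hm : Continuous fun p : (X × unitInterval) × T => F (mk f p.1.1 p.1.2, p.2))
    (hb : Continuous fun p : Y × T => F (base f p.1, p.2)) : Continuous F :=
  isQuotientMap.continuous_lift_prod_left
    (continuous_sum_prod (h.comp continuous_snd) (continuous_sum_prod hm hb))

theorem continuous_of_mk_base {F : Cone f → B}
    (hm : Continuous fun p : X × unitInterval => F (mk f p.1 p.2))
    (hb : Continuous fun y => F (base f y)) : Continuous F :=
  isQuotientMap.continuous_iff.2
    (continuous_sum_dom.2 ⟨continuous_of_discreteTopology, continuous_sum_dom.2 ⟨hm, hb⟩⟩)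

end Cone

end Pieces

/-! ### Topology of the graph and movement of points along edges at `v` -/

namespace MGraph

variable {V E : Type*} {G : MGraph V E} {v : V}

theorem edgeMap_zero (e : E) : G.edgeMap e 0 = Point.vert (G.ends e false) := by
  simp [edgeMap]

theorem edgeMap_one (e : E) : G.edgeMap e 1 = Point.vert (G.ends e true) := by
  simp [edgeMap]

theorem edgeMap_projIcc (e : E) (s : Ioo (0 : ℝ) 1) :
    G.edgeMap e (projIcc 0 1 zero_le_one (s : ℝ)) = Point.inner e s := by
  have h := s.2
  rw [projIcc_of_mem _ (Ioo_subset_Icc_self h)]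
  simp [edgeMap, h.1.ne', h.2.ne]

theorem unitInterval_cases {motive : unitInterval → Prop} (zero : motive 0) (one : motive 1)
    (mid : ∀ s : Ioo (0 : ℝ) 1, motive (projIcc 0 1 zero_le_one (s : ℝ))) (s : unitInterval) :
    motive s := by
  rcases eq_or_ne s 0 with rfl | hs0
  · exact zero
  rcases eq_or_ne s 1 with rfl | hs1
  · exact one
  have := mid ⟨s, lt_of_le_of_ne s.2.1 fun h => hs0 (Subtype.ext h.symm),
    lt_of_le_of_ne s.2.2 fun h => hs1 (Subtype.ext h)⟩
  rwa [projIcc_of_mem _ s.2] at this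

open Classical in
theorem dist_edgeMap (e : E) (s : unitInterval) : G.dist v (G.edgeMap e s) =
    min (if G.ends e false = v then (s : ℝ) else 1)
      (if G.ends e true = v then 1 - (s : ℝ) else 1) := by
  induction s using unitInterval_cases with
  | zero =>
    rw [edgeMap_zero]
    simp only [dist, Icc.coe_zero]
    split_ifs <;> simp
  | one =>
    rw [edgeMap_one]
    simp only [dist, Icc.coe_one]
    split_ifs <;> simp
  | mid s =>
    rw [edgeMap_projIcc, projIcc_of_mem _ (Ioo_subset_Icc_self s.2)]
    rfl

theorem continuous_edgeMap (e : E) : Continuous (G.edgeMap e) :=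
  continuous_iff_coinduced_le.2 (le_iSup (fun e => TopologicalSpace.coinduced (G.edgeMap e) _) e)

theorem continuous_of_edgeMap {B : Type*} [TopologicalSpace B] {f : G.Point → B}
    (h : ∀ e, Continuous fun s => f (G.edgeMap e s)) : Continuous f :=
  continuous_iSup_dom.2 fun e => continuous_coinduced_dom.2 (h e)

theorem isOpen_of_edgeMap {U : Set G.Point} (h : ∀ e, IsOpen (G.edgeMap e ⁻¹' U)) : IsOpen U :=
  isOpen_iSup_iff.2 fun e => isOpen_coinduced.2 (h e)

theorem isClosed_of_edgeMap {U : Set G.Point} (h : ∀ e, IsClosed (G.edgeMap e ⁻¹' U)) :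
    IsClosed U :=
  ⟨isOpen_of_edgeMap fun e => (h e).isOpen_compl⟩

theorem continuous_dist : Continuous (G.dist v) := by
  classical
  refine continuous_of_edgeMap fun e => ?_
  simp only [dist_edgeMap]
  split_ifs <;> fun_prop

/-- A characteristic map meets a vertex only at the ends of `[0,1]`, so every preimage is finite. -/
theorem isClosed_vert (w : V) : IsClosed ({Point.vert w} : Set G.Point) := by
  refine isClosed_of_edgeMap fun e => Set.Finite.isClosed ?_
  refine (toFinite ({0, 1} : Set unitInterval)).subset fun s hs => ?_
  induction s using unitInterval_cases with
  | zero => simp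
  | one => simp
  | mid s =>
    rw [mem_preimage, edgeMap_projIcc] at hs
    cases hs

theorem isClosed_range_edgeMap (e : E) : IsClosed (range (G.edgeMap e)) := by
  refine isClosed_of_edgeMap fun e' => ?_
  rcases eq_or_ne e' e with rfl | he
  · rw [preimage_range]
    exact isClosed_univ
  · refine Set.Finite.isClosed ?_
    refine (toFinite ({0, 1} : Set unitInterval)).subset fun s hs => ?_
    induction s using unitInterval_cases with
    | zero => simp
    | one => simp
    | mid s =>
      rw [mem_preimage, edgeMap_projIcc] at hs
      obtain ⟨t, ht⟩ := hs
      induction t using unitInterval_cases with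
      | zero => rw [edgeMap_zero] at ht; cases ht
      | one => rw [edgeMap_one] at ht; cases ht
      | mid t =>
        rw [edgeMap_projIcc] at ht
        cases ht
        exact absurd rfl he

theorem exists_mem_closed_cell (x : G.Point) :
    ∃ k : V ⊕ E, x ∈ Sum.elim (fun w => {Point.vert w}) (fun e => range (G.edgeMap e)) k := by
  rcases x with w | ⟨e, s⟩
  · exact ⟨Sum.inl w, rfl⟩
  · exact ⟨Sum.inr e, _, edgeMap_projIcc e s⟩

theorem dist_nonneg (x : G.Point) : 0 ≤ G.dist v x := by
  rcases x with w | ⟨e, s⟩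
  · simp only [dist]; split_ifs <;> norm_num
  · have := s.2.1; have := s.2.2
    simp only [dist, le_min_iff]
    constructor <;> split_ifs <;> linarith

theorem dist_le_one (x : G.Point) : G.dist v x ≤ 1 := by
  rcases x with w | ⟨e, s⟩
  · simp only [dist]; split_ifs <;> norm_num
  · have := s.2.1; have := s.2.2
    simp only [dist, min_le_iff]
    left; split_ifs <;> linarith

theorem dist_eq_zero {x : G.Point} (h : G.dist v x = 0) : x = Point.vert v := by
  rcases x with w | ⟨e, s⟩
  · simp only [dist] at h
    split_ifs at h with hw
    · rw [hw]
    · norm_num at h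
  · exfalso
    have h0 := s.2.1; have h1 := s.2.2
    refine absurd h (ne_of_gt ?_)
    simp only [dist, lt_min_iff]
    constructor <;> split_ifs <;> linarith

theorem dist_pos {x : G.Point} (h : x ≠ Point.vert v) : 0 < G.dist v x :=
  lt_of_le_of_ne (dist_nonneg x) fun h' => h (dist_eq_zero h'.symm)

open Classical in
/-- The point at distance `r` from `v` on the edge of a half-edge at `v`. -/
def HalfEdge.pos (h : G.HalfEdge v) (r : ℝ) : G.Point :=
  if G.ends h.edge false = v then G.edgeMap h.edge (projIcc 0 1 zero_le_one r)
  else G.edgeMap h.edge (projIcc 0 1 zero_le_one (1 - r))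

open Classical in
/-- Move a point along its edge to the distance `r` from `v`; vertices and points on edges that
are not incident to `v` do not move. -/
def place (G : MGraph V E) (v : V) : G.Point → ℝ → G.Point
  | Point.vert w, _ => Point.vert w
  | Point.inner e s, r => if he : ∃ b, G.ends e b = v then HalfEdge.pos (v := v) ⟨e, he⟩ r
      else Point.inner e s

theorem HalfEdge.continuous_pos (h : G.HalfEdge v) : Continuous h.pos := by
  unfold HalfEdge.pos
  split_ifs
  · exact (continuous_edgeMap _).comp continuous_projIcc
  · exact (continuous_edgeMap _).comp (continuous_projIcc.comp (by fun_prop))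

theorem HalfEdge.pos_eq_inner (h : G.HalfEdge v) {r : ℝ} (hr : r ∈ Ioo (0 : ℝ) 1) :
    ∃ s, h.pos r = Point.inner h.edge s := by
  unfold HalfEdge.pos
  split_ifs
  · exact ⟨⟨r, hr⟩, edgeMap_projIcc _ ⟨r, hr⟩⟩
  · have : 1 - r ∈ Ioo (0 : ℝ) 1 := ⟨by linarith [hr.2], by linarith [hr.1]⟩
    exact ⟨⟨1 - r, this⟩, edgeMap_projIcc _ ⟨1 - r, this⟩⟩

theorem HalfEdge.ends_true (h : G.HalfEdge v) (h' : G.ends h.edge false ≠ v) :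
    G.ends h.edge true = v := by
  obtain ⟨e, b, hb⟩ := h
  cases b
  · exact absurd hb h'
  · exact hb

theorem HalfEdge.pos_zero (h : G.HalfEdge v) : h.pos 0 = Point.vert v := by
  unfold HalfEdge.pos
  split_ifs with hf
  · rw [projIcc_of_le_left _ le_rfl]
    exact (edgeMap_zero _).trans (by rw [hf])
  · rw [projIcc_of_right_le _ (by norm_num)]
    exact (edgeMap_one _).trans (by rw [h.ends_true hf])

theorem HalfEdge.pos_half (h : G.HalfEdge v) : h.pos (1 / 2) = h.mid := by
  unfold HalfEdge.pos HalfEdge.mid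
  have : (1 / 2 : ℝ) ∈ Ioo (0 : ℝ) 1 := by norm_num
  have h' : (1 - 1 / 2 : ℝ) = 1 / 2 := by norm_num
  rw [h']
  split_ifs <;> exact edgeMap_projIcc _ ⟨1 / 2, this⟩

theorem HalfEdge.dist_pos_eq (hv : G.NoLoopAt v) (h : G.HalfEdge v) {r : ℝ}
    (hr : r ∈ Icc (0 : ℝ) 1) : G.dist v (h.pos r) = r := by
  have hl := hv h.edge
  have hr' : 1 - r ∈ Icc (0 : ℝ) 1 := ⟨by linarith [hr.2], by linarith [hr.1]⟩
  unfold HalfEdge.pos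
  split_ifs with hf
  · rw [dist_edgeMap, projIcc_of_mem _ hr, if_pos hf, if_neg fun h => hl ⟨hf, h⟩]
    exact min_eq_left hr.2
  · rw [dist_edgeMap, projIcc_of_mem _ hr', if_neg hf, if_pos (h.ends_true hf)]
    simp only [sub_sub_cancel]
    exact min_eq_right hr.2

/-- Without a loop only one of the two terms in the minimum that defines `dist` is less than `1`, so
the distance is a coordinate on the edge. -/
theorem HalfEdge.inner_eq_pos (hv : G.NoLoopAt v) (h : G.HalfEdge v) (s : Ioo (0 : ℝ) 1) :
    Point.inner h.edge s = h.pos (G.dist v (Point.inner h.edge s)) := by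
  have hl := hv h.edge
  have h0 := s.2.1
  have h1 := s.2.2
  unfold HalfEdge.pos
  simp only [dist]
  split_ifs with hf ht ht
  · exact absurd ⟨hf, ht⟩ hl
  · rw [min_eq_left h1.le, edgeMap_projIcc]
  · rw [min_eq_right (by linarith), sub_sub_cancel, edgeMap_projIcc]
  · exact absurd (h.ends_true hf) ht

theorem place_pos (h : G.HalfEdge v) {r : ℝ} (hr : r ∈ Ioo (0 : ℝ) 1) (r' : ℝ) :
    G.place v (h.pos r) r' = h.pos r' := by
  obtain ⟨s, hs⟩ := h.pos_eq_inner hr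
  rw [hs]
  exact dif_pos h.2

/-- The case distinction behind most facts about `place`: the vertex itself, the points that never
move (other vertices, and edges that are not incident to `v`), and the points with polar coordinates
`(h, r)`. -/
theorem point_cases (hv : G.NoLoopAt v) (x : G.Point) : x = Point.vert v ∨
    (G.dist v x = 1 ∧ ∀ r, G.place v x r = x) ∨
    ∃ (h : G.HalfEdge v) (r : ℝ), r ∈ Ioo (0 : ℝ) 1 ∧ x = h.pos r := by
  rcases x with w | ⟨e, s⟩
  · by_cases hw : w = v
    · left; rw [hw]
    · right; left
      exact ⟨by simp [dist, hw], fun r => rfl⟩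
  · by_cases he : ∃ b, G.ends e b = v
    · right; right
      have h0 := s.2.1; have h1 := s.2.2
      refine ⟨⟨e, he⟩, G.dist v (Point.inner e s), ⟨dist_pos (by simp), ?_⟩,
        HalfEdge.inner_eq_pos hv ⟨e, he⟩ s⟩
      obtain ⟨b, hb⟩ := he
      simp only [dist, min_lt_iff]
      cases b
      · left; rw [if_pos hb]; exact h1
      · right; rw [if_pos hb]; linarith
    · right; left
      rw [not_exists] at he
      refine ⟨by simp [dist, he], fun r => ?_⟩
      simp [place, he]

theorem place_vert (w : V) (r : ℝ) : G.place v (Point.vert w) r = Point.vert w := rfl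

theorem place_dist (hv : G.NoLoopAt v) (x : G.Point) : G.place v x (G.dist v x) = x := by
  rcases point_cases hv x with rfl | ⟨_, h⟩ | ⟨h, r, hr, rfl⟩
  · rfl
  · exact h _
  · rw [place_pos h hr, h.dist_pos_eq hv (Ioo_subset_Icc_self hr)]

/-- `r` is a possible distance from `v` for a point that is moved along its edge from `x`. -/
structure Admissible (v : V) (x : G.Point) (r : ℝ) : Prop where
  mem : r ∈ Icc (0 : ℝ) 1
  zero : G.dist v x = 0 → r = 0
  one : G.dist v x = 1 → r = 1

theorem Admissible.dist_place (hv : G.NoLoopAt v) {x : G.Point} {r : ℝ}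
    (hr : Admissible v x r) : G.dist v (G.place v x r) = r := by
  rcases point_cases hv x with rfl | ⟨h1, h⟩ | ⟨h, s, hs, rfl⟩
  · rw [place_vert, dist_vert_self, hr.zero dist_vert_self]
  · rw [h, h1, hr.one h1]
  · rw [place_pos h hs, h.dist_pos_eq hv hr.mem]

theorem HalfEdge.pos_mem_carrier (hv : G.NoLoopAt v) (h : G.HalfEdge v) {r : ℝ} (h0 : 0 < r)
    (h1 : r < 1 / 2) : h.pos r ∈ h.carrier :=
  ⟨h.pos_eq_inner ⟨h0, by linarith⟩, by rwa [h.dist_pos_eq hv ⟨h0.le, by linarith⟩]⟩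

theorem HalfEdge.eq_pos_of_mem (hv : G.NoLoopAt v) {h : G.HalfEdge v} {x : G.Point}
    (hx : x ∈ h.carrier) : x = h.pos (G.dist v x) := by
  obtain ⟨⟨s, rfl⟩, _⟩ := hx
  exact h.inner_eq_pos hv s

theorem HalfEdge.dist_pos_of_mem {h : G.HalfEdge v} {x : G.Point}
    (hx : x ∈ h.carrier) : 0 < G.dist v x := by
  obtain ⟨⟨s, rfl⟩, _⟩ := hx
  exact dist_pos (by simp)

theorem HalfEdge.eq_of_inner {h h' : G.HalfEdge v} {x : G.Point}
    (hx : ∃ s, x = Point.inner h.edge s) (hx' : ∃ s, x = Point.inner h'.edge s) : h = h' := by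
  obtain ⟨s, rfl⟩ := hx
  obtain ⟨s', hs⟩ := hx'
  rw [Point.inner.injEq] at hs
  exact Subtype.ext hs.1

theorem HalfEdge.eq_of_mem {h h' : G.HalfEdge v} {x : G.Point}
    (hx : x ∈ h.carrier) (hx' : x ∈ h'.carrier) : h = h' :=
  HalfEdge.eq_of_inner hx.1 hx'.1

theorem HalfEdge.eq_of_pos_mem {h h' : G.HalfEdge v} {r : ℝ} (hr : r ∈ Ioo (0 : ℝ) 1)
    (hx : h.pos r ∈ h'.carrier) : h = h' :=
  HalfEdge.eq_of_inner (h.pos_eq_inner hr) hx.1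

theorem Admissible.of_place_mem_carrier (hv : G.NoLoopAt v) {x : G.Point} {r : ℝ}
    (hr : Admissible v x r) {h : G.HalfEdge v} (hx : G.place v x r ∈ h.carrier) :
    (∃ s ∈ Ioo (0 : ℝ) 1, x = h.pos s) ∧ 0 < r ∧ r < 1 / 2 := by
  have hd := hr.dist_place hv
  have h0 := HalfEdge.dist_pos_of_mem hx
  have h1 := hx.2
  rw [hd] at h0 h1
  refine ⟨?_, h0, h1⟩
  rcases point_cases hv x with rfl | ⟨h1', _⟩ | ⟨h', s, hs, rfl⟩
  · have := hr.zero dist_vert_self; linarith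
  · have := hr.one h1'; linarith
  · rw [place_pos h' hs] at hx
    rw [HalfEdge.eq_of_pos_mem ⟨h0, by linarith⟩ hx]
    exact ⟨s, hs, rfl⟩

/-- A point that moves along its edge can enter a half-edge of `H` only from the far part of the
same edge, and the last hypothesis forbids that. -/
theorem place_mem_compl_cup (hv : G.NoLoopAt v) {H : Set (G.HalfEdge v)} {x : G.Point} {r : ℝ}
    (hr : Admissible v x r) (hx : x ∈ (cup H)ᶜ) (h : 1 / 2 ≤ G.dist v x → 1 / 2 ≤ r) :
    G.place v x r ∈ (cup H)ᶜ := by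
  simp only [cup, mem_compl_iff, mem_iUnion, not_exists] at hx ⊢
  intro h' hh' hm
  obtain ⟨⟨s, hs, rfl⟩, h0, h1⟩ := hr.of_place_mem_carrier hv hm
  refine hx h' hh' (h'.pos_mem_carrier hv hs.1 ?_)
  rw [h'.dist_pos_eq hv (Ioo_subset_Icc_self hs)] at h
  by_contra! hc
  linarith [h hc]

/-- As long as a moved point stays in the interior of its edge, the edge can be recovered from it;
together with the common old distance this determines the old point. -/
theorem place_injective (hv : G.NoLoopAt v) {x y : G.Point} {r : ℝ} (hr : Admissible v x r)
    (hd : G.dist v x = G.dist v y) (h1 : 0 < G.dist v x → 0 < r)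
    (h2 : G.dist v x < 1 → r < 1) (h : G.place v x r = G.place v y r) : x = y := by
  rcases point_cases hv x with rfl | ⟨hx1, hx⟩ | ⟨a, s, hs, rfl⟩
  · rw [dist_vert_self] at hd
    exact (dist_eq_zero hd.symm).symm
  · rcases point_cases hv y with rfl | ⟨hy1, hy⟩ | ⟨b, t, ht, rfl⟩
    · rw [dist_vert_self, hx1] at hd; norm_num at hd
    · rwa [hx, hy] at h
    · rw [hx1, b.dist_pos_eq hv (Ioo_subset_Icc_self ht)] at hd
      exact absurd hd ht.2.ne'
  · have hds := a.dist_pos_eq hv (Ioo_subset_Icc_self hs)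
    rw [hds] at hd h1 h2
    rcases point_cases hv y with rfl | ⟨hy1, hy⟩ | ⟨b, t, ht, rfl⟩
    · rw [dist_vert_self] at hd; exact absurd hd hs.1.ne'
    · rw [hy1] at hd; exact absurd hd hs.2.ne
    · rw [b.dist_pos_eq hv (Ioo_subset_Icc_self ht)] at hd
      subst hd
      rw [place_pos a hs, place_pos b hs] at h
      have hr' : r ∈ Ioo (0 : ℝ) 1 := ⟨h1 hs.1, h2 hs.2⟩
      rw [HalfEdge.eq_of_inner (a.pos_eq_inner hr') (h ▸ b.pos_eq_inner hr')]

theorem push_eq_place (hv : G.NoLoopAt v) (x : G.Point) :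
    push G v x = G.place v x ((1 + G.dist v x) / 2) := by
  rcases x with w | ⟨e, s⟩
  · rfl
  · have hl := hv e
    have h0 := s.2.1; have h1 := s.2.2
    simp only [push, place, dist, pushParam]
    have h2 : (1 + (s : ℝ)) / 2 ∈ Ioo (0 : ℝ) 1 := by constructor <;> linarith
    have h3 : (s : ℝ) / 2 ∈ Ioo (0 : ℝ) 1 := by constructor <;> linarith
    by_cases hf : G.ends e false = v
    · have ht : G.ends e true ≠ v := fun h => hl ⟨hf, h⟩
      rw [dif_pos ⟨_, hf⟩]
      simp only [if_pos hf, if_neg ht]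
      rw [min_eq_left h1.le]
      exact (edgeMap_projIcc e ⟨_, h2⟩).symm.trans (if_pos hf).symm
    · by_cases ht : G.ends e true = v
      · rw [dif_pos ⟨_, ht⟩]
        simp only [if_pos ht, if_neg hf]
        rw [min_eq_right (by linarith)]
        have : (s : ℝ) / 2 = 1 - (1 + (1 - (s : ℝ))) / 2 := by ring
        refine (edgeMap_projIcc e ⟨_, h3⟩).symm.trans ?_
        simp only [this]
        exact (if_neg hf).symm
      · rw [dif_neg (by simp [hf, ht])]
        simp only [if_neg hf, if_neg ht]

theorem HalfEdge.isOpen_carrier (h : G.HalfEdge v) : IsOpen h.carrier := by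
  have key : IsOpen {x : G.Point | ∃ s, x = Point.inner h.edge s} := by
    refine isOpen_of_edgeMap fun e => ?_
    have : G.edgeMap e ⁻¹' {x : G.Point | ∃ s, x = Point.inner h.edge s} =
        {s | e = h.edge ∧ s ≠ 0 ∧ s ≠ 1} := by
      ext s
      induction s using unitInterval_cases with
      | zero => simp [edgeMap_zero]
      | one => simp [edgeMap_one]
      | mid s =>
        have h0 := s.2.1; have h1 := s.2.2
        simp only [mem_preimage, edgeMap_projIcc]
        rw [projIcc_of_mem _ (Ioo_subset_Icc_self s.2)]
        refine ⟨fun ⟨s', hs'⟩ => ?_, fun hs' => ⟨s, by rw [hs'.1]⟩⟩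
        rw [Point.inner.injEq] at hs'
        exact ⟨hs'.1, fun h => h0.ne' (congrArg Subtype.val h),
          fun h => h1.ne (congrArg Subtype.val h)⟩
    rw [this]
    by_cases he : e = h.edge
    · simp only [he, true_and]
      exact isOpen_ne.inter isOpen_ne
    · simp [he]
  exact key.inter (isOpen_lt continuous_dist continuous_const)

theorem isOpen_cup (H : Set (G.HalfEdge v)) : IsOpen (cup H) :=
  isOpen_biUnion fun h _ => h.isOpen_carrier

/-- The points of the closed edge of a half-edge at distance at most `1/2` from `v`. -/
def HalfEdge.closedCarrier (h : G.HalfEdge v) : Set G.Point :=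
  range (G.edgeMap h.edge) ∩ {x | G.dist v x ≤ 1 / 2}

theorem HalfEdge.isClosed_closedCarrier (h : G.HalfEdge v) : IsClosed h.closedCarrier :=
  (isClosed_range_edgeMap _).inter (isClosed_le continuous_dist continuous_const)

theorem HalfEdge.carrier_subset (h : G.HalfEdge v) : h.carrier ⊆ h.closedCarrier := by
  rintro _ ⟨⟨s, rfl⟩, hd⟩
  exact ⟨⟨_, edgeMap_projIcc _ s⟩, le_of_lt hd⟩

/-- Closing a half-edge adds only points at the distances `0` and `1/2`, as the vertices other than
`v` have distance `1`. Functions on a half-edge are therefore extended by checking these two values.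
-/
theorem HalfEdge.mem_closedCarrier {h : G.HalfEdge v} {x : G.Point} (hx : x ∈ h.closedCarrier) :
    x = Point.vert v ∨ G.dist v x = 1 / 2 ∨ x ∈ h.carrier := by
  obtain ⟨⟨s, rfl⟩, hd⟩ := hx
  have hw : ∀ w, (Point.vert w : G.Point) ∈ {x | G.dist v x ≤ 1 / 2} →
      (Point.vert w : G.Point) = Point.vert v := fun w hw => by
    simp only [dist, mem_ofPred_eq] at hw
    split_ifs at hw with h
    · rw [h]
    · norm_num at hw
  induction s using unitInterval_cases with
  | zero => rw [edgeMap_zero] at hd ⊢; exact Or.inl (hw _ hd)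
  | one => rw [edgeMap_one] at hd ⊢; exact Or.inl (hw _ hd)
  | mid s =>
    rw [edgeMap_projIcc] at hd ⊢
    right
    rcases eq_or_lt_of_le (show G.dist v _ ≤ 1 / 2 from hd) with h' | h'
    · exact Or.inl h'
    · exact Or.inr ⟨⟨s, rfl⟩, h'⟩

/-- A finite graph is covered by finitely many closed cells. On a closed edge at `v` the moved point
is `pos (f t)`, also at the ends of the edge: there `Admissible` forces the new distance to be the
old one. -/
theorem continuous_place [Finite V] [Finite E] {T : Type*}
    [TopologicalSpace T] {g : T → G.Point} {f : T → ℝ} (hg : Continuous g) (hf : Continuous f)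
    (hgf : ∀ t, Admissible v (g t) (f t)) : Continuous fun t => G.place v (g t) (f t) := by
  refine continuous_of_finite_closed_cover
    (fun k : V ⊕ E => g ⁻¹' Sum.elim (fun w => {Point.vert w}) (fun e => range (G.edgeMap e)) k)
    ?_ (fun t => exists_mem_closed_cell (g t)) ?_
  · rintro (w | e)
    · exact (isClosed_vert w).preimage hg
    · exact (isClosed_range_edgeMap e).preimage hg
  · rintro (w | e)
    · refine (continuous_const (y := Point.vert w)).congr fun t => ?_
      have : g t = Point.vert w := t.2
      rw [this, place_vert]
    · by_cases he : ∃ b, G.ends e b = v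
      · set h : G.HalfEdge v := ⟨e, he⟩ with hh
        refine (h.continuous_pos.comp (hf.comp continuous_subtype_val)).congr ?_
        rintro ⟨t, s, hs⟩
        simp only [comp_apply]
        have ha := hgf t
        have key : ∀ w, (w = G.ends e true ∨ w = G.ends e false) → Point.vert w = g t →
            h.pos (f t) = G.place v (g t) (f t) := by
          intro w hw hs
          rw [← hs] at ha ⊢
          rw [place_vert]
          by_cases hwv : w = v
          · rw [ha.zero (by simp [dist, hwv]), h.pos_zero, hwv]
          · rw [ha.one (by simp [dist, hwv])]
            unfold HalfEdge.pos
            split_ifs with hf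
            · rw [projIcc_of_right_le _ le_rfl]
              refine (edgeMap_one e).trans ?_
              rcases hw with rfl | rfl
              · rfl
              · exact absurd hf hwv
            · rw [projIcc_of_le_left _ (by norm_num)]
              refine (edgeMap_zero e).trans ?_
              rcases hw with rfl | rfl
              · exact absurd (h.ends_true hf) hwv
              · rfl
        induction s using unitInterval_cases with
        | zero =>
          rw [edgeMap_zero] at hs
          exact key _ (Or.inr rfl) hs
        | one =>
          rw [edgeMap_one] at hs
          exact key _ (Or.inl rfl) hs
        | mid s =>
          rw [edgeMap_projIcc] at hs
          rw [← hs]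
          simp only [place]
          rw [dif_pos he]
      · refine (hg.comp continuous_subtype_val).congr ?_
        rintro ⟨t, s, hs⟩
        simp only [comp_apply]
        induction s using unitInterval_cases with
        | zero => rw [← hs, edgeMap_zero, place_vert]
        | one => rw [← hs, edgeMap_one, place_vert]
        | mid s =>
          rw [← hs, edgeMap_projIcc]
          simp only [place]
          rw [dif_neg he]

end MGraph

/-! ### Equivariant maps and homotopies of mapping cones -/

namespace Cone

variable {S X Y X' Y' : Type*} {f : X → Y} {f' : X' → Y'}

theorem isEquivariant_map {rX : S → X → X} {rY : S → Y → Y} {rX' : S → X' → X'}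
    {rY' : S → Y' → Y'} (hr : ∀ s x, rY s (f x) = f (rX s x))
    (hr' : ∀ s x, rY' s (f' x) = f' (rX' s x)) {a : X → X'} {b : Y → Y'}
    (h : ∀ x, b (f x) = f' (a x)) (ha : IsEquivariant rX rX' a) (hb : IsEquivariant rY rY' b) :
    IsEquivariant (fun s => map (rX s) (rY s) (hr s)) (fun s => map (rX' s) (rY' s) (hr' s))
      (map a b h) := by
  intro s z
  induction z using Cone.cases with
  | h => rfl
  | hm x t => exact congrArg (fun x => mk f' x t) (ha s x)
  | hb y => exact congrArg (base f') (hb s y)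

variable [TopologicalSpace X] [TopologicalSpace Y] [TopologicalSpace X'] [TopologicalSpace Y']

theorem continuous_map {a : X → X'} {b : Y → Y'} (h : ∀ x, b (f x) = f' (a x))
    (ha : Continuous a) (hb : Continuous b) : Continuous (map a b h) :=
  continuous_of_mk_base (continuous_mk.comp (ha.prodMap continuous_id)) (continuous_base.comp hb)

/-- The end maps `k` and `l` are described by their values only, so that the identity and composites
can be used without rewriting them as `Cone.map`. -/
theorem eqPtdHomotopic_map {rX : S → X → X} {rY : S → Y → Y} {rX' : S → X' → X'}
    {rY' : S → Y' → Y'} (hr : ∀ s x, rY s (f x) = f (rX s x))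
    (hr' : ∀ s x, rY' s (f' x) = f' (rX' s x)) {a : unitInterval → X → X'}
    {b : unitInterval → Y → Y'} (h : ∀ u x, b u (f x) = f' (a u x))
    (hac : Continuous fun p : X × unitInterval => a p.2 p.1)
    (hbc : Continuous fun p : Y × unitInterval => b p.2 p.1)
    (ha : ∀ u, IsEquivariant rX rX' (a u)) (hb : ∀ u, IsEquivariant rY rY' (b u))
    {k l : Cone f → Cone f'} (hkp : k pt = pt) (hkm : ∀ x t, k (mk f x t) = mk f' (a 0 x) t)
    (hkb : ∀ y, k (base f y) = base f' (b 0 y)) (hlp : l pt = pt)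
    (hlm : ∀ x t, l (mk f x t) = mk f' (a 1 x) t) (hlb : ∀ y, l (base f y) = base f' (b 1 y)) :
    EqPtdHomotopic (fun s => map (rX s) (rY s) (hr s)) (fun s => map (rX' s) (rY' s) (hr' s))
      k l := by
  refine ⟨fun p => map (a p.2) (b p.2) (h p.2) p.1, ?_, fun z => ?_, fun z => ?_,
    fun _ => rfl, fun t => isEquivariant_map hr hr' (h t) (ha t) (hb t)⟩
  · refine continuous_prod continuous_const ?_ (continuous_base.comp hbc)
    exact continuous_mk.comp ((hac.comp ((continuous_fst.comp continuous_fst).prodMk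
      continuous_snd)).prodMk (continuous_snd.comp continuous_fst))
  · induction z using Cone.cases with
    | h => exact hkp.symm
    | hm x t => exact (hkm x t).symm
    | hb y => exact (hkb y).symm
  · induction z using Cone.cases with
    | h => exact hlp.symm
    | hm x t => exact (hlm x t).symm
    | hb y => exact (hlb y).symm

end Cone

/-! ### Radial expansion, and the equivalence `J` -/

namespace MGraph

variable {V E : Type*} {G : MGraph V E} {v : V}

/-- Self-maps of `[0,1]` that describe radial movements away from a vertex, which keep the
points outside the ball of radius `1/2` apart from each other and from the ball. -/
structure IsProfile (ρ : ℝ → ℝ) : Prop where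
  mapsTo : MapsTo ρ (Icc 0 1) (Icc 0 1)
  zero : ρ 0 = 0
  one : ρ 1 = 1
  le : ∀ r ∈ Icc (1 / 2 : ℝ) 1, r ≤ ρ r
  strictMonoOn : StrictMonoOn ρ (Icc (1 / 2) 1)
  lt : ∀ r ∈ Ico (0 : ℝ) (1 / 2), ρ r < ρ (1 / 2)

theorem IsProfile.lt_one {ρ : ℝ → ℝ} (hρ : IsProfile ρ) {r : ℝ} (h0 : 0 ≤ r) (h1 : r < 1) :
    ρ r < 1 := by
  have key : ∀ s ∈ Ico (1 / 2 : ℝ) 1, ρ s < 1 := fun s hs => by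
    rw [← hρ.one]
    exact hρ.strictMonoOn ⟨hs.1, hs.2.le⟩ ⟨by norm_num, le_rfl⟩ hs.2
  rcases lt_or_ge r (1 / 2) with h | h
  · exact (hρ.lt r ⟨h0, h⟩).trans (key _ (by norm_num))
  · exact key r ⟨h, h1⟩

theorem IsProfile.admissible {ρ : ℝ → ℝ} (hρ : IsProfile ρ) (x : G.Point) :
    Admissible v x (ρ (G.dist v x)) :=
  ⟨hρ.mapsTo ⟨dist_nonneg x, dist_le_one x⟩, fun h => by rw [h, hρ.zero],
    fun h => by rw [h, hρ.one]⟩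

/-- Change the distance to `v` by `ρ`. -/
def radial (G : MGraph V E) (v : V) (ρ : ℝ → ℝ) (x : G.Point) : G.Point :=
  G.place v x (ρ (G.dist v x))

theorem dist_radial (hv : G.NoLoopAt v) {ρ : ℝ → ℝ} (hρ : IsProfile ρ) (x : G.Point) :
    G.dist v (G.radial v ρ x) = ρ (G.dist v x) :=
  (hρ.admissible x).dist_place hv

theorem radial_inj (hv : G.NoLoopAt v) {ρ : ℝ → ℝ} (hρ : IsProfile ρ) {x y : G.Point}
    (hd : ρ (G.dist v x) = ρ (G.dist v y) → G.dist v x = G.dist v y)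
    (h0 : 0 < G.dist v x → 0 < ρ (G.dist v x)) (h : G.radial v ρ x = G.radial v ρ y) :
    x = y := by
  have h' := congrArg (G.dist v) h
  rw [dist_radial hv hρ, dist_radial hv hρ] at h'
  refine place_injective hv (hρ.admissible x) (hd h') h0 (hρ.lt_one (dist_nonneg x)) ?_
  rw [radial, radial, ← h'] at h
  exact h

/-- Profiles do not decrease distances that are at least `1/2`, so nothing enters the ball from
outside. -/
theorem mem_ball_of_radial (hv : G.NoLoopAt v) {ρ : ℝ → ℝ} (hρ : IsProfile ρ) {x : G.Point}
    (h : G.radial v ρ x ∈ G.ball v) : x ∈ G.ball v := by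
  simp only [ball, mem_ofPred_eq, dist_radial hv hρ] at h ⊢
  by_contra! hc
  exact absurd (hρ.le _ ⟨hc, dist_le_one x⟩) (by linarith)

theorem radial_mem_compl_cup (hv : G.NoLoopAt v) {ρ : ℝ → ℝ} (hρ : IsProfile ρ)
    {H : Set (G.HalfEdge v)} {x : G.Point} (hx : x ∈ (cup H)ᶜ) : G.radial v ρ x ∈ (cup H)ᶜ :=
  place_mem_compl_cup hv (hρ.admissible x) hx fun h =>
    h.trans (hρ.le _ ⟨h, dist_le_one x⟩)

section Config

variable {ι : Type*} {H : Set (G.HalfEdge v)}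

theorem mem_confOne_compl {c : ι → G.Point} :
    c ∈ confOne ι (cup H)ᶜ (G.ball v \ cup H) ↔
      c ∈ confOne ι univ (G.ball v) ∧ ∀ i, c i ∈ (cup H)ᶜ :=
  ⟨fun h => ⟨confOne_sub H ι h, h.1.2⟩, fun h => ⟨⟨h.1.1.1, h.2⟩, fun i j hi hj =>
    h.1.2 i j hi.1 hj.1⟩⟩

/-- A collision of two moved points is excluded in each case: both cannot have been in the ball, a
point inside is kept strictly below `ρ (1/2)` and one outside at or above it, and outside the ball
`ρ` is injective. Injectivity of `ρ` inside the ball is not needed, which permits `outward`. -/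
theorem radial_mem_confOne (hv : G.NoLoopAt v) {ρ : ℝ → ℝ} (hρ : IsProfile ρ) {c : ι → G.Point}
    (hc : c ∈ confOne ι univ (G.ball v)) :
    (fun i => G.radial v ρ (c i)) ∈ confOne ι (univ : Set G.Point) (G.ball v) := by
  refine ⟨⟨fun i j hij => ?_, fun _ => mem_univ _⟩, fun i j hi hj =>
    hc.2 i j (mem_ball_of_radial hv hρ hi) (mem_ball_of_radial hv hρ hj)⟩
  simp only at hij
  by_contra hne
  have hd := congrArg (G.dist v) hij
  rw [dist_radial hv hρ, dist_radial hv hρ] at hd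
  have key : ∀ x y : G.Point, G.dist v x < 1 / 2 → 1 / 2 ≤ G.dist v y →
      ρ (G.dist v x) < ρ (G.dist v y) := fun x y hx hy =>
    (hρ.lt _ ⟨dist_nonneg x, hx⟩).trans_le
      (hρ.strictMonoOn.monotoneOn ⟨le_rfl, by norm_num⟩ ⟨hy, dist_le_one y⟩ hy)
  rcases lt_or_ge (G.dist v (c i)) (1 / 2) with hi | hi <;>
    rcases lt_or_ge (G.dist v (c j)) (1 / 2) with hj | hj
  · exact hne (hc.2 i j hi hj)
  · exact (key _ _ hi hj).ne hd
  · exact (key _ _ hj hi).ne hd.symm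
  · refine hne (hc.1.1 (radial_inj hv hρ (fun h => ?_) (fun h => ?_) hij))
    · exact hρ.strictMonoOn.injOn ⟨hi, dist_le_one _⟩ ⟨hj, dist_le_one _⟩ h
    · exact h.trans_le (hρ.le _ ⟨hi, dist_le_one _⟩)

theorem radial_mem_conf (hv : G.NoLoopAt v) {ρ : ℝ → ℝ} (hρ : IsProfile ρ)
    (hm : StrictMonoOn ρ (Icc 0 1)) {c : ι → G.Point} (hc : c ∈ conf ι univ) :
    (fun i => G.radial v ρ (c i)) ∈ conf ι (univ : Set G.Point) := by
  refine ⟨fun i j hij => hc.1 (radial_inj hv hρ (fun h => ?_) (fun h => ?_) hij),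
    fun _ => mem_univ _⟩
  · exact hm.injOn ⟨dist_nonneg _, dist_le_one _⟩ ⟨dist_nonneg _, dist_le_one _⟩ h
  · rw [← hρ.zero]
    exact hm ⟨le_rfl, zero_le_one⟩ ⟨dist_nonneg _, dist_le_one _⟩ h

end Config

/-- A radial expansion of `[0,1]` that moves `[δ,1]` to `[1/2,1]`. -/
def expandFun (δ r : ℝ) : ℝ := r / (r + δ * (1 - r))

theorem expandFun_one (r : ℝ) : expandFun 1 r = r := by simp [expandFun]

section ExpandFun

variable {δ : ℝ}

theorem expandFun_denom_pos (h0 : 0 < δ) {r : ℝ} (hr : r ∈ Icc (0 : ℝ) 1) :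
    0 < r + δ * (1 - r) := by
  rcases eq_or_lt_of_le hr.1 with rfl | h
  · simpa using h0
  · have := mul_nonneg h0.le (sub_nonneg.2 hr.2)
    linarith

theorem strictMonoOn_expandFun (h0 : 0 < δ) : StrictMonoOn (expandFun δ) (Icc 0 1) := by
  intro r hr s hs hrs
  rw [expandFun, expandFun, div_lt_div_iff₀ (expandFun_denom_pos h0 hr)
    (expandFun_denom_pos h0 hs)]
  nlinarith [mul_pos h0 (sub_pos.2 hrs)]

theorem le_expandFun (h0 : 0 < δ) (h1 : δ ≤ 1) {r : ℝ} (hr : r ∈ Icc (0 : ℝ) 1) :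
    r ≤ expandFun δ r := by
  rw [expandFun, le_div_iff₀ (expandFun_denom_pos h0 hr)]
  have : r + δ * (1 - r) ≤ 1 := by nlinarith [hr.1, hr.2]
  nlinarith [hr.1]

/-- Since `δ * (1 - r) ≤ δ ≤ r`, the numerator is at least half of the denominator. -/
theorem half_le_expandFun (h0 : 0 < δ) {r : ℝ} (hr : r ∈ Icc (0 : ℝ) 1) (h : δ ≤ r) :
    1 / 2 ≤ expandFun δ r := by
  rw [expandFun, le_div_iff₀ (expandFun_denom_pos h0 hr)]
  nlinarith [hr.1, hr.2]

theorem isProfile_expandFun (h0 : 0 < δ) (h1 : δ ≤ 1) : IsProfile (expandFun δ) := by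
  have hm := strictMonoOn_expandFun h0
  have hz : expandFun δ 0 = 0 := by simp [expandFun]
  have ho : expandFun δ 1 = 1 := by simp [expandFun]
  refine ⟨fun r hr => ⟨?_, ?_⟩, hz, ho, fun r hr => le_expandFun h0 h1 ⟨?_, hr.2⟩,
    hm.mono (Icc_subset_Icc_left (by norm_num)), fun r hr => hm ⟨hr.1, ?_⟩ (by norm_num) hr.2⟩
  · rw [← hz]
    exact hm.monotoneOn ⟨le_rfl, zero_le_one⟩ hr hr.1
  · rw [← ho]
    exact hm.monotoneOn hr ⟨zero_le_one, le_rfl⟩ hr.2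
  · linarith [hr.1]
  · linarith [hr.2]

end ExpandFun

section Gap

theorem gap_factor_mem {ι : Type*} {c : ι → G.Point} (i j : ι) [Decidable (i = j)] :
    (if i = j then 1 else max (G.dist v (c i)) (G.dist v (c j))) ∈ Icc (0 : ℝ) 1 := by
  split_ifs
  · exact ⟨zero_le_one, le_rfl⟩
  · exact ⟨le_max_of_le_left (dist_nonneg _), max_le (dist_le_one _) (dist_le_one _)⟩

variable {ι : Type*} [Fintype ι]

open Classical in
/-- A positive lower bound for the second smallest distance to `v` of a point of `c`. -/
def gap (v : V) (c : ι → G.Point) : ℝ :=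
  ∏ p : ι × ι, if p.1 = p.2 then 1 else max (G.dist v (c p.1)) (G.dist v (c p.2))

theorem gap_relabel (σ : Equiv.Perm ι) (c : ι → G.Point) :
    gap v (fun i => c (σ.symm i)) = gap v c := by
  classical
  unfold gap
  rw [← Equiv.prod_comp (Equiv.prodCongr σ σ)]
  refine Finset.prod_congr rfl fun p _ => ?_
  simp

/-- Two distinct points cannot both lie at `v`, so no factor vanishes. -/
theorem gap_pos {c : ι → G.Point} (hc : Injective c) : 0 < gap v c := by
  classical
  refine Finset.prod_pos fun p _ => ?_
  split_ifs with h
  · exact zero_lt_one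
  · by_contra! hm
    rw [max_le_iff] at hm
    exact h (hc ((dist_eq_zero (hm.1.antisymm (dist_nonneg _))).trans
      (dist_eq_zero (hm.2.antisymm (dist_nonneg _))).symm))

theorem gap_le_one (c : ι → G.Point) : gap v c ≤ 1 := by
  classical
  exact Finset.prod_le_one (fun p _ => (gap_factor_mem _ _).1) fun p _ => (gap_factor_mem _ _).2

/-- All factors lie in `[0,1]`, so the product is at most any one of them. -/
theorem gap_le (c : ι → G.Point) {i j : ι} (h : i ≠ j) :
    gap v c ≤ max (G.dist v (c i)) (G.dist v (c j)) := by
  classical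
  unfold gap
  rw [← Finset.mul_prod_erase _ _ (Finset.mem_univ (i, j))]
  simp only [if_neg h]
  refine mul_le_of_le_one_right (le_max_of_le_left (dist_nonneg _)) ?_
  exact Finset.prod_le_one (fun p _ => (gap_factor_mem _ _).1) fun p _ => (gap_factor_mem _ _).2

theorem continuous_gap : Continuous (gap v : (ι → G.Point) → ℝ) := by
  classical
  refine continuous_finsetProd _ fun p _ => ?_
  split_ifs
  · exact continuous_const
  · have h (i : ι) : Continuous fun c : ι → G.Point => G.dist v (c i) :=
      continuous_dist.comp (continuous_apply i)
    exact (h _).max (h _)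

end Gap

theorem continuous_radial [Finite V] [Finite E] {T : Type*} [TopologicalSpace T] {g : T → G.Point}
    {ρ : T → ℝ → ℝ} (hg : Continuous g) (hρ : Continuous fun t => ρ t (G.dist v (g t)))
    (h : ∀ t, IsProfile (ρ t)) : Continuous fun t => G.radial v (ρ t) (g t) :=
  continuous_place hg hρ fun t => (h t).admissible _

section Expand

variable {ι : Type*} [Fintype ι]

/-- The expansion factor at the time `u` of the deformation that leaves not more than one point
in the ball. -/
def factor (v : V) (c : ι → G.Point) (u : unitInterval) : ℝ := 1 - u + u * gap v c

theorem factor_pos {c : ι → G.Point} (hc : Injective c) (u : unitInterval) : 0 < factor v c u := by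
  have h := gap_pos (v := v) hc
  have h0 := u.2.1; have h1 := u.2.2
  rcases eq_or_lt_of_le h0 with h' | h'
  · simp [factor, ← h']
  · have := mul_pos h' h
    unfold factor; linarith

theorem factor_le_one (c : ι → G.Point) (u : unitInterval) : factor v c u ≤ 1 := by
  have := mul_le_mul_of_nonneg_left (gap_le_one (v := v) c) u.2.1
  unfold factor; linarith

theorem factor_relabel (σ : Equiv.Perm ι) (c : ι → G.Point) (u : unitInterval) :
    factor v (fun i => c (σ.symm i)) u = factor v c u := by
  rw [factor, gap_relabel, factor]

/-- The expansion away from `v` at the time `u`. -/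
def expand (v : V) (u : unitInterval) (c : ι → G.Point) (i : ι) : G.Point :=
  G.radial v (expandFun (factor v c u)) (c i)

theorem isProfile_factor {c : ι → G.Point} (hc : Injective c) (u : unitInterval) :
    IsProfile (expandFun (factor v c u)) :=
  isProfile_expandFun (factor_pos hc u) (factor_le_one c u)

theorem expand_zero (hv : G.NoLoopAt v) (c : ι → G.Point) : expand v 0 c = c := by
  funext i
  simp [expand, factor, radial, expandFun_one, place_dist hv]

theorem expand_relabel (σ : Equiv.Perm ι) (c : ι → G.Point) (u : unitInterval) (i : ι) :
    expand v u (fun i => c (σ.symm i)) i = expand v u c (σ.symm i) := by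
  rw [expand, factor_relabel, expand]

theorem expand_mem_conf (hv : G.NoLoopAt v) (u : unitInterval) {c : ι → G.Point}
    (hc : c ∈ conf ι univ) : expand v u c ∈ conf ι (univ : Set G.Point) :=
  radial_mem_conf hv (isProfile_factor hc.1 u) (strictMonoOn_expandFun (factor_pos hc.1 u)) hc

theorem expand_mem_confOne (hv : G.NoLoopAt v) (u : unitInterval) {c : ι → G.Point}
    (hc : c ∈ confOne ι univ (G.ball v)) :
    expand v u c ∈ confOne ι (univ : Set G.Point) (G.ball v) :=
  radial_mem_confOne hv (isProfile_factor hc.1.1 u) hc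

/-- At time `1` every point at distance at least `gap v c` is moved out of the ball, and `gap_le`
leaves at most one point closer than that. -/
theorem expand_one_mem_confOne (hv : G.NoLoopAt v) {c : ι → G.Point} (hc : c ∈ conf ι univ) :
    expand v 1 c ∈ confOne ι (univ : Set G.Point) (G.ball v) := by
  refine ⟨expand_mem_conf hv 1 hc, fun i j hi hj => ?_⟩
  by_contra hne
  have key : ∀ k, expand v 1 c k ∈ G.ball v → G.dist v (c k) < gap v c := fun k hk => by
    have hf : factor v c 1 = gap v c := by simp [factor]
    simp only [expand, ball, mem_ofPred_eq, dist_radial hv (isProfile_factor hc.1 1)] at hk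
    rw [hf] at hk
    by_contra! h
    exact absurd (half_le_expandFun (gap_pos hc.1) ⟨dist_nonneg _, dist_le_one _⟩ h) hk.not_ge
  exact absurd (gap_le c hne) (not_le.2 (max_lt (key i hi) (key j hj)))

theorem expand_mem_compl_cup (hv : G.NoLoopAt v) (u : unitInterval) {c : ι → G.Point}
    (hc : Injective c) {H : Set (G.HalfEdge v)} {i : ι} (hi : c i ∈ (cup H)ᶜ) :
    expand v u c i ∈ (cup H)ᶜ :=
  radial_mem_compl_cup hv (isProfile_factor hc u) hi

theorem continuous_expand [Finite V] [Finite E] {S : Set (ι → G.Point)}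
    (hS : S ⊆ conf ι univ) :
    Continuous fun p : S × unitInterval => expand v p.2 (p.1 : ι → G.Point) := by
  refine continuous_pi fun i => ?_
  have hg : Continuous fun p : S × unitInterval => (p.1 : ι → G.Point) i :=
    (continuous_apply i).comp (continuous_subtype_val.comp continuous_fst)
  have hd : Continuous fun p : S × unitInterval => G.dist v ((p.1 : ι → G.Point) i) :=
    continuous_dist.comp hg
  have hgap : Continuous fun p : S × unitInterval => gap v (p.1 : ι → G.Point) :=
    continuous_gap.comp (continuous_subtype_val.comp continuous_fst)
  refine continuous_radial hg ?_ fun p => isProfile_factor (hS p.1.2).1 p.2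
  unfold expandFun factor
  refine hd.div₀ (by fun_prop) fun p => ?_
  exact (expandFun_denom_pos (factor_pos (hS p.1.2).1 p.2) ⟨dist_nonneg _, dist_le_one _⟩).ne'

end Expand

variable (H : Set (G.HalfEdge v))

/-- The expansion at time `1` is the inverse. One formula preserves all four configuration spaces at
every time, so it gives both homotopies; equivariance holds because `gap` is symmetric in the
labels. -/
theorem isEqPtdHomotopyEquiv_coneIncl [Finite V] [Finite E] (hv : G.NoLoopAt v) (ι : Type*)
    [Fintype ι] : IsEqPtdHomotopyEquiv (permConeOne H ι) (permCone H ι) (coneIncl H ι) := by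
  have hX : conf ι (cup H)ᶜ ⊆ conf ι (univ : Set G.Point) := conf_sub H ι
  have hY1 := confOne_sub_conf ι (univ : Set G.Point) (G.ball v)
  have hX1 : confOne ι (cup H)ᶜ (G.ball v \ cup H) ⊆ conf ι (univ : Set G.Point) :=
    fun c hc => hY1 (confOne_sub H ι hc)
  let aX (u : unitInterval) (c : conf ι (cup H)ᶜ) : conf ι (cup H)ᶜ :=
    ⟨expand v u c.1, (expand_mem_conf hv u (hX c.2)).1,
      fun i => expand_mem_compl_cup hv u c.2.1 (c.2.2 i)⟩
  let aY (u : unitInterval) (c : conf ι (univ : Set G.Point)) : conf ι (univ : Set G.Point) :=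
    ⟨expand v u c.1, expand_mem_conf hv u c.2⟩
  let aX1 (u : unitInterval) (c : confOne ι (cup H)ᶜ (G.ball v \ cup H)) :
      confOne ι (cup H)ᶜ (G.ball v \ cup H) :=
    ⟨expand v u c.1, mem_confOne_compl.2 ⟨expand_mem_confOne hv u (confOne_sub H ι c.2),
      fun i => expand_mem_compl_cup hv u c.2.1.1 (c.2.1.2 i)⟩⟩
  let aY1 (u : unitInterval) (c : confOne ι (univ : Set G.Point) (G.ball v)) :
      confOne ι (univ : Set G.Point) (G.ball v) :=
    ⟨expand v u c.1, expand_mem_confOne hv u c.2⟩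
  let kX (c : conf ι (cup H)ᶜ) : confOne ι (cup H)ᶜ (G.ball v \ cup H) :=
    ⟨expand v 1 c.1, mem_confOne_compl.2 ⟨expand_one_mem_confOne hv (hX c.2),
      fun i => expand_mem_compl_cup hv 1 c.2.1 (c.2.2 i)⟩⟩
  let kY (c : conf ι (univ : Set G.Point)) : confOne ι (univ : Set G.Point) (G.ball v) :=
    ⟨expand v 1 c.1, expand_one_mem_confOne hv c.2⟩
  have cX := continuous_expand (v := v) hX
  have cY := continuous_expand (v := v) (subset_refl (conf ι (univ : Set G.Point)))
  have cX1 := continuous_expand (v := v) hX1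
  have cY1 := continuous_expand (v := v) hY1
  have heq : ∀ u (σ : Equiv.Perm ι) (c : ι → G.Point),
      expand v u (fun i => c (σ.symm i)) = fun i => expand v u c (σ.symm i) :=
    fun u σ c => funext fun i => expand_relabel σ c u i
  refine ⟨Cone.continuous_map _ (continuous_inclusion _) (continuous_inclusion _), rfl,
    Cone.isEquivariant_map _ _ _ (fun _ _ => rfl) (fun _ _ => rfl),
    Cone.map kX kY (fun _ => rfl), Cone.continuous_map _ ?_ ?_, rfl,
    Cone.isEquivariant_map _ _ _ (fun σ c => Subtype.ext (heq 1 σ c.1))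
      (fun σ c => Subtype.ext (heq 1 σ c.1)), EqPtdHomotopic.symm ?_, EqPtdHomotopic.symm ?_⟩
  · exact (cX.comp (continuous_id.prodMk continuous_const)).subtype_mk _
  · exact (cY.comp (continuous_id.prodMk continuous_const)).subtype_mk _
  · refine Cone.eqPtdHomotopic_map _ _ (a := aX1) (b := aY1) (fun _ _ => rfl)
      (cX1.subtype_mk _) (cY1.subtype_mk _) (fun u σ c => Subtype.ext (heq u σ c.1))
      (fun u σ c => Subtype.ext (heq u σ c.1)) rfl (fun c t => ?_) (fun c => ?_) rfl
      (fun _ _ => rfl) (fun _ => rfl)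
    · exact congrArg (fun c => Cone.mk _ c t) (Subtype.ext (expand_zero hv c.1).symm)
    · exact congrArg (Cone.base _) (Subtype.ext (expand_zero hv c.1).symm)
  · refine Cone.eqPtdHomotopic_map _ _ (a := aX) (b := aY) (fun _ _ => rfl)
      (cX.subtype_mk _) (cY.subtype_mk _) (fun u σ c => Subtype.ext (heq u σ c.1))
      (fun u σ c => Subtype.ext (heq u σ c.1)) rfl (fun c t => ?_) (fun c => ?_) rfl
      (fun _ _ => rfl) (fun _ => rfl)
    · exact congrArg (fun c => Cone.mk _ c t) (Subtype.ext (expand_zero hv c.1).symm)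
    · exact congrArg (Cone.base _) (Subtype.ext (expand_zero hv c.1).symm)

end MGraph

/-! ### The forgetful map `P` -/

namespace MGraph

variable {V E : Type*} {G : MGraph V E} {v : V}

instance [Finite E] : Finite (G.HalfEdge v) :=
  inferInstanceAs (Finite {e : E // ∃ b, G.ends e b = v})

section Forget

variable (H : Set (G.HalfEdge v)) {ι : Type*}

/-- The point `[z, t]` in the summand `k` of the wedge. -/
def wedgePt (k : ι × H) (z : conf {j : ι // j ≠ k.1} ({Point.vert v}ᶜ : Set G.Point))
    (t : unitInterval) : SuspWedge H ι :=
  Wedge.incl (fun k : ι × H => Susp (conf {j : ι // j ≠ k.1} ({Point.vert v}ᶜ : Set G.Point))) k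
    (Susp.mk z t)

theorem wedgePt_zero (k : ι × H) (z : conf {j : ι // j ≠ k.1} ({Point.vert v}ᶜ : Set G.Point)) :
    wedgePt H k z 0 = pt :=
  (congrArg (Wedge.incl _ k) (Susp.mk_zero z)).trans (Wedge.incl_pt _ k)

theorem wedgePt_one (k : ι × H) (z : conf {j : ι // j ≠ k.1} ({Point.vert v}ᶜ : Set G.Point)) :
    wedgePt H k z 1 = pt :=
  (congrArg (Wedge.incl _ k) (Susp.mk_one z)).trans (Wedge.incl_pt _ k)

theorem continuous_wedgePt (k : ι × H) : Continuous fun p :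
    conf {j : ι // j ≠ k.1} ({Point.vert v}ᶜ : Set G.Point) × unitInterval =>
      wedgePt H k p.1 p.2 :=
  (Wedge.continuous_incl k).comp Susp.continuous_mk

variable {H}

theorem suspWedge_cases {p : SuspWedge H ι → Prop} (h : p pt)
    (hm : ∀ k z t, p (wedgePt H k z t)) (a : SuspWedge H ι) : p a := by
  induction a using Wedge.cases with
  | h => exact h
  | hm k a =>
    induction a using Susp.cases with
    | h => rwa [Wedge.incl_pt]
    | hm z t => exact hm k z t

theorem suspWedge_continuous_prod {T B : Type*} [TopologicalSpace T] [LocallyCompactSpace T]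
    [TopologicalSpace B] {F : SuspWedge H ι × T → B} (h : Continuous fun t => F (pt, t))
    (hm : ∀ k, Continuous fun p :
      (conf {j : ι // j ≠ k.1} ({Point.vert v}ᶜ : Set G.Point) × unitInterval) × T =>
        F (wedgePt H k p.1.1 p.1.2, p.2)) : Continuous F := by
  refine Wedge.continuous_prod h fun k => Susp.continuous_prod ?_ (hm k)
  simp only [Wedge.incl_pt]
  exact h

theorem suspWedge_continuous_of {B : Type*} [TopologicalSpace B] {F : SuspWedge H ι → B}
    (hm : ∀ k, Continuous fun p :
      conf {j : ι // j ≠ k.1} ({Point.vert v}ᶜ : Set G.Point) × unitInterval =>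
        F (wedgePt H k p.1 p.2)) : Continuous F :=
  Wedge.continuous_of_incl fun k => Susp.continuous_of_mk (hm k)

/-- The configuration that remains when the point with label `i` is forgotten. -/
def rest (c : confOne ι (univ : Set G.Point) (G.ball v)) (i : ι)
    (h : ∀ j, j ≠ i → c.1 j ≠ Point.vert v) :
    conf {j : ι // j ≠ i} ({Point.vert v}ᶜ : Set G.Point) :=
  ⟨fun j => c.1 j, c.2.1.1.comp Subtype.val_injective, fun j => h j j.2⟩

theorem ne_vert_of_mem_carrier (c : confOne ι (univ : Set G.Point) (G.ball v)) {i : ι}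
    (hi : c.1 i ∈ G.ball v) (j : ι) (hj : j ≠ i) : c.1 j ≠ Point.vert v := fun h =>
  hj (c.2.2 j i (by rw [h]; exact vert_mem_ball) hi)

/-- Half-edges lie in the ball, which holds at most one point, and distinct half-edges are disjoint.
This makes the choice in `forgetBase` harmless. -/
theorem occupied_unique (c : confOne ι (univ : Set G.Point) (G.ball v)) {k k' : ι × H}
    (hk : c.1 k.1 ∈ k.2.1.carrier) (hk' : c.1 k'.1 ∈ k'.2.1.carrier) : k = k' := by
  have h := c.2.2 _ _ hk.2 hk'.2
  rw [← h] at hk'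
  exact Prod.ext h (Subtype.ext (HalfEdge.eq_of_mem hk hk'))

open Classical in
variable (H) in
/-- The forgetful map on the base of the mapping cone. -/
def forgetBase (c : confOne ι (univ : Set G.Point) (G.ball v)) : SuspWedge H ι :=
  if h : ∃ k : ι × H, c.1 k.1 ∈ k.2.1.carrier then
    wedgePt H h.choose (rest c h.choose.1 (ne_vert_of_mem_carrier c h.choose_spec.2))
      (projIcc 0 1 zero_le_one (2 * G.dist v (c.1 h.choose.1)))
  else pt

theorem forgetBase_of_mem (c : confOne ι (univ : Set G.Point) (G.ball v)) (k : ι × H)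
    (hk : c.1 k.1 ∈ k.2.1.carrier) : forgetBase H c =
      wedgePt H k (rest c k.1 (ne_vert_of_mem_carrier c hk.2))
        (projIcc 0 1 zero_le_one (2 * G.dist v (c.1 k.1))) := by
  have h : ∃ k : ι × H, c.1 k.1 ∈ k.2.1.carrier := ⟨k, hk⟩
  obtain rfl := occupied_unique c h.choose_spec hk
  exact dif_pos h

theorem forgetBase_of_notMem (c : confOne ι (univ : Set G.Point) (G.ball v))
    (hc : ∀ i, c.1 i ∈ (cup H)ᶜ) : forgetBase H c = pt :=
  dif_neg fun ⟨k, hk⟩ => hc k.1 (mem_biUnion k.2.2 hk)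

/-- The formula for `P` persists on the closed half-edge: at `v` and at distance `1/2` the
suspension parameter is `0` or `1`, hence the value is the base point, as it must be when no point
lies on `∪H`. -/
theorem forgetBase_of_mem_closed (c : confOne ι (univ : Set G.Point) (G.ball v)) (k : ι × H)
    (hk : c.1 k.1 ∈ k.2.1.closedCarrier) (h : ∀ j, j ≠ k.1 → 1 / 2 ≤ G.dist v (c.1 j))
    (h' : ∀ j, j ≠ k.1 → c.1 j ≠ Point.vert v) : forgetBase H c =
      wedgePt H k (rest c k.1 h') (projIcc 0 1 zero_le_one (2 * G.dist v (c.1 k.1))) := by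
  have key : c.1 k.1 ∈ (cup H)ᶜ → ∀ i, c.1 i ∈ (cup H)ᶜ := fun hk' i => by
    by_cases hi : i = k.1
    · rwa [hi]
    · exact mem_compl_cup (h i hi)
  rcases HalfEdge.mem_closedCarrier hk with hx | hx | hx
  · rw [forgetBase_of_notMem c (key (hx ▸ vert_mem_compl_cup)), hx, dist_vert_self,
      projIcc_of_le_left _ (by norm_num)]
    exact (wedgePt_zero H k _).symm
  · rw [forgetBase_of_notMem c (key (mem_compl_cup hx.ge)), hx,
      projIcc_of_right_le _ (by norm_num)]
    exact (wedgePt_one H k _).symm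
  · exact forgetBase_of_mem c k hx

theorem ne_vert_of_half_le {x : G.Point} (h : 1 / 2 ≤ G.dist v x) : x ≠ Point.vert v := by
  rintro rfl
  rw [dist_vert_self] at h
  norm_num at h

theorem isClosed_compl_cup {T : Type*} [TopologicalSpace T] {c : T → ι → G.Point}
    (hc : Continuous c) (H : Set (G.HalfEdge v)) : IsClosed {t | ∀ i, c t i ∈ (cup H)ᶜ} := by
  simp only [ofPred_forall]
  exact isClosed_iInter fun i =>
    (isOpen_cup H).isClosed_compl.preimage ((continuous_apply i).comp hc)

/-- The closed cover consists of the configurations that miss `∪H` and, for each `(i, h)`, those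
with point `i` on the closed half-edge `h` and all others at distance at least `1/2`. On each piece
`P` is given by one continuous formula. -/
theorem continuous_forgetBase [Finite E] [Finite ι] :
    Continuous (forgetBase H : confOne ι (univ : Set G.Point) (G.ball v) → _) := by
  have hcoord (i : ι) : Continuous fun c : confOne ι (univ : Set G.Point) (G.ball v) => c.1 i :=
    (continuous_apply i).comp continuous_subtype_val
  let C (o : Option (ι × H)) : Set (confOne ι (univ : Set G.Point) (G.ball v)) :=
    o.elim {c | ∀ i, c.1 i ∈ (cup H)ᶜ} fun k =>
      {c | c.1 k.1 ∈ k.2.1.closedCarrier} ∩ {c | ∀ j, j ≠ k.1 → 1 / 2 ≤ G.dist v (c.1 j)}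
  refine continuous_of_finite_closed_cover C ?_ (fun c => ?_) ?_
  · rintro (_ | k)
    · exact isClosed_compl_cup continuous_subtype_val H
    · refine (k.2.1.isClosed_closedCarrier.preimage (hcoord _)).inter ?_
      simp only [ofPred_forall]
      exact isClosed_iInter fun j => isClosed_iInter fun _ =>
        isClosed_le continuous_const (continuous_dist.comp (hcoord j))
  · by_cases h : ∃ k : ι × H, c.1 k.1 ∈ k.2.1.carrier
    · obtain ⟨k, hk⟩ := h
      refine ⟨some k, HalfEdge.carrier_subset _ hk, fun j hj => ?_⟩
      by_contra! hlt
      exact hj (c.2.2 _ _ hlt hk.2)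
    · refine ⟨none, fun i hi => ?_⟩
      simp only [cup, mem_iUnion] at hi
      obtain ⟨a, ha, hia⟩ := hi
      exact h ⟨(i, ⟨a, ha⟩), hia⟩
  · rintro (_ | k)
    · exact continuous_const.congr fun c => (forgetBase_of_notMem c.1 c.2).symm
    · have h' (c : C (some k)) (j : ι) (hj : j ≠ k.1) : c.1.1 j ≠ Point.vert v :=
        ne_vert_of_half_le (c.2.2 j hj)
      refine Continuous.congr ?_
        fun c => (forgetBase_of_mem_closed c.1 k c.2.1 c.2.2 (h' c)).symm
      refine (continuous_wedgePt H k).comp (Continuous.prodMk ?_ ?_)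
      · exact (continuous_pi fun j : {j : ι // j ≠ k.1} =>
          (hcoord j).comp continuous_subtype_val).subtype_mk _
      · exact (continuous_projIcc (h := zero_le_one)).comp
          (((continuous_dist.comp (hcoord k.1)).const_mul 2).comp continuous_subtype_val)

variable (H ι) in
/-- The map that forgets the point on a half-edge of `H`. -/
def forgetMap : Cone (inclOne H ι) → SuspWedge H ι :=
  Cone.desc _ pt (fun _ _ => pt) (forgetBase H) (fun _ => rfl)
    (fun c => (forgetBase_of_notMem (inclOne H ι c) c.2.1.2).symm)

variable (H ι) in
theorem isForgetMap_forgetMap : IsForgetMap H ι (forgetMap H ι) := by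
  refine ⟨rfl, fun _ _ => rfl, fun c hc => forgetBase_of_notMem c hc, fun c i h hi t ht => ?_⟩
  refine (forgetBase_of_mem c (i, h) hi).trans ?_
  rw [← ht, projIcc_val]
  rfl

theorem continuous_forgetMap [Finite E] [Finite ι] : Continuous (forgetMap H ι) :=
  Cone.continuous_of_mk_base continuous_const continuous_forgetBase

theorem isEquivariant_forgetMap :
    IsEquivariant (permConeOne H ι) (permWedge H ι) (forgetMap H ι) := by
  intro σ a
  induction a using Cone.cases with
  | h => rfl
  | hm x t => rfl
  | hb c =>
    change forgetBase H (relabelOne σ c) = permWedge H ι σ (forgetBase H c)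
    by_cases h : ∃ k : ι × H, c.1 k.1 ∈ k.2.1.carrier
    · obtain ⟨⟨i, a⟩, hk⟩ := h
      have hi : (relabelOne σ c).1 (σ i) = c.1 i := congrArg c.1 (σ.symm_apply_apply i)
      have hk' : (relabelOne σ c).1 (σ i) ∈ a.1.carrier := by rwa [hi]
      rw [forgetBase_of_mem c (i, a) hk, forgetBase_of_mem (relabelOne σ c) (σ i, a) hk']
      simp only [hi]
      rfl
    · have h1 : ∀ i, c.1 i ∈ (cup H)ᶜ := fun i hi => by
        simp only [cup, mem_iUnion] at hi
        obtain ⟨a, ha, hia⟩ := hi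
        exact h ⟨(i, ⟨a, ha⟩), hia⟩
      rw [forgetBase_of_notMem c h1, forgetBase_of_notMem _ fun i => h1 (σ.symm i)]
      rfl

end Forget

/-! ### Using the cone coordinate where a configuration misses `∪H` -/

section ConeAt

variable (H : Set (G.HalfEdge v)) {ι : Type*}

open Classical in
/-- The point `(c, s)` on the cone if no point of `c` lies in `∪H`, and `c` otherwise. -/
def coneAt (c : confOne ι (univ : Set G.Point) (G.ball v)) (s : unitInterval) :
    Cone (inclOne H ι) :=
  if h : ∀ i, c.1 i ∈ (cup H)ᶜ then Cone.mk _ ⟨c.1, mem_confOne_compl.2 ⟨c.2, h⟩⟩ s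
  else Cone.base _ c

variable {H}

theorem coneAt_of_forall {c : confOne ι (univ : Set G.Point) (G.ball v)}
    (h : ∀ i, c.1 i ∈ (cup H)ᶜ) (s : unitInterval) :
    coneAt H c s = Cone.mk _ ⟨c.1, mem_confOne_compl.2 ⟨c.2, h⟩⟩ s := dif_pos h

theorem coneAt_of_not {c : confOne ι (univ : Set G.Point) (G.ball v)}
    (h : ¬ ∀ i, c.1 i ∈ (cup H)ᶜ) (s : unitInterval) : coneAt H c s = Cone.base _ c := dif_neg h

theorem coneAt_one (c : confOne ι (univ : Set G.Point) (G.ball v)) :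
    coneAt H c 1 = Cone.base _ c := by
  by_cases h : ∀ i, c.1 i ∈ (cup H)ᶜ
  · rw [coneAt_of_forall h, Cone.mk_one]
    rfl
  · exact coneAt_of_not h 1

theorem coneAt_zero {c : confOne ι (univ : Set G.Point) (G.ball v)}
    (h : ∀ i, c.1 i ∈ (cup H)ᶜ) : coneAt H c 0 = pt := by
  rw [coneAt_of_forall h, Cone.mk_zero]

/-- Missing `∪H` is a closed condition, and so is `s = 1`; by assumption the two cover `T`. On the
second set `coneAt` is the inclusion of the base. -/
theorem continuous_coneAt {T : Type*} [TopologicalSpace T]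
    {c : T → confOne ι (univ : Set G.Point) (G.ball v)} {s : T → unitInterval}
    (hc : Continuous c) (hs : Continuous s)
    (h : ∀ t, (¬ ∀ i, (c t).1 i ∈ (cup H)ᶜ) → s t = 1) :
    Continuous fun t => coneAt H (c t) (s t) := by
  refine continuous_of_two_closed (isClosed_compl_cup (continuous_subtype_val.comp hc) H)
    (isClosed_eq hs (continuous_const (y := 1))) (fun t => ?_) ?_ ?_
  · exact or_iff_not_imp_left.2 (h t)
  · refine Continuous.congr ?_ fun t => (coneAt_of_forall t.2 (s t.1)).symm
    exact Cone.continuous_mk.comp (Continuous.prodMk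
      ((continuous_subtype_val.comp (hc.comp continuous_subtype_val)).subtype_mk _)
      (hs.comp continuous_subtype_val))
  · refine (Cone.continuous_base.comp (hc.comp continuous_subtype_val)).congr ?_
    rintro ⟨t, ht⟩
    have ht' : s t = 1 := ht
    simp only [ht', coneAt_one, comp_apply]

theorem permConeOne_coneAt (σ : Equiv.Perm ι) (c : confOne ι (univ : Set G.Point) (G.ball v))
    (s : unitInterval) : permConeOne H ι σ (coneAt H c s) = coneAt H (relabelOne σ c) s := by
  by_cases h : ∀ i, c.1 i ∈ (cup H)ᶜ
  · have h' : ∀ i, (relabelOne σ c).1 i ∈ (cup H)ᶜ := fun i => h _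
    rw [coneAt_of_forall h, coneAt_of_forall h']
    rfl
  · have h' : ¬ ∀ i, (relabelOne σ c).1 i ∈ (cup H)ᶜ := fun h' => h fun i => by
      have := h' (σ i)
      rwa [show (relabelOne σ c).1 (σ i) = c.1 i from congrArg c.1 (σ.symm_apply_apply i)] at this
    rw [coneAt_of_not h, coneAt_of_not h']
    rfl

/-- The cone parameter is used only by configurations that `P` sends to the base point anyway. -/
theorem forgetMap_coneAt (c : confOne ι (univ : Set G.Point) (G.ball v)) (s : unitInterval) :
    forgetMap H ι (coneAt H c s) = forgetBase H c := by
  by_cases h : ∀ i, c.1 i ∈ (cup H)ᶜ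
  · rw [coneAt_of_forall h, forgetBase_of_notMem c h]
    rfl
  · rw [coneAt_of_not h]
    rfl

end ConeAt

end MGraph

/-! ### The profile `outward`, the cone parameter `bump`, and adding a point -/

namespace MGraph

variable {V E : Type*} {G : MGraph V E} {v : V}

theorem IsProfile.id : IsProfile (fun r => r) :=
  ⟨fun _ h => h, rfl, rfl, fun _ _ => le_rfl, strictMonoOn_id, fun _ h => h.2⟩

theorem combo_lt_combo {u a b a' b' : ℝ} (h0 : 0 ≤ u) (h1 : u ≤ 1) (h : a < b) (h' : a' < b') :
    (1 - u) * a + u * a' < (1 - u) * b + u * b' := by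
  rcases eq_or_lt_of_le h0 with rfl | h0
  · simpa using h
  · have := mul_lt_mul_of_pos_left h' h0
    have := mul_le_mul_of_nonneg_left h.le (sub_nonneg.2 h1)
    linarith

theorem combo_mem {u a b : ℝ} (hu : u ∈ Icc (0 : ℝ) 1) (ha : a ∈ Icc (0 : ℝ) 1)
    (hb : b ∈ Icc (0 : ℝ) 1) : (1 - u) * a + u * b ∈ Icc (0 : ℝ) 1 := by
  have := mul_nonneg (sub_nonneg.2 hu.2) ha.1
  have := mul_nonneg hu.1 hb.1
  have := mul_nonneg (sub_nonneg.2 hu.2) (sub_nonneg.2 ha.2)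
  have := mul_nonneg hu.1 (sub_nonneg.2 hb.2)
  constructor <;> linarith

theorem IsProfile.combo {ρ τ : ℝ → ℝ} (hρ : IsProfile ρ) (hτ : IsProfile τ) {u : ℝ}
    (hu : u ∈ Icc (0 : ℝ) 1) : IsProfile (fun r => (1 - u) * ρ r + u * τ r) := by
  refine ⟨fun r hr => combo_mem hu (hρ.mapsTo hr) (hτ.mapsTo hr), by simp [hρ.zero, hτ.zero],
    by simp [hρ.one, hτ.one], fun r hr => ?_, fun r hr s hs h => ?_, fun r hr => ?_⟩
  · have := mul_le_mul_of_nonneg_left (hρ.le r hr) (sub_nonneg.2 hu.2)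
    have := mul_le_mul_of_nonneg_left (hτ.le r hr) hu.1
    linarith
  · exact combo_lt_combo hu.1 hu.2 (hρ.strictMonoOn hr hs h) (hτ.strictMonoOn hr hs h)
  · exact combo_lt_combo hu.1 hu.2 (hρ.lt r hr) (hτ.lt r hr)

/-- A profile that moves the points near a vertex to the vertex, the other points of the ball of
radius `3/8` into the closed ball of radius `1/2`, and the points outside the ball of radius `1/2`
by `r ↦ (1 + r) / 2`. -/
def outward (r : ℝ) : ℝ :=
  max (min (max 0 (4 * r - 1 / 2)) (1 / 2)) (min (2 * r - 1 / 4) ((1 + r) / 2))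

/-- A function with support in `[0, 3/8]` that is `1` where `outward` has values in
`(0, 1/2)`. -/
def bump (r : ℝ) : ℝ := max 0 (min (min 1 (8 * r)) (3 - 8 * r))

theorem continuous_outward : Continuous outward := by
  unfold outward; fun_prop

theorem continuous_bump : Continuous bump := by
  unfold bump; fun_prop

theorem outward_zero : outward 0 = 0 := by norm_num [outward]

theorem outward_of_half_le {r : ℝ} (h : 1 / 2 ≤ r) : outward r = (1 + r) / 2 := by
  unfold outward
  rw [min_eq_right (a := 2 * r - 1 / 4) (by linarith)]
  exact max_eq_right ((min_le_right _ _).trans (by linarith))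

/-- On `[0,1]`, `outward` is `0` up to `1/8`, rises to `1/2` at `1/4`, is constant up to `3/8`,
rises to `3/4` at `1/2`, and is `(1 + r) / 2` afterwards. Up to `3/8` the line `2 * r - 1 / 4` stays
below the first three pieces. -/
theorem outward_of_le {r : ℝ} (h : r ≤ 3 / 8) :
    outward r = min (max 0 (4 * r - 1 / 2)) (1 / 2) := by
  unfold outward
  rw [min_eq_left (a := 2 * r - 1 / 4) (by linarith)]
  refine max_eq_left (le_min ?_ (by linarith))
  rcases le_or_gt r (1 / 8) with h | h
  · exact le_max_of_le_left (by linarith)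
  · exact le_max_of_le_right (by linarith)

theorem half_le_outward {r : ℝ} (h : 3 / 8 ≤ r) : 1 / 2 ≤ outward r := by
  refine le_max_of_le_left (le_min (le_max_of_le_right ?_) le_rfl)
  linarith

theorem outward_nonneg (r : ℝ) : 0 ≤ outward r :=
  le_max_of_le_left (le_min (le_max_left _ _) (by norm_num))

theorem outward_lt {r : ℝ} (h : r < 1 / 2) : outward r < 3 / 4 := by
  refine max_lt ((min_le_right _ _).trans_lt (by norm_num)) ((min_le_left _ _).trans_lt ?_)
  linarith

theorem bump_mem (r : ℝ) : bump r ∈ Icc (0 : ℝ) 1 :=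
  ⟨le_max_left _ _, max_le zero_le_one ((min_le_left _ _).trans (min_le_left _ _))⟩

/-- The value of `outward` lies strictly between `0` and `1/2` only for `1/8 < r < 1/4`, and there
`bump` is on its plateau. This is the compatibility that `continuous_coneAt` demands. -/
theorem bump_eq_one {r : ℝ} (h0 : 0 < outward r) (h1 : outward r < 1 / 2) : bump r = 1 := by
  have h2 : r < 3 / 8 := by
    by_contra! h
    exact absurd (half_le_outward h) h1.not_ge
  rw [outward_of_le h2.le] at h0 h1
  have h3 : 1 / 8 < r := by
    by_contra! h
    rw [max_eq_left (by linarith)] at h0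
    exact absurd h0 (not_lt.2 (min_le_left _ _))
  have h4 : r < 1 / 4 := by
    by_contra! h
    rw [min_eq_right (le_max_of_le_right (by linarith))] at h1
    exact lt_irrefl _ h1
  unfold bump
  rw [min_eq_left (a := 1) (by linarith), min_eq_left (by linarith), max_eq_right zero_le_one]

theorem bump_of_le {r : ℝ} (h : 3 / 8 ≤ r) : bump r = 0 :=
  max_eq_left ((min_le_right _ _).trans (by linarith))

theorem bump_zero : bump 0 = 0 := by norm_num [bump]

theorem isProfile_outward : IsProfile outward := by
  refine ⟨fun r hr => ⟨outward_nonneg r, ?_⟩, outward_zero, ?_, fun r hr => ?_,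
    fun r hr s hs h => ?_, fun r hr => ?_⟩
  · rcases lt_or_ge r (1 / 2) with h | h
    · linarith [outward_lt h]
    · rw [outward_of_half_le h]; linarith [hr.2]
  · rw [outward_of_half_le (by norm_num)]; norm_num
  · rw [outward_of_half_le hr.1]; linarith [hr.2]
  · rw [outward_of_half_le hr.1, outward_of_half_le hs.1]; linarith
  · rw [outward_of_half_le (r := 1 / 2) le_rfl]; linarith [outward_lt hr.2]

section Insert

variable {H : Set (G.HalfEdge v)} {ι : Type*}

open Classical in
/-- Put the new point `x` at the label `i`, after scaling the configuration `z` away from `v`. -/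
def insertPt (v : V) (i : ι) (x : G.Point) (z : {j : ι // j ≠ i} → G.Point) (j : ι) : G.Point :=
  if h : j = i then x else push G v (z ⟨j, h⟩)

theorem insertPt_self (i : ι) (x : G.Point) (z : {j : ι // j ≠ i} → G.Point) :
    insertPt v i x z i = x := dif_pos rfl

theorem insertPt_of_ne {i : ι} (x : G.Point) (z : {j : ι // j ≠ i} → G.Point) {j : ι}
    (h : j ≠ i) : insertPt v i x z j = push G v (z ⟨j, h⟩) := dif_neg h

theorem lt_dist_insertPt (hv : G.NoLoopAt v) {i : ι} (x : G.Point)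
    (z : conf {j : ι // j ≠ i} ({Point.vert v}ᶜ : Set G.Point)) {j : ι} (h : j ≠ i) :
    1 / 2 < G.dist v (insertPt v i x z.1 j) := by
  rw [insertPt_of_ne x z.1 h]
  exact lt_dist_push hv (z.2.2 _)

theorem insertPt_mem (hv : G.NoLoopAt v) {i : ι} {x : G.Point} (hx : G.dist v x ≤ 1 / 2)
    (z : conf {j : ι // j ≠ i} ({Point.vert v}ᶜ : Set G.Point)) :
    insertPt v i x z.1 ∈ confOne ι (univ : Set G.Point) (G.ball v) := by
  have key : ∀ j, insertPt v i x z.1 j ∈ G.ball v → j = i := fun j hj => by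
    by_contra h
    exact absurd hj (lt_dist_insertPt hv x z h).le.not_gt
  refine ⟨⟨fun j k hjk => ?_, fun _ => mem_univ _⟩, fun j k hj hk =>
    (key j hj).trans (key k hk).symm⟩
  by_cases hj : j = i <;> by_cases hk : k = i
  · exact hj.trans hk.symm
  · have := lt_dist_insertPt hv x z hk
    rw [← hjk, hj, insertPt_self] at this
    exact absurd hx this.not_ge
  · have := lt_dist_insertPt hv x z hj
    rw [hjk, hk, insertPt_self] at this
    exact absurd hx this.not_ge
  · rw [insertPt_of_ne x z.1 hj, insertPt_of_ne x z.1 hk] at hjk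
    exact congrArg Subtype.val (z.2.1 (push_injective hjk))

theorem insertPt_mem_compl_cup (hv : G.NoLoopAt v) {i : ι} {x : G.Point} (hx : x ∈ (cup H)ᶜ)
    (z : conf {j : ι // j ≠ i} ({Point.vert v}ᶜ : Set G.Point)) (j : ι) :
    insertPt v i x z.1 j ∈ (cup H)ᶜ := by
  by_cases h : j = i
  · rwa [h, insertPt_self]
  · exact mem_compl_cup (lt_dist_insertPt hv x z h).le

theorem insertPt_relabel (σ : Equiv.Perm ι) (i : ι) (x : G.Point)
    (z : conf {j : ι // j ≠ i} ({Point.vert v}ᶜ : Set G.Point)) (j : ι) :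
    insertPt v (σ i) x (relabel (σ.subtypeEquiv
      (fun j => (σ.injective.ne_iff (x := j) (y := i)).symm)) z).1 j =
      insertPt v i x z.1 (σ.symm j) := by
  by_cases h : j = σ i
  · subst h
    rw [insertPt_self, σ.symm_apply_apply, insertPt_self]
  · have h' : σ.symm j ≠ i := fun h' => h (by rw [← h', σ.apply_symm_apply])
    rw [insertPt_of_ne _ _ h, insertPt_of_ne _ _ h']
    rfl

theorem continuous_push_conf [Finite V] [Finite E] (hv : G.NoLoopAt v) {κ : Type*} (j : κ) :
    Continuous fun z : conf κ ({Point.vert v}ᶜ : Set G.Point) => push G v (z.1 j) := by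
  simp only [push_eq_place hv]
  have hg : Continuous fun z : conf κ ({Point.vert v}ᶜ : Set G.Point) => z.1 j :=
    (continuous_apply j).comp continuous_subtype_val
  have hd := (continuous_dist (v := v)).comp hg
  refine continuous_place hg ((hd.const_add 1).div_const 2) fun z => ⟨?_, fun h => ?_, fun h => ?_⟩
  · have h0 := dist_nonneg (v := v) (z.1 j)
    have h1 := dist_le_one (v := v) (z.1 j)
    constructor <;> linarith
  · exact absurd (dist_eq_zero h) (z.2.2 j)
  · rw [h]; norm_num

theorem continuous_insertPt [Finite V] [Finite E] (hv : G.NoLoopAt v) (i : ι) {T : Type*}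
    [TopologicalSpace T] {x : T → G.Point} (hx : Continuous x)
    {z : T → conf {j : ι // j ≠ i} ({Point.vert v}ᶜ : Set G.Point)} (hz : Continuous z) :
    Continuous fun t => insertPt v i (x t) (z t).1 := by
  refine continuous_pi fun j => ?_
  by_cases h : j = i
  · subst h
    simpa only [insertPt_self] using hx
  · simp only [insertPt_of_ne _ _ h]
    exact (continuous_push_conf hv _).comp hz

theorem continuous_addAt [Finite V] [Finite E] (hv : G.NoLoopAt v) (i : ι) (x : G.Point)
    (hx : x ∈ (cup H)ᶜ) (hd : G.dist v x ≤ 1 / 2) : Continuous (addAt H hv i x hx hd) :=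
  (continuous_insertPt hv i continuous_const continuous_id).subtype_mk _

end Insert

end MGraph

/-! ### The homotopy inverse of `P`, and the composite on the wedge -/

namespace MGraph

variable {V E : Type*} {G : MGraph V E} {v : V} (H : Set (G.HalfEdge v)) {ι : Type*}

section InsertMap

theorem height_mem (r : ℝ) : min (outward r) (1 / 2) ∈ Icc (0 : ℝ) (1 / 2) :=
  ⟨le_min (outward_nonneg r) (by norm_num), min_le_right _ _⟩

theorem dist_pos_height (hv : G.NoLoopAt v) (h : G.HalfEdge v) (r : ℝ) :
    G.dist v (h.pos (min (outward r) (1 / 2))) = min (outward r) (1 / 2) :=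
  h.dist_pos_eq hv ⟨(height_mem r).1, (height_mem r).2.trans (by norm_num)⟩

variable {H} in
/-- Put a new point on the half-edge of `k`, at the label of `k`, at a distance from `v` that is
determined by `r`. -/
def insertConf (hv : G.NoLoopAt v) (k : ι × H)
    (z : conf {j : ι // j ≠ k.1} ({Point.vert v}ᶜ : Set G.Point)) (r : ℝ) :
    confOne ι (univ : Set G.Point) (G.ball v) :=
  ⟨insertPt v k.1 (k.2.1.pos (min (outward r) (1 / 2))) z.1,
    insertPt_mem hv ((dist_pos_height hv _ r).trans_le (height_mem r).2) z⟩

variable {H}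

theorem insertConf_mem_compl_cup (hv : G.NoLoopAt v) (k : ι × H)
    (z : conf {j : ι // j ≠ k.1} ({Point.vert v}ᶜ : Set G.Point)) {r : ℝ}
    (h : outward r = 0 ∨ 1 / 2 ≤ outward r) (j : ι) :
    (insertConf hv k z r).1 j ∈ (cup H)ᶜ := by
  refine insertPt_mem_compl_cup hv ?_ z j
  rcases h with h | h
  · rw [h, min_eq_left (by norm_num), HalfEdge.pos_zero]
    exact vert_mem_compl_cup
  · refine mem_compl_cup ?_
    rw [dist_pos_height hv, min_eq_right h]

theorem insertConf_notMem_compl_cup (hv : G.NoLoopAt v) (k : ι × H)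
    (z : conf {j : ι // j ≠ k.1} ({Point.vert v}ᶜ : Set G.Point)) {r : ℝ}
    (h0 : 0 < outward r) (h1 : outward r < 1 / 2) :
    ¬ ∀ j, (insertConf hv k z r).1 j ∈ (cup H)ᶜ := by
  intro h
  refine h k.1 (mem_biUnion k.2.2 ?_)
  have hself : (insertConf hv k z r).1 k.1 = k.2.1.pos (min (outward r) (1 / 2)) :=
    insertPt_self _ _ _
  rw [hself, min_eq_left h1.le]
  exact k.2.1.pos_mem_carrier hv h0 h1

theorem bump_eq_one_of_insertConf (hv : G.NoLoopAt v) (k : ι × H)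
    (z : conf {j : ι // j ≠ k.1} ({Point.vert v}ᶜ : Set G.Point)) {r : ℝ}
    (h : ¬ ∀ j, (insertConf hv k z r).1 j ∈ (cup H)ᶜ) : bump r = 1 := by
  have h' : ¬ (outward r = 0 ∨ 1 / 2 ≤ outward r) :=
    fun h' => h (insertConf_mem_compl_cup hv k z h')
  rw [not_or, not_le] at h'
  exact bump_eq_one (lt_of_le_of_ne (outward_nonneg r) (Ne.symm h'.1)) h'.2

theorem insertConf_relabel (hv : G.NoLoopAt v) (σ : Equiv.Perm ι) (i : ι) (a : H)
    (z : conf {j : ι // j ≠ i} ({Point.vert v}ᶜ : Set G.Point)) (r : ℝ) :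
    insertConf hv (σ i, a) (relabel (σ.subtypeEquiv
      (fun j => (σ.injective.ne_iff (x := j) (y := i)).symm)) z) r =
      relabelOne σ (insertConf hv (i, a) z r) :=
  Subtype.ext (funext fun j => insertPt_relabel σ i _ z j)

/-- The bump function with values in the unit interval. -/
def bumpI (r : ℝ) : unitInterval := ⟨bump r, bump_mem r⟩

theorem continuous_bumpI : Continuous bumpI := continuous_bump.subtype_mk _

theorem bumpI_zero : bumpI 0 = 0 := Subtype.ext bump_zero

theorem bumpI_of_le {r : ℝ} (h : 3 / 8 ≤ r) : bumpI r = 0 := Subtype.ext (bump_of_le h)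

theorem coneAt_insertConf_zero (hv : G.NoLoopAt v) (k : ι × H)
    (z : conf {j : ι // j ≠ k.1} ({Point.vert v}ᶜ : Set G.Point)) :
    coneAt H (insertConf hv k z 0) (bumpI 0) = pt := by
  rw [bumpI_zero, coneAt_zero (insertConf_mem_compl_cup hv k z (Or.inl outward_zero))]

theorem coneAt_insertConf_of_le (hv : G.NoLoopAt v) (k : ι × H)
    (z : conf {j : ι // j ≠ k.1} ({Point.vert v}ᶜ : Set G.Point)) {r : ℝ} (h : 3 / 8 ≤ r) :
    coneAt H (insertConf hv k z r) (bumpI r) = pt := by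
  rw [bumpI_of_le h,
    coneAt_zero (insertConf_mem_compl_cup hv k z (Or.inr (half_le_outward h)))]

variable (H ι) in
/-- The homotopy inverse of the forgetful map: the suspension parameter moves a new point along a
half-edge, and the cone is used at both ends. -/
def insertMap (hv : G.NoLoopAt v) : SuspWedge H ι → Cone (inclOne H ι) :=
  Wedge.desc (fun k => Susp.desc pt
    (fun z t => coneAt H (insertConf hv k z ((t : ℝ) / 2)) (bumpI ((t : ℝ) / 2)))
    (fun z => by
      simp only [Icc.coe_zero, zero_div]
      exact coneAt_insertConf_zero hv k z)
    (fun z => coneAt_insertConf_of_le hv k z (by norm_num))) (fun _ => rfl)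

/-- The time `t` has four stages, separated by `1/4`, `1/2` and `3/4`: new point at `v` with cone
parameter `4 * t`; new point running along the half-edge; new point at the midpoint with cone
parameter `3 - 4 * t`; tip of the cone. -/
theorem insertMap_wedgePt (hv : G.NoLoopAt v) (k : ι × H)
    (z : conf {j : ι // j ≠ k.1} ({Point.vert v}ᶜ : Set G.Point)) (t : unitInterval) :
    insertMap H ι hv (wedgePt H k z t) =
      coneAt H (insertConf hv k z ((t : ℝ) / 2)) (bumpI ((t : ℝ) / 2)) := rfl

theorem continuous_insertMap [Finite V] [Finite E] (hv : G.NoLoopAt v) :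
    Continuous (insertMap H ι hv) := by
  refine suspWedge_continuous_of fun k => ?_
  simp only [insertMap_wedgePt]
  have ht : Continuous fun p :
      conf {j : ι // j ≠ k.1} ({Point.vert v}ᶜ : Set G.Point) × unitInterval =>
        (p.2 : ℝ) / 2 := by fun_prop
  refine continuous_coneAt ?_ (continuous_bumpI.comp ht)
    fun p hp => Subtype.ext (bump_eq_one_of_insertConf hv k p.1 hp)
  refine (continuous_insertPt hv k.1 ?_ continuous_fst).subtype_mk _
  exact k.2.1.continuous_pos.comp ((continuous_outward.comp ht).min continuous_const)

theorem isEquivariant_insertMap (hv : G.NoLoopAt v) :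
    IsEquivariant (permWedge H ι) (permConeOne H ι) (insertMap H ι hv) := by
  intro σ a
  induction a using suspWedge_cases with
  | h => rfl
  | hm k z t =>
    rw [insertMap_wedgePt, permConeOne_coneAt]
    exact congrArg (fun c => coneAt H c _) (insertConf_relabel hv σ k.1 k.2 z _)

end InsertMap

section ForgetInsert

variable {H}

/-- The linear movement from the identity to `push`. -/
def pushAt (v : V) (u : ℝ) (x : G.Point) : G.Point :=
  G.place v x ((1 - u) * G.dist v x + u * ((1 + G.dist v x) / 2))

theorem admissible_pushAt {u : ℝ} (hu : u ∈ Icc (0 : ℝ) 1) {x : G.Point}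
    (hx : x ≠ Point.vert v) :
    Admissible v x ((1 - u) * G.dist v x + u * ((1 + G.dist v x) / 2)) := by
  have h0 := dist_nonneg (v := v) x
  have h1 := dist_le_one (v := v) x
  refine ⟨combo_mem hu ⟨h0, h1⟩ ⟨by linarith, by linarith⟩, fun h => absurd (dist_eq_zero h) hx,
    fun h => ?_⟩
  rw [h]; ring

theorem pushAt_ne_vert (hv : G.NoLoopAt v) {u : ℝ} (hu : u ∈ Icc (0 : ℝ) 1) {x : G.Point}
    (hx : x ≠ Point.vert v) : pushAt v u x ≠ Point.vert v := by
  intro h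
  have h' := congrArg (G.dist v) h
  rw [pushAt, (admissible_pushAt hu hx).dist_place hv, dist_vert_self] at h'
  have := mul_nonneg hu.1 (sub_nonneg.2 (dist_le_one (v := v) x))
  have := dist_pos hx
  linarith

/-- The new distance is a convex combination of two strictly increasing functions of the old one, so
the old distances agree and `place_injective` applies. -/
theorem pushAt_inj (hv : G.NoLoopAt v) {u : ℝ} (hu : u ∈ Icc (0 : ℝ) 1) {x y : G.Point}
    (hx : x ≠ Point.vert v) (hy : y ≠ Point.vert v) (h : pushAt v u x = pushAt v u y) :
    x = y := by
  have h' := congrArg (G.dist v) h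
  rw [pushAt, pushAt, (admissible_pushAt hu hx).dist_place hv,
    (admissible_pushAt hu hy).dist_place hv] at h'
  have hd : G.dist v x = G.dist v y := by
    rcases lt_trichotomy (G.dist v x) (G.dist v y) with hlt | heq | hlt
    · exact absurd h' (combo_lt_combo hu.1 hu.2 hlt (by linarith)).ne
    · exact heq
    · exact absurd h' (combo_lt_combo hu.1 hu.2 hlt (by linarith)).ne'
  refine place_injective hv (admissible_pushAt hu hx) hd (fun hp => ?_) (fun hl => ?_) ?_
  · have := mul_nonneg hu.1 (sub_nonneg.2 (dist_le_one (v := v) x))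
    linarith
  · have := combo_lt_combo hu.1 hu.2 hl
      (show (1 + G.dist v x) / 2 < 1 by linarith)
    linarith
  · rw [pushAt, pushAt, ← hd] at h
    exact h

/-- The movement `pushAt` of configurations. -/
def pushConf (hv : G.NoLoopAt v) {κ : Type*} (u : unitInterval)
    (z : conf κ ({Point.vert v}ᶜ : Set G.Point)) : conf κ ({Point.vert v}ᶜ : Set G.Point) :=
  ⟨fun j => pushAt v u (z.1 j),
    fun i j h => z.2.1 (pushAt_inj hv u.2 (z.2.2 i) (z.2.2 j) h),
    fun j => pushAt_ne_vert hv u.2 (z.2.2 j)⟩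

theorem continuous_pushConf [Finite V] [Finite E] (hv : G.NoLoopAt v) {κ : Type*} :
    Continuous fun p : conf κ ({Point.vert v}ᶜ : Set G.Point) × unitInterval =>
      pushConf hv p.2 p.1 := by
  refine (continuous_pi fun j => ?_).subtype_mk _
  have hg : Continuous fun p : conf κ ({Point.vert v}ᶜ : Set G.Point) × unitInterval =>
      p.1.1 j := (continuous_apply j).comp (continuous_subtype_val.comp continuous_fst)
  have hd : Continuous fun p : conf κ ({Point.vert v}ᶜ : Set G.Point) × unitInterval =>
      G.dist v (p.1.1 j) := continuous_dist.comp hg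
  exact continuous_place hg (by fun_prop) fun p => admissible_pushAt p.2.2 (p.1.2.2 j)

theorem pushConf_zero (hv : G.NoLoopAt v) {κ : Type*}
    (z : conf κ ({Point.vert v}ᶜ : Set G.Point)) : pushConf hv 0 z = z := by
  refine Subtype.ext (funext fun j => ?_)
  simp [pushConf, pushAt, place_dist hv]

/-- The inserted point always lies on the closed half-edge and all others are far away, so
`forgetBase_of_mem_closed` covers all stages at once. What is left is `push` on `z` and a
reparametrization of `t`. -/
theorem forgetMap_insertMap_wedgePt (hv : G.NoLoopAt v) (k : ι × H)
    (z : conf {j : ι // j ≠ k.1} ({Point.vert v}ᶜ : Set G.Point)) (t : unitInterval) :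
    forgetMap H ι (insertMap H ι hv (wedgePt H k z t)) = wedgePt H k (pushConf hv 1 z)
      (projIcc 0 1 zero_le_one (2 * min (outward ((t : ℝ) / 2)) (1 / 2))) := by
  set r := (t : ℝ) / 2 with hr
  rw [insertMap_wedgePt, forgetMap_coneAt]
  have hself : (insertConf hv k z r).1 k.1 = k.2.1.pos (min (outward r) (1 / 2)) :=
    insertPt_self _ _ _
  have hd : ∀ j, j ≠ k.1 → 1 / 2 ≤ G.dist v ((insertConf hv k z r).1 j) :=
    fun j hj => (lt_dist_insertPt hv _ z hj).le
  have hmem : (insertConf hv k z r).1 k.1 ∈ k.2.1.closedCarrier := by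
    rw [hself]
    refine ⟨?_, (dist_pos_height hv _ r).trans_le (height_mem r).2⟩
    unfold HalfEdge.pos
    split_ifs <;> exact mem_range_self _
  rw [forgetBase_of_mem_closed _ k hmem hd fun j hj => ne_vert_of_half_le (hd j hj)]
  rw [hself, dist_pos_height hv]
  refine congrArg (fun z => wedgePt H k z _) (Subtype.ext (funext fun j => ?_))
  refine (insertPt_of_ne _ _ j.2).trans ?_
  simp [pushConf, pushAt, push_eq_place hv]

theorem forgetMap_comp_insertMap [Finite V] [Finite E] (hv : G.NoLoopAt v) :
    EqPtdHomotopic (permWedge H ι) (permWedge H ι) (forgetMap H ι ∘ insertMap H ι hv) id := by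
  refine EqPtdHomotopic.symm ?_
  -- Straight line from `t` to the parameter of the composite. It fixes `0` and `1` at every time
  -- `u`, so it passes to the suspension.
  let τ (u t : unitInterval) : unitInterval := projIcc 0 1 zero_le_one
    ((1 - u) * t + u * (2 * min (outward ((t : ℝ) / 2)) (1 / 2)))
  have hτ0 (u) : τ u 0 = 0 := by
    simp only [τ, Icc.coe_zero, zero_div, outward_zero]
    rw [min_eq_left (by norm_num), projIcc_of_le_left _ (by norm_num)]
    rfl
  have hτ1 (u) : τ u 1 = 1 := by
    simp only [τ, Icc.coe_one]
    rw [min_eq_right (half_le_outward (by norm_num)), projIcc_of_right_le _ (by norm_num)]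
    rfl
  have hτ : Continuous fun p : unitInterval × unitInterval => τ p.1 p.2 := by
    have := continuous_outward
    exact (continuous_projIcc (h := zero_le_one)).comp (by fun_prop)
  refine ⟨fun p => Wedge.desc (fun k => Susp.desc pt
    (fun z t => wedgePt H k (pushConf hv p.2 z) (τ p.2 t))
    (fun z => by rw [hτ0, wedgePt_zero]) (fun z => by rw [hτ1, wedgePt_one])) (fun _ => rfl) p.1,
    ?_, fun a => ?_, fun a => ?_, fun _ => rfl, fun u σ a => ?_⟩
  · refine suspWedge_continuous_prod continuous_const fun k => ?_
    refine (continuous_wedgePt H k).comp (Continuous.prodMk ?_ ?_)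
    · exact (continuous_pushConf hv).comp
        ((continuous_fst.comp continuous_fst).prodMk continuous_snd)
    · exact hτ.comp (continuous_snd.prodMk (continuous_snd.comp continuous_fst))
  · induction a using suspWedge_cases with
    | h => rfl
    | hm k z t =>
      change wedgePt H k (pushConf hv 0 z) (τ 0 t) = wedgePt H k z t
      rw [pushConf_zero]
      congr 1
      simp [τ]
  · induction a using suspWedge_cases with
    | h => rfl
    | hm k z t =>
      refine Eq.trans ?_ (forgetMap_insertMap_wedgePt hv k z t).symm
      change wedgePt H k (pushConf hv 1 z) (τ 1 t) = _
      congr 1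
      simp [τ]
  · induction a using suspWedge_cases with
    | h => rfl
    | hm k z t => rfl

end ForgetInsert

end MGraph

/-! ### The composite on the cone, and the equivalence `P` -/

namespace MGraph

variable {V E : Type*} {G : MGraph V E} {v : V} (H : Set (G.HalfEdge v)) {ι : Type*}

section Weight

open Classical in
/-- The bump function of the distance to `v` on `∪H`, extended by zero. -/
def weightPt (x : G.Point) : ℝ := if x ∈ cup H then bump (G.dist v x) else 0

theorem weightPt_of_notMem {x : G.Point} (h : x ∈ (cup H)ᶜ) : weightPt H x = 0 := if_neg h

/-- Extension by zero is continuous since `bump` vanishes at both ends of a half-edge. -/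
theorem continuous_weightPt [Finite E] : Continuous (weightPt H) := by
  let C (o : Option H) : Set G.Point := o.elim (cup H)ᶜ fun h => h.1.closedCarrier
  refine continuous_of_finite_closed_cover C ?_ (fun x => ?_) ?_
  · rintro (_ | h)
    · exact (isOpen_cup H).isClosed_compl
    · exact h.1.isClosed_closedCarrier
  · by_cases hx : x ∈ cup H
    · simp only [cup, mem_iUnion] at hx
      obtain ⟨h, hh, hx⟩ := hx
      exact ⟨some ⟨h, hh⟩, h.carrier_subset hx⟩
    · exact ⟨none, hx⟩
  · rintro (_ | h)
    · exact continuous_const.congr fun x => (weightPt_of_notMem H x.2).symm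
    · refine (continuous_bump.comp ((continuous_dist (v := v)).comp continuous_subtype_val)).congr ?_
      rintro ⟨x, hx⟩
      simp only [comp_apply]
      rcases HalfEdge.mem_closedCarrier hx with rfl | hd | hm
      · rw [weightPt_of_notMem H vert_mem_compl_cup, dist_vert_self, bump_zero]
      · rw [weightPt_of_notMem H (mem_compl_cup hd.ge), hd, bump_of_le (by norm_num)]
      · exact (if_pos (mem_biUnion h.2 hm)).symm

variable [Fintype ι]

/-- The total weight of a configuration. -/
def weight (c : ι → G.Point) : unitInterval := projIcc 0 1 zero_le_one (∑ i, weightPt H (c i))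

variable {H}

theorem weight_of_forall {c : ι → G.Point} (h : ∀ i, c i ∈ (cup H)ᶜ) : weight H c = 0 := by
  rw [weight, Finset.sum_eq_zero fun i _ => weightPt_of_notMem H (h i),
    projIcc_of_le_left _ le_rfl]
  rfl

/-- Only one summand can be nonzero. Taking the sum yields a cone parameter that is continuous and
symmetric without naming the point in question. -/
theorem weight_of_mem {c : ι → G.Point} (hc : c ∈ confOne ι univ (G.ball v)) (k : ι × H)
    (hk : c k.1 ∈ k.2.1.carrier) : weight H c = bumpI (G.dist v (c k.1)) := by
  have h : ∑ i, weightPt H (c i) = bump (G.dist v (c k.1)) := by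
    rw [Finset.sum_eq_single k.1]
    · exact if_pos (mem_biUnion k.2.2 hk)
    · intro i _ hi
      refine weightPt_of_notMem H (mem_compl_cup ?_)
      by_contra! hlt
      exact hi (hc.2 _ _ hlt hk.2)
    · exact fun h => absurd (Finset.mem_univ _) h
  rw [weight, h, projIcc_of_mem _ (bump_mem _)]
  rfl

theorem weight_relabel (σ : Equiv.Perm ι) (c : ι → G.Point) :
    weight H (fun i => c (σ.symm i)) = weight H c := by
  rw [weight, Equiv.sum_comp σ.symm (fun i => weightPt H (c i)), weight]

theorem continuous_weight [Finite E] : Continuous (weight H : (ι → G.Point) → _) :=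
  (continuous_projIcc (h := zero_le_one)).comp
    (continuous_finsetSum _ fun i _ => (continuous_weightPt H).comp (continuous_apply i))

end Weight

section Collapse

variable {H}

theorem exists_mem_carrier_of_not_forall {c : ι → G.Point} (h : ¬ ∀ i, c i ∈ (cup H)ᶜ) :
    ∃ k : ι × H, c k.1 ∈ k.2.1.carrier := by
  simp only [not_forall, mem_compl_iff, not_not, cup, mem_iUnion] at h
  obtain ⟨i, a, ha, h⟩ := h
  exact ⟨(i, ⟨a, ha⟩), h⟩

/-- The movement from the identity to the profile `outward`. -/
def outwardAt (u : unitInterval) (r : ℝ) : ℝ := (1 - u) * r + u * outward r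

theorem isProfile_outwardAt (u : unitInterval) : IsProfile (outwardAt u) :=
  IsProfile.id.combo isProfile_outward u.2

/-- The radial movement of configurations by the profile `outwardAt`. -/
def moveOut (hv : G.NoLoopAt v) (u : unitInterval)
    (c : confOne ι (univ : Set G.Point) (G.ball v)) : confOne ι (univ : Set G.Point) (G.ball v) :=
  ⟨fun i => G.radial v (outwardAt u) (c.1 i), radial_mem_confOne hv (isProfile_outwardAt u) c.2⟩

/-- The radial movement of configurations outside `∪H` by the profile `outwardAt`. -/
def moveOutCompl (hv : G.NoLoopAt v) (u : unitInterval)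
    (c : confOne ι (cup H)ᶜ (G.ball v \ cup H)) : confOne ι (cup H)ᶜ (G.ball v \ cup H) :=
  ⟨fun i => G.radial v (outwardAt u) (c.1 i), mem_confOne_compl.2
    ⟨radial_mem_confOne hv (isProfile_outwardAt u) (confOne_sub H ι c.2),
      fun i => radial_mem_compl_cup hv (isProfile_outwardAt u) (c.2.1.2 i)⟩⟩

theorem continuous_radial_outwardAt [Finite V] [Finite E] {S : Set (ι → G.Point)} :
    Continuous fun p : S × unitInterval =>
      fun i => G.radial v (outwardAt p.2) ((p.1 : ι → G.Point) i) := by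
  refine continuous_pi fun i => ?_
  have hg : Continuous fun p : S × unitInterval => (p.1 : ι → G.Point) i :=
    (continuous_apply i).comp (continuous_subtype_val.comp continuous_fst)
  have hd : Continuous fun p : S × unitInterval => G.dist v ((p.1 : ι → G.Point) i) :=
    continuous_dist.comp hg
  have := continuous_outward
  refine continuous_radial hg ?_ fun p => isProfile_outwardAt p.2
  unfold outwardAt
  fun_prop

theorem continuous_moveOut [Finite V] [Finite E] (hv : G.NoLoopAt v) :
    Continuous fun p : confOne ι (univ : Set G.Point) (G.ball v) × unitInterval =>
      moveOut hv p.2 p.1 :=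
  continuous_radial_outwardAt.subtype_mk _

theorem continuous_moveOutCompl [Finite V] [Finite E] (hv : G.NoLoopAt v) :
    Continuous fun p : confOne ι (cup H)ᶜ (G.ball v \ cup H) × unitInterval =>
      moveOutCompl hv p.2 p.1 :=
  continuous_radial_outwardAt.subtype_mk _

theorem outwardAt_zero (r : ℝ) : outwardAt 0 r = r := by simp [outwardAt]

theorem outwardAt_one : outwardAt 1 = outward := by funext r; simp [outwardAt]

/-- A point that is on `∪H` after the movement was on the same half-edge before it, at a distance
where `outward` lies strictly between `0` and `1/2`; so `bump_eq_one` applies. -/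
theorem weight_eq_one_of_moveOut [Fintype ι] (hv : G.NoLoopAt v)
    (c : confOne ι (univ : Set G.Point) (G.ball v))
    (h : ¬ ∀ i, (moveOut hv 1 c).1 i ∈ (cup H)ᶜ) : weight H c.1 = 1 := by
  obtain ⟨⟨i, a⟩, hk⟩ := exists_mem_carrier_of_not_forall h
  change G.place v (c.1 i) (outwardAt 1 (G.dist v (c.1 i))) ∈ a.1.carrier at hk
  rw [outwardAt_one] at hk
  obtain ⟨⟨s, hs, hx⟩, h0, h1⟩ :=
    (isProfile_outward.admissible (c.1 i)).of_place_mem_carrier hv hk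
  have hd : s = G.dist v (c.1 i) := by
    rw [hx, a.1.dist_pos_eq hv (Ioo_subset_Icc_self hs)]
  have hs' : s < 1 / 2 := by
    by_contra! h
    rw [← hd] at h1
    exact absurd (half_le_outward (le_trans (by norm_num) h)) h1.not_ge
  have hm : c.1 i ∈ a.1.carrier := by
    rw [hx]
    exact a.1.pos_mem_carrier hv hs.1 hs'
  rw [weight_of_mem c.2 (i, a) hm]
  exact Subtype.ext (bump_eq_one h0 h1)

/-- Forgetting and reinserting a point at distance `d` gives it the distance `outward d` and pushes
the others, which is the movement by `outward`, because this profile agrees with `push` outside the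
ball. -/
theorem insertMap_forgetBase [Fintype ι] (hv : G.NoLoopAt v)
    (c : confOne ι (univ : Set G.Point) (G.ball v)) :
    insertMap H ι hv (forgetBase H c) = coneAt H (moveOut hv 1 c) (weight H c.1) := by
  by_cases h : ∀ i, c.1 i ∈ (cup H)ᶜ
  · have h' : ∀ i, (moveOut hv 1 c).1 i ∈ (cup H)ᶜ :=
      fun i => radial_mem_compl_cup hv (isProfile_outwardAt 1) (h i)
    rw [forgetBase_of_notMem c h, weight_of_forall h, coneAt_zero h']
    rfl
  · obtain ⟨⟨i, a⟩, hk⟩ := exists_mem_carrier_of_not_forall h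
    have hfar : ∀ j, j ≠ i → 1 / 2 ≤ G.dist v (c.1 j) := fun j hj => by
      by_contra! hlt
      exact hj (c.2.2 _ _ hlt hk.2)
    have hd0 := HalfEdge.dist_pos_of_mem hk
    have hd1 : G.dist v (c.1 i) < 1 / 2 := hk.2
    have hx := HalfEdge.eq_pos_of_mem hv hk
    rw [forgetBase_of_mem c (i, a) hk, weight_of_mem c.2 (i, a) hk, insertMap_wedgePt]
    simp only
    set d := G.dist v (c.1 i) with hd
    rw [projIcc_of_mem zero_le_one (show 2 * d ∈ Icc (0 : ℝ) 1 by constructor <;> linarith)]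
    simp only [mul_div_cancel_left₀ d (two_ne_zero)]
    have hmi : (moveOut hv 1 c).1 i = a.1.pos (outward d) := by
      change G.place v (c.1 i) (outwardAt 1 (G.dist v (c.1 i))) = _
      rw [outwardAt_one, ← hd, hx, place_pos a.1 ⟨hd0, by linarith⟩]
    have hmj : ∀ j, j ≠ i → (moveOut hv 1 c).1 j = push G v (c.1 j) := fun j hj => by
      change G.place v (c.1 j) (outwardAt 1 (G.dist v (c.1 j))) = _
      rw [outwardAt_one, outward_of_half_le (hfar j hj), push_eq_place hv]
    -- From `3/8` on, `outward d` may exceed the cut-off `1/2` in `insertConf`, so the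
    -- configurations may differ. But then both miss `∪H` and the cone parameter is `0`, so both
    -- sides are the tip.
    rcases lt_or_ge d (3 / 8) with hlt | hge
    · congr 1
      refine Subtype.ext (funext fun j => ?_)
      by_cases hj : j = i
      · subst hj
        rw [hmi]
        refine (insertPt_self _ _ _).trans ?_
        rw [min_eq_left]
        rw [outward_of_le hlt.le]
        exact min_le_right _ _
      · rw [hmj j hj]
        exact insertPt_of_ne _ _ hj
    · refine (coneAt_insertConf_of_le hv (i, a) _ hge).trans ?_
      rw [bumpI_of_le hge, coneAt_zero]
      intro j
      by_cases hj : j = i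
      · subst hj
        rw [hmi]
        refine mem_compl_cup ?_
        rw [a.1.dist_pos_eq hv]
        · exact half_le_outward hge
        · exact isProfile_outward.mapsTo ⟨hd0.le, by linarith⟩
      · exact radial_mem_compl_cup hv (isProfile_outwardAt 1) (mem_compl_cup (hfar j hj))

theorem insertMap_comp_forgetMap [Finite V] [Finite E] [Fintype ι] (hv : G.NoLoopAt v) :
    EqPtdHomotopic (permConeOne H ι) (permConeOne H ι) (insertMap H ι hv ∘ forgetMap H ι) id := by
  -- Two stages from the identity: move all points by `outward`, leaving the cone parameter alone;
  -- then lower the cone parameter.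
  refine EqPtdHomotopic.symm (EqPtdHomotopic.trans
    (g := Cone.map (moveOutCompl hv 1) (moveOut hv 1) fun _ => rfl) ?_ ?_)
  · refine Cone.eqPtdHomotopic_map _ _ (a := moveOutCompl hv) (b := moveOut hv) (fun _ _ => rfl)
      (continuous_moveOutCompl hv) (continuous_moveOut hv) (fun _ _ _ => rfl) (fun _ _ _ => rfl)
      rfl (fun c t => ?_) (fun c => ?_) rfl (fun _ _ => rfl) (fun _ => rfl)
    · refine congrArg (fun c => Cone.mk _ c t) (Subtype.ext (funext fun i => ?_)).symm
      simp [moveOutCompl, radial, outwardAt_zero, place_dist hv]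
    · refine congrArg (Cone.base _) (Subtype.ext (funext fun i => ?_)).symm
      simp [moveOut, radial, outwardAt_zero, place_dist hv]
  · have hmem (c : confOne ι (cup H)ᶜ (G.ball v \ cup H)) (i : ι) :
        (moveOut hv 1 (inclOne H ι c)).1 i ∈ (cup H)ᶜ :=
      radial_mem_compl_cup hv (isProfile_outwardAt 1) (c.2.1.2 i)
    have hw (c : confOne ι (cup H)ᶜ (G.ball v \ cup H)) : weight H (inclOne H ι c).1 = 0 :=
      weight_of_forall c.2.1.2
    -- At time `u` the parameter is `1 - u * (1 - weight)` on the base and `s * (1 - u)` on the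
    -- cone. They agree where the two are glued, as `s = 1` and the weight is `0` there; and the
    -- first is `1` wherever the moved configuration meets `∪H`.
    let F (p : Cone (inclOne H ι) × unitInterval) : Cone (inclOne H ι) :=
      Cone.desc _ pt (fun c s => Cone.mk _ (moveOutCompl hv 1 c) (s * unitInterval.symm p.2))
        (fun c => coneAt H (moveOut hv 1 c)
          (unitInterval.symm (p.2 * unitInterval.symm (weight H c.1))))
        (fun c => by rw [zero_mul, Cone.mk_zero])
        (fun c => by
          rw [coneAt_of_forall (hmem c), hw, unitInterval.symm_zero, mul_one, one_mul]
          rfl) p.1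
    have hc : Continuous (moveOut hv 1 : confOne ι (univ : Set G.Point) (G.ball v) → _) :=
      (continuous_moveOut hv).comp (continuous_id.prodMk continuous_const)
    have hc' : Continuous (moveOutCompl hv 1 : confOne ι (cup H)ᶜ (G.ball v \ cup H) → _) :=
      (continuous_moveOutCompl hv).comp (continuous_id.prodMk continuous_const)
    have hcw : Continuous fun c : confOne ι (univ : Set G.Point) (G.ball v) => weight H c.1 :=
      continuous_weight.comp continuous_subtype_val
    refine ⟨F, ?_, fun a => ?_, fun a => ?_, fun _ => rfl, fun u σ a => ?_⟩
    · refine Cone.continuous_prod continuous_const ?_ ?_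
      · exact Cone.continuous_mk.comp (Continuous.prodMk
          (hc'.comp (continuous_fst.comp continuous_fst)) (by fun_prop))
      · refine continuous_coneAt (hc.comp continuous_fst) (unitInterval.continuous_symm.comp
          (continuous_snd.mul (unitInterval.continuous_symm.comp (hcw.comp continuous_fst))))
          fun p hp => ?_
        rw [weight_eq_one_of_moveOut hv p.1 hp, unitInterval.symm_one, mul_zero,
          unitInterval.symm_zero]
    · induction a using Cone.cases with
      | h => rfl
      | hm c s =>
        change Cone.mk _ (moveOutCompl hv 1 c) (s * unitInterval.symm 0) =
          Cone.mk _ (moveOutCompl hv 1 c) s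
        rw [unitInterval.symm_zero, mul_one]
      | hb c =>
        change coneAt H _ (unitInterval.symm (0 * _)) = Cone.base _ (moveOut hv 1 c)
        rw [zero_mul, unitInterval.symm_zero, coneAt_one]
    · induction a using Cone.cases with
      | h => rfl
      | hm c s =>
        change Cone.mk _ (moveOutCompl hv 1 c) (s * unitInterval.symm 1) = pt
        rw [unitInterval.symm_one, mul_zero, Cone.mk_zero]
      | hb c =>
        refine Eq.trans ?_ (insertMap_forgetBase hv c).symm
        change coneAt H _ (unitInterval.symm (1 * unitInterval.symm (weight H c.1))) = _
        rw [one_mul, unitInterval.symm_symm]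
    · induction a using Cone.cases with
      | h => rfl
      | hm c s => rfl
      | hb c =>
        change coneAt H (moveOut hv 1 (relabelOne σ c)) (unitInterval.symm (u *
          unitInterval.symm (weight H fun i => c.1 (σ.symm i)))) = permConeOne H ι σ (coneAt H _ _)
        rw [permConeOne_coneAt, weight_relabel]
        rfl

theorem isEqPtdHomotopyEquiv_forgetMap [Finite V] [Finite E] [Fintype ι] (hv : G.NoLoopAt v) :
    IsEqPtdHomotopyEquiv (permConeOne H ι) (permWedge H ι) (forgetMap H ι) :=
  ⟨continuous_forgetMap, rfl, isEquivariant_forgetMap, insertMap H ι hv, continuous_insertMap hv,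
    rfl, isEquivariant_insertMap hv, insertMap_comp_forgetMap hv, forgetMap_comp_insertMap hv⟩

theorem isEqPtdHomotopyEquiv_insertMap [Finite V] [Finite E] [Fintype ι] (hv : G.NoLoopAt v) :
    IsEqPtdHomotopyEquiv (permWedge H ι) (permConeOne H ι) (insertMap H ι hv) :=
  ⟨continuous_insertMap hv, rfl, isEquivariant_insertMap hv, forgetMap H ι, continuous_forgetMap,
    rfl, isEquivariant_forgetMap, forgetMap_comp_insertMap hv, insertMap_comp_forgetMap hv⟩

end Collapse

/-! ### The boundary of the identification -/

section Boundary

variable {H}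

theorem boundary_coneIncl_coneAt_of_forall {c : confOne ι (univ : Set G.Point) (G.ball v)}
    (h : ∀ i, c.1 i ∈ (cup H)ᶜ) (s : unitInterval) :
    Cone.boundary (incl H ι) (coneIncl H ι (coneAt H c s)) = Susp.mk ⟨c.1, c.2.1.1, h⟩ s := by
  rw [coneAt_of_forall h]
  rfl

theorem boundary_coneIncl_coneAt_of_not {c : confOne ι (univ : Set G.Point) (G.ball v)}
    (h : ¬ ∀ i, c.1 i ∈ (cup H)ᶜ) (s : unitInterval) :
    Cone.boundary (incl H ι) (coneIncl H ι (coneAt H c s)) = pt := by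
  rw [coneAt_of_not h]
  rfl

theorem addV_relabel (hv : G.NoLoopAt v) (σ : Equiv.Perm ι) (i : ι)
    (z : conf {j : ι // j ≠ i} ({Point.vert v}ᶜ : Set G.Point)) :
    addV H hv (σ i) (relabel (σ.subtypeEquiv
      (fun j => (σ.injective.ne_iff (x := j) (y := i)).symm)) z) = relabel σ (addV H hv i z) :=
  Subtype.ext (funext fun j => insertPt_relabel σ i _ z j)

theorem addH_relabel (hv : G.NoLoopAt v) (σ : Equiv.Perm ι) (i : ι) (h : G.HalfEdge v)
    (z : conf {j : ι // j ≠ i} ({Point.vert v}ᶜ : Set G.Point)) :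
    addH H hv (σ i) h (relabel (σ.subtypeEquiv
      (fun j => (σ.injective.ne_iff (x := j) (y := i)).symm)) z) = relabel σ (addH H hv i h z) :=
  Subtype.ext (funext fun j => insertPt_relabel σ i _ z j)

/-- The path of suspension parameters on the part of the suspension that adds the vertex. -/
def paramV (u t : unitInterval) : unitInterval :=
  projIcc 0 1 zero_le_one ((1 - (u : ℝ)) * min 1 (4 * (t : ℝ)) + u * (2 * t))

/-- The path of suspension parameters on the part of the suspension that adds a midpoint. -/
def paramH (u t : unitInterval) : unitInterval :=
  projIcc 0 1 zero_le_one ((1 - (u : ℝ)) * max 0 (3 - 4 * (t : ℝ)) + u * (2 - 2 * t))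

variable (H ι) in
/-- The homotopy from the boundary of the identification to the difference of the maps that add
a point. -/
def boundaryHomotopy (hv : G.NoLoopAt v) (u : unitInterval) :
    SuspWedge H ι → Susp (conf ι (cup H)ᶜ) :=
  Wedge.desc (fun k => Susp.desc pt
    (fun z t => if (t : ℝ) ≤ 1 / 2 then Susp.mk (addV H hv k.1 z) (paramV u t)
      else Susp.mk (addH H hv k.1 k.2.1 z) (paramH u t))
    (fun z => by
      rw [if_pos (by norm_num)]
      simp [paramV, Susp.mk_zero])
    (fun z => by
      rw [if_neg (by norm_num)]
      simp only [paramH, Icc.coe_one]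
      rw [max_eq_left (by norm_num), projIcc_of_le_left _ (by norm_num)]
      exact Susp.mk_zero _)) (fun _ => rfl)

theorem boundaryHomotopy_wedgePt (hv : G.NoLoopAt v) (u : unitInterval) (k : ι × H)
    (z : conf {j : ι // j ≠ k.1} ({Point.vert v}ᶜ : Set G.Point)) (t : unitInterval) :
    boundaryHomotopy H ι hv u (wedgePt H k z t) =
      if (t : ℝ) ≤ 1 / 2 then Susp.mk (addV H hv k.1 z) (paramV u t)
      else Susp.mk (addH H hv k.1 k.2.1 z) (paramH u t) := rfl

theorem continuous_boundaryHomotopy [Finite V] [Finite E] (hv : G.NoLoopAt v) :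
    Continuous fun p : SuspWedge H ι × unitInterval => boundaryHomotopy H ι hv p.2 p.1 := by
  refine suspWedge_continuous_prod continuous_const fun k => ?_
  simp only [boundaryHomotopy_wedgePt]
  have hV : Continuous (addV H hv k.1) := continuous_addAt hv _ _ _ _
  have hH : Continuous (addH H hv k.1 k.2.1) := continuous_addAt hv _ _ _ _
  have hpV : Continuous fun p : unitInterval × unitInterval => paramV p.1 p.2 :=
    (continuous_projIcc (h := zero_le_one)).comp (by fun_prop)
  have hpH : Continuous fun p : unitInterval × unitInterval => paramH p.1 p.2 :=
    (continuous_projIcc (h := zero_le_one)).comp (by fun_prop)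
  have hsw : Continuous fun p :
      (conf {j : ι // j ≠ k.1} ({Point.vert v}ᶜ : Set G.Point) × unitInterval) × unitInterval =>
        (p.2, p.1.2) := by fun_prop
  refine Continuous.if_le ?_ ?_ (by fun_prop) continuous_const ?_
  · exact Susp.continuous_mk.comp ((hV.comp (continuous_fst.comp continuous_fst)).prodMk
      (hpV.comp hsw))
  · exact Susp.continuous_mk.comp ((hH.comp (continuous_fst.comp continuous_fst)).prodMk
      (hpH.comp hsw))
  · rintro ⟨⟨z, t⟩, u⟩ ht
    simp only at ht ⊢
    have h1 : paramV u t = 1 := by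
      unfold paramV
      rw [ht, min_eq_left (by norm_num), projIcc_of_right_le _ (by norm_num)]
      rfl
    have h2 : paramH u t = 1 := by
      unfold paramH
      rw [ht, max_eq_right (by norm_num), projIcc_of_right_le _ (by norm_num)]
      rfl
    rw [h1, h2, Susp.mk_one, Susp.mk_one]

/-- The boundary map keeps the cone parameter and kills the base, so only the stages in which the
new point waits at `v` or at the midpoint survive; `bump (t / 2)` is then `4 * t` or `max 0 (3 - 4 *
t)`. -/
theorem boundaryHomotopy_zero (hv : G.NoLoopAt v) (a : SuspWedge H ι) :
    boundaryHomotopy H ι hv 0 a =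
      Cone.boundary (incl H ι) (coneIncl H ι (insertMap H ι hv a)) := by
  induction a using suspWedge_cases with
  | h => rfl
  | hm k z t =>
    have ht0 := t.2.1
    have ht1 := t.2.2
    rw [boundaryHomotopy_wedgePt, insertMap_wedgePt]
    set r := (t : ℝ) / 2 with hr
    have hout : (t : ℝ) ≤ 1 / 2 → outward r = min (max 0 (4 * r - 1 / 2)) (1 / 2) :=
      fun h => outward_of_le (by linarith)
    have hV : (t : ℝ) ≤ 1 / 4 → outward r = 0 := fun h => by
      rw [hout (by linarith), max_eq_left (by linarith), min_eq_left (by norm_num)]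
    have hH : 1 / 2 ≤ (t : ℝ) → 1 / 2 ≤ outward r := fun h => by
      rcases le_or_gt r (3 / 8) with h' | h'
      · rw [outward_of_le h', max_eq_right (by linarith), min_eq_right (by linarith)]
      · exact half_le_outward h'.le
    rcases le_or_gt (t : ℝ) (1 / 4) with h4 | h4
    · rw [if_pos (by linarith), boundary_coneIncl_coneAt_of_forall
        (insertConf_mem_compl_cup hv k z (Or.inl (hV h4)))]
      congr 1
      · refine Subtype.ext (funext fun j => ?_)
        change insertPt v k.1 (Point.vert v) z.1 j =
          insertPt v k.1 (k.2.1.pos (min (outward r) (1 / 2))) z.1 j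
        rw [hV h4, min_eq_left (by norm_num), HalfEdge.pos_zero]
      · refine Subtype.ext ?_
        simp only [paramV, Icc.coe_zero, sub_zero, one_mul, zero_mul, add_zero]
        rw [min_eq_right (by linarith),
          projIcc_of_mem zero_le_one ⟨by linarith, by linarith⟩]
        change 4 * (t : ℝ) = bump r
        unfold bump
        rw [min_eq_right (a := 1) (by linarith), min_eq_left (by linarith),
          max_eq_right (by linarith)]
        linarith
    -- For `1/4 < t < 1/2` the new point is inside the half-edge, so the configuration lies in the
    -- collapsed base; `paramV 0 t` is already `1`.
    rcases lt_or_ge (t : ℝ) (1 / 2) with h2 | h2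
    · have h1 : paramV 0 t = 1 := by
        simp only [paramV, Icc.coe_zero, sub_zero, one_mul, zero_mul, add_zero]
        rw [min_eq_left (by linarith), projIcc_of_right_le _ le_rfl]
        rfl
      rw [if_pos h2.le, h1, Susp.mk_one, boundary_coneIncl_coneAt_of_not]
      refine insertConf_notMem_compl_cup hv k z ?_ ?_
      · rw [hout h2.le]
        exact lt_min (lt_max_of_lt_right (by linarith)) (by norm_num)
      · rw [hout h2.le, max_eq_right (by linarith), min_eq_left (by linarith)]
        linarith
    · have hmid : (⟨(insertConf hv k z r).1, (insertConf hv k z r).2.1.1,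
          insertConf_mem_compl_cup hv k z (Or.inr (hH h2))⟩ : conf ι (cup H)ᶜ) =
          addH H hv k.1 k.2.1 z := by
        refine Subtype.ext (funext fun j => ?_)
        change insertPt v k.1 (k.2.1.pos (min (outward r) (1 / 2))) z.1 j =
          insertPt v k.1 k.2.1.mid z.1 j
        rw [min_eq_right (hH h2), HalfEdge.pos_half]
      rw [boundary_coneIncl_coneAt_of_forall
        (insertConf_mem_compl_cup hv k z (Or.inr (hH h2))), hmid]
      have hb : bump r = max 0 (3 - 4 * (t : ℝ)) := by
        unfold bump
        rw [min_eq_left (a := 1) (by linarith), min_eq_right (by linarith)]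
        congr 1
        linarith
      -- At `t = 1/2` the homotopy takes the branch of `add_v`, whereas the configuration already
      -- has the midpoint. Both parameters are `1`, so both values are the base point.
      rcases eq_or_lt_of_le h2 with h2 | h2
      · have h1 : paramV 0 t = 1 := by
          simp only [paramV, Icc.coe_zero, sub_zero, one_mul, zero_mul, add_zero]
          rw [min_eq_left (by linarith), projIcc_of_right_le _ le_rfl]
          rfl
        have h3 : bumpI r = 1 := by
          refine Subtype.ext (hb.trans ?_)
          rw [← h2]
          norm_num
        rw [if_pos h2.ge, h1, h3, Susp.mk_one, Susp.mk_one]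
      · rw [if_neg h2.not_ge]
        congr 1
        refine Subtype.ext ?_
        simp only [paramH, Icc.coe_zero, sub_zero, one_mul, zero_mul, add_zero]
        rw [projIcc_of_mem zero_le_one ⟨le_max_left _ _, max_le zero_le_one (by linarith)⟩]
        exact hb.symm

theorem boundaryHomotopy_one (hv : G.NoLoopAt v) (a : SuspWedge H ι) :
    boundaryHomotopy H ι hv 1 a = diffMap H ι hv a := by
  induction a using suspWedge_cases with
  | h => rfl
  | hm k z t =>
    rw [boundaryHomotopy_wedgePt]
    simp only [paramV, paramH, Icc.coe_one, sub_self, zero_mul, zero_add, one_mul]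
    rfl

theorem boundary_comp_insertMap [Finite V] [Finite E] (hv : G.NoLoopAt v) :
    EqPtdHomotopic (permWedge H ι) (permSusp H ι)
      (Cone.boundary (incl H ι) ∘ coneIncl H ι ∘ insertMap H ι hv) (diffMap H ι hv) := by
  refine ⟨fun p => boundaryHomotopy H ι hv p.2 p.1, continuous_boundaryHomotopy hv,
    boundaryHomotopy_zero hv, boundaryHomotopy_one hv, fun _ => rfl, fun u σ a => ?_⟩
  induction a using suspWedge_cases with
  | h => rfl
  | hm k z t =>
    change (if (t : ℝ) ≤ 1 / 2 then Susp.mk (addV H hv (σ k.1) (relabel _ z)) (paramV u t)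
      else Susp.mk (addH H hv (σ k.1) k.2.1 (relabel _ z)) (paramH u t)) =
      permSusp H ι σ (if (t : ℝ) ≤ 1 / 2 then Susp.mk (addV H hv k.1 z) (paramV u t)
      else Susp.mk (addH H hv k.1 k.2.1 z) (paramH u t))
    rw [addV_relabel, addH_relabel]
    split_ifs <;> rfl

end Boundary

end MGraph

/-! ### Cones and wedges of unordered configurations as orbit spaces -/

/-- Continuous maps to `Prop` are the open sets, so it is enough to test the quotient property on
such maps; this makes the continuity criteria for cones and wedges applicable. -/
theorem isQuotientMap_of_forall_continuous {A B : Type*} [TopologicalSpace A] [TopologicalSpace B]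
    {q : A → B} (hs : Surjective q) (hc : Continuous q)
    (h : ∀ f : B → Prop, Continuous (f ∘ q) → Continuous f) : IsQuotientMap q :=
  isQuotientMap_iff_isClosed.2 ⟨hs, fun s => ⟨fun hs => hs.preimage hc, fun hs =>
    ⟨continuous_Prop.1 (h (fun b => b ∈ sᶜ) (continuous_Prop.2 hs.isOpen_compl))⟩⟩⟩

section ConeOrbit

variable {S X Y X' Y' : Type*} [TopologicalSpace X] [TopologicalSpace Y] [TopologicalSpace X']
  [TopologicalSpace Y'] {f : X → Y} {f' : X' → Y'} {rX : S → X → X} {rY : S → Y → Y}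
  {qX : X → X'} {qY : Y → Y'}

theorem Cone.isOrbitMap_map [Nonempty S] (hr : ∀ s x, rY s (f x) = f (rX s x))
    (hq : ∀ x, qY (f x) = f' (qX x)) (hX : IsQuotientMap qX) (hY : IsQuotientMap qY)
    (iX : ∀ s x, qX (rX s x) = qX x) (iY : ∀ s y, qY (rY s y) = qY y)
    (oX : ∀ x x', qX x = qX x' → ∃ s, rX s x = x') (oY : ∀ y y', qY y = qY y' → ∃ s, rY s y = y') :
    IsOrbitMap (fun s => Cone.map (rX s) (rY s) (hr s)) (Cone.map qX qY hq) := by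
  have hc : Continuous (Cone.map qX qY hq) := Cone.continuous_map hq hX.continuous hY.continuous
  refine ⟨⟨hc, rfl, fun s a => ?_⟩, isQuotientMap_of_forall_continuous (fun a => ?_) hc
    fun g hg => Cone.continuous_of_mk_base ?_ ?_, fun a b hab => ?_⟩
  · induction a using Cone.cases with
    | h => rfl
    | hm x t => exact congrArg (fun x => Cone.mk f' x t) (iX s x)
    | hb y => exact congrArg (Cone.base f') (iY s y)
  · induction a using Cone.cases with
    | h => exact ⟨pt, rfl⟩
    | hm x t =>
      obtain ⟨x, rfl⟩ := hX.surjective x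
      exact ⟨Cone.mk f x t, rfl⟩
    | hb y =>
      obtain ⟨y, rfl⟩ := hY.surjective y
      exact ⟨Cone.base f y, rfl⟩
  · exact hX.continuous_lift_prod_left (hg.comp Cone.continuous_mk)
  · exact hY.continuous_iff.2 (hg.comp Cone.continuous_base)
  -- `O` sends a point to the set of its lifts. Defining it by `Cone.desc` replaces an analysis of
  -- the equivalence relation generated by the gluing.
  · let O : Cone f' → Set (Cone f) := Cone.desc f' {pt}
      (fun x' t => {z | ∃ x, qX x = x' ∧ z = Cone.mk f x t})
      (fun y' => {z | ∃ y, qY y = y' ∧ z = Cone.base f y})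
      (fun x' => by
        obtain ⟨x, rfl⟩ := hX.surjective x'
        ext z
        simp only [Cone.mk_zero, mem_ofPred_eq, mem_singleton_iff]
        exact ⟨fun ⟨_, _, h⟩ => h, fun h => ⟨x, rfl, h⟩⟩)
      (fun x' => by
        obtain ⟨x, rfl⟩ := hX.surjective x'
        ext z
        simp only [Cone.mk_one, mem_ofPred_eq]
        refine ⟨fun ⟨w, hw, h⟩ => ⟨f w, by rw [hq, hw], h⟩, fun ⟨y, hy, h⟩ => ?_⟩
        -- A lift of `f' (qX x)` to `Y` is a translate of `f x`, hence the image of a translate of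
        -- `x`; so the two sets of lifts agree at the base of the cone.
        obtain ⟨s, rfl⟩ := oY _ _ ((hq x).trans hy.symm)
        exact ⟨rX s x, iX s x, by rw [h, hr]⟩)
    have hb : b ∈ O (Cone.map qX qY hq b) := by
      induction b using Cone.cases with
      | h => exact rfl
      | hm x t => exact ⟨x, rfl, rfl⟩
      | hb y => exact ⟨y, rfl, rfl⟩
    rw [← hab] at hb
    induction a using Cone.cases with
    | h =>
      obtain rfl : b = pt := hb
      exact ⟨Classical.arbitrary S, rfl⟩
    | hm x t =>
      obtain ⟨x', hx, rfl⟩ := hb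
      obtain ⟨s, rfl⟩ := oX x x' hx.symm
      exact ⟨s, rfl⟩
    | hb y =>
      obtain ⟨y', hy, rfl⟩ := hb
      obtain ⟨s, rfl⟩ := oY y y' hy.symm
      exact ⟨s, rfl⟩

end ConeOrbit

namespace MGraph

variable {V E : Type*} {G : MGraph V E} {v : V} (H : Set (G.HalfEdge v))

section Unord

variable {ι : Type*} {A : Set (ι → G.Point)}

theorem Unord.isQuotientMap_mk : IsQuotientMap (Unord.mk : A → Unord A) :=
  isQuotientMap_quotient_mk'

theorem Unord.mk_op {r : Equiv.Perm ι → A → A} (hr : ∀ σ c i, (r σ c).1 i = c.1 (σ.symm i))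
    (σ : Equiv.Perm ι) (c : A) : Unord.mk (r σ c) = Unord.mk c :=
  Quotient.sound ⟨σ, fun i => by rw [hr, σ.symm_apply_apply]⟩

theorem Unord.exists_op {r : Equiv.Perm ι → A → A}
    (hr : ∀ σ c i, (r σ c).1 i = c.1 (σ.symm i)) (c c' : A) (h : Unord.mk c = Unord.mk c') :
    ∃ σ, r σ c = c' := by
  obtain ⟨σ, hσ⟩ := Quotient.exact h
  exact ⟨σ.symm, Subtype.ext (funext fun i => by rw [hr, hσ]; rfl)⟩

end Unord

section Quotients

/-- The projection from the mapping cone of ordered configurations to the mapping cone of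
unordered configurations. -/
def coneToUnord (n : ℕ) : Cone (incl H (Fin n)) → Cone (uincl H n) :=
  Cone.map Unord.mk Unord.mk fun _ => rfl

/-- The projection from ordered to unordered configurations with not more than one point in the
ball. -/
def coneOneToUnord (n : ℕ) : Cone (inclOne H (Fin n)) → Cone (uinclOne H n) :=
  Cone.map Unord.mk Unord.mk fun _ => rfl

/-- The projection from the suspension of ordered to the one of unordered configurations. -/
def suspToUnord (n : ℕ) : Susp (conf (Fin n) (cup H)ᶜ) → Susp (Unord (conf (Fin n) (cup H)ᶜ)) :=
  Susp.map Unord.mk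

theorem isOrbitMap_coneToUnord (n : ℕ) :
    IsOrbitMap (permCone H (Fin n)) (coneToUnord H n) :=
  Cone.isOrbitMap_map (rX := relabel) (rY := relabel) (qX := Unord.mk) (qY := Unord.mk)
    (fun _ _ => rfl) (fun _ => rfl)
    Unord.isQuotientMap_mk Unord.isQuotientMap_mk (Unord.mk_op fun _ _ _ => rfl)
    (Unord.mk_op fun _ _ _ => rfl) (Unord.exists_op fun _ _ _ => rfl)
    (Unord.exists_op fun _ _ _ => rfl)

theorem isOrbitMap_coneOneToUnord (n : ℕ) :
    IsOrbitMap (permConeOne H (Fin n)) (coneOneToUnord H n) :=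
  Cone.isOrbitMap_map (rX := relabelOne) (rY := relabelOne) (qX := Unord.mk) (qY := Unord.mk)
    (fun _ _ => rfl) (fun _ => rfl)
    Unord.isQuotientMap_mk Unord.isQuotientMap_mk (Unord.mk_op fun _ _ _ => rfl)
    (Unord.mk_op fun _ _ _ => rfl) (Unord.exists_op fun _ _ _ => rfl)
    (Unord.exists_op fun _ _ _ => rfl)

theorem isInvariant_suspToUnord (n : ℕ) :
    IsInvariant (permSusp H (Fin n)) (suspToUnord H n) := by
  refine ⟨Susp.continuous_of_mk ?_, rfl, fun σ a => ?_⟩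
  · exact Susp.continuous_mk.comp (Unord.isQuotientMap_mk.continuous.prodMap continuous_id)
  · induction a using Susp.cases with
    | h => rfl
    | hm c t => exact congrArg (fun c => Susp.mk c t) (Unord.mk_op (r := relabel) (fun _ _ _ => rfl) σ c)

variable (n : ℕ)

/-- The unordered configuration underlying a configuration labelled by the complement of `i`. -/
def forgetLabels (i : Fin (n + 1))
    (z : conf {j : Fin (n + 1) // j ≠ i} ({Point.vert v}ᶜ : Set G.Point)) :
    Unord (conf (Fin n) ({Point.vert v}ᶜ : Set G.Point)) :=
  Unord.mk (relabel (finSuccAboveEquiv i).symm z)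

theorem continuous_relabel {κ κ' : Type*} {A : Set G.Point} (e : κ ≃ κ') :
    Continuous (relabel e : conf κ A → conf κ' A) :=
  (continuous_pi fun k => (continuous_apply (e.symm k)).comp
    (continuous_subtype_val (p := (· ∈ conf κ A)))).subtype_mk _

theorem exists_forgetLabels (i : Fin (n + 1))
    (c : conf (Fin n) ({Point.vert v}ᶜ : Set G.Point)) :
    forgetLabels n i (relabel (finSuccAboveEquiv i) c) = Unord.mk c := by
  refine congrArg Unord.mk (Subtype.ext (funext fun k => ?_))
  simp [relabel]

theorem forgetLabels_surjective (i : Fin (n + 1)) :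
    Surjective (forgetLabels (G := G) (v := v) n i) := fun ζ => by
  obtain ⟨c, rfl⟩ := Unord.isQuotientMap_mk.surjective ζ
  exact ⟨_, exists_forgetLabels n i c⟩

/-- The projection from the wedge for ordered configurations to the one for unordered
configurations. -/
def wedgeToUnord : SuspWedge H (Fin (n + 1)) → USuspWedge H n :=
  Wedge.desc (fun k a => Wedge.incl _ k.2 (Susp.map (forgetLabels n k.1) a))
    fun k => Wedge.incl_pt _ k.2

/-- The point `[ζ, t]` in the summand `h` of the wedge. -/
def uwedgePt (h : H) (ζ : Unord (conf (Fin n) ({Point.vert v}ᶜ : Set G.Point)))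
    (t : unitInterval) : USuspWedge H n :=
  Wedge.incl (fun _ : H => Susp (Unord (conf (Fin n) ({Point.vert v}ᶜ : Set G.Point)))) h
    (Susp.mk ζ t)

variable {H n} in
theorem wedgePt_congr {i i' : Fin (n + 1)} (hi : i = i') (h : H)
    {z : conf {j : Fin (n + 1) // j ≠ i} ({Point.vert v}ᶜ : Set G.Point)}
    {z' : conf {j : Fin (n + 1) // j ≠ i'} ({Point.vert v}ᶜ : Set G.Point)}
    (hz : ∀ j (hj : j ≠ i) (hj' : j ≠ i'), z.1 ⟨j, hj⟩ = z'.1 ⟨j, hj'⟩) (t : unitInterval) :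
    wedgePt H (i, h) z t = wedgePt H (i', h) z' t := by
  subst hi
  obtain rfl : z = z' := Subtype.ext (funext fun j => hz j j.2 j.2)
  rfl

variable {H n} in
-- The permutation that matches the two remaining configurations is a bijection between the
-- complements of `i` and `i'`; extended by `i ↦ i'`, it relabels one summand to the other.
theorem exists_permWedge {i i' : Fin (n + 1)} (h : H)
    {z : conf {j : Fin (n + 1) // j ≠ i} ({Point.vert v}ᶜ : Set G.Point)}
    {z' : conf {j : Fin (n + 1) // j ≠ i'} ({Point.vert v}ᶜ : Set G.Point)}
    (hz : forgetLabels n i z = forgetLabels n i' z') (t : unitInterval) :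
    ∃ σ, permWedge H (Fin (n + 1)) σ (wedgePt H (i, h) z t) = wedgePt H (i', h) z' t := by
  obtain ⟨τ, hτ⟩ := Quotient.exact hz
  let e : {j // j ≠ i} ≃ {j // j ≠ i'} := ((finSuccAboveEquiv i).symm.trans
    τ.symm).trans (finSuccAboveEquiv i')
  have hi : e.extendSubtype i = i' := by
    have := e.extendSubtype_not_mem i (by simp)
    simpa using this
  refine ⟨e.extendSubtype, wedgePt_congr hi h (fun j hj hj' => ?_) t⟩
  have hk : (e.extendSubtype).symm j = e.symm ⟨j, hj'⟩ := by
    rw [Equiv.symm_apply_eq, e.extendSubtype_apply_of_mem _ (e.symm ⟨j, hj'⟩).2]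
    simp
  have h1 := hτ ((finSuccAboveEquiv i').symm ⟨j, hj'⟩)
  have h2 : (relabel (finSuccAboveEquiv i').symm z').1
      ((finSuccAboveEquiv i').symm ⟨j, hj'⟩) = z'.1 ⟨j, hj'⟩ :=
    congrArg z'.1 ((finSuccAboveEquiv i').apply_symm_apply _)
  rw [h2] at h1
  rw [h1]
  exact congrArg z.1 (Subtype.ext hk)

theorem isOrbitMap_wedgeToUnord :
    IsOrbitMap (permWedge H (Fin (n + 1))) (wedgeToUnord H n) := by
  have hmk (i : Fin (n + 1)) : Continuous (forgetLabels (G := G) (v := v) n i) :=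
    Unord.isQuotientMap_mk.continuous.comp (continuous_relabel _)
  have hc : Continuous (wedgeToUnord H n) := suspWedge_continuous_of fun k =>
    (Wedge.continuous_incl k.2).comp
      (Susp.continuous_mk.comp ((hmk k.1).prodMap continuous_id))
  refine ⟨⟨hc, rfl, fun σ a => ?_⟩, isQuotientMap_of_forall_continuous (fun a => ?_) hc
    fun g hg => Wedge.continuous_of_incl fun h => Susp.continuous_of_mk ?_, fun a b hab => ?_⟩
  · induction a using suspWedge_cases with
    | h => rfl
    | hm k z t =>
      refine congrArg (fun ζ => uwedgePt H n k.2 ζ t) (Quotient.sound ?_)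
      let e : {j // j ≠ k.1} ≃ {j // j ≠ σ k.1} := σ.subtypeEquiv (fun j => (σ.injective.ne_iff (x := j) (y := k.1)).symm)
      refine ⟨((finSuccAboveEquiv k.1).trans e).trans
        (finSuccAboveEquiv (σ k.1)).symm, fun i => ?_⟩
      simp [relabel, e]
  · induction a using Wedge.cases with
    | h => exact ⟨pt, rfl⟩
    | hm h a =>
      induction a using Susp.cases with
      | h => exact ⟨pt, (Wedge.incl_pt _ h).symm⟩
      | hm ζ t =>
        obtain ⟨z, rfl⟩ := forgetLabels_surjective n 0 ζ
        exact ⟨wedgePt H (0, h) z t, rfl⟩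
  · refine Unord.isQuotientMap_mk.continuous_lift_prod_left ?_
    refine (hg.comp ((continuous_wedgePt H (0, h)).comp
      ((continuous_relabel (finSuccAboveEquiv 0)).prodMap continuous_id))).congr
        fun p => ?_
    exact congrArg (fun ζ => g (uwedgePt H n h ζ p.2)) (exists_forgetLabels n 0 p.1)
  -- As for the cone, the set of lifts is defined as a map out of the quotient; its value at the
  -- base point has to be `{pt}`.
  · let _ : BasePt (Set (SuspWedge H (Fin (n + 1)))) := ⟨{pt}⟩
    let F (h : H) (ζ : Unord (conf (Fin n) ({Point.vert v}ᶜ : Set G.Point)))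
        (t : unitInterval) : Set (SuspWedge H (Fin (n + 1))) :=
      {a | ∃ i z, forgetLabels n i z = ζ ∧ a = wedgePt H (i, h) z t}
    have hF (h ζ t) (ht : ∀ i z, wedgePt H ((i : Fin (n + 1)), h) z t = pt) : F h ζ t = {pt} := by
      ext a
      simp only [F, ht, mem_ofPred_eq, mem_singleton_iff]
      obtain ⟨z, hz⟩ := forgetLabels_surjective n 0 ζ
      exact ⟨fun ⟨_, _, _, h⟩ => h, fun h => ⟨0, z, hz, h⟩⟩
    let O : USuspWedge H n → Set (SuspWedge H (Fin (n + 1))) :=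
      Wedge.desc (fun h => Susp.desc {pt} (F h)
        (fun ζ => hF h ζ 0 fun i z => wedgePt_zero H (i, h) z)
        (fun ζ => hF h ζ 1 fun i z => wedgePt_one H (i, h) z)) fun _ => rfl
    have hb : b ∈ O (wedgeToUnord H n b) := by
      induction b using suspWedge_cases with
      | h => exact rfl
      | hm k z t => exact ⟨k.1, z, rfl, rfl⟩
    rw [← hab] at hb
    induction a using suspWedge_cases with
    | h =>
      obtain rfl : b = pt := hb
      exact ⟨1, rfl⟩
    | hm k z t =>
      obtain ⟨i, z', hz, rfl⟩ := hb
      exact exists_permWedge k.2 hz.symm t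

end Quotients

section Add

variable (n : ℕ)

theorem continuous_uaddAt [Finite V] [Finite E] (hv : G.NoLoopAt v) (x : G.Point)
    (hx : x ∈ (cup H)ᶜ) (hd : G.dist v x ≤ 1 / 2) : Continuous (uaddAt H n hv x hx hd) := by
  refine Unord.isQuotientMap_mk.continuous_iff.2
    (Unord.isQuotientMap_mk.continuous.comp (Continuous.subtype_mk ?_ _))
  refine continuous_pi fun j => ?_
  refine Fin.cases ?_ (fun j => ?_) j
  · exact continuous_const
  · exact continuous_push_conf hv j

theorem mk_addAt (hv : G.NoLoopAt v) (x : G.Point) (hx : x ∈ (cup H)ᶜ)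
    (hd : G.dist v x ≤ 1 / 2) (i : Fin (n + 1))
    (z : conf {j : Fin (n + 1) // j ≠ i} ({Point.vert v}ᶜ : Set G.Point)) :
    Unord.mk (addAt H hv i x hx hd z) = uaddAt H n hv x hx hd (forgetLabels n i z) := by
  -- The ordered version puts the new point at label `i`, the unordered one at label `0`. This
  -- permutation takes `0` to `i` and `j.succ` to `i.succAbove j`.
  refine Quotient.sound ⟨i.cycleRange.symm, fun j => ?_⟩
  refine Fin.cases ?_ (fun j => ?_) j
  · rw [Fin.cycleRange_symm_zero]
    exact (insertPt_self (v := v) i x z.1).symm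
  · rw [Fin.cycleRange_symm_succ]
    exact (insertPt_of_ne (v := v) x z.1 (i.succAbove_ne j)).symm

/-- The map that is `Σ add_v - Σ add_h` on the summand `h` of the wedge. -/
def udiffMap (hv : G.NoLoopAt v) :
    USuspWedge H n → Susp (Unord (conf (Fin (n + 1)) (cup H)ᶜ)) :=
  Wedge.desc (fun h => Susp.sub (Susp.map (uaddV H n hv)) (Susp.map (uaddH H n hv h.1)) rfl rfl)
    fun _ => rfl

theorem udiffMap_wedgeToUnord (hv : G.NoLoopAt v) (a : SuspWedge H (Fin (n + 1))) :
    udiffMap H n hv (wedgeToUnord H n a) = suspToUnord H (n + 1) (diffMap H _ hv a) := by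
  induction a using suspWedge_cases with
  | h => rfl
  | hm k z t =>
    change (if (t : ℝ) ≤ 1 / 2 then Susp.mk (uaddV H n hv (forgetLabels n k.1 z)) _
      else Susp.mk (uaddH H n hv k.2.1 (forgetLabels n k.1 z)) _) =
      suspToUnord H (n + 1) (if (t : ℝ) ≤ 1 / 2 then Susp.mk (addV H hv k.1 z) _
      else Susp.mk (addH H hv k.1 k.2.1 z) _)
    split_ifs
    · exact congrArg (fun c => Susp.mk c _) (mk_addAt H n hv _ _ _ k.1 z).symm
    · exact congrArg (fun c => Susp.mk c _) (mk_addAt H n hv _ _ _ k.1 z).symm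

end Add

end MGraph

/-! ### The identification, and comparison with unordered configurations -/

namespace MGraph

variable {V E : Type*} {G : MGraph V E} {v : V} (H : Set (G.HalfEdge v))

section Identification

variable (ι : Type*)

/-- The identification of the wedge with the mapping cone of `ι_H`. -/
def identification (hv : G.NoLoopAt v) : SuspWedge H ι → Cone (incl H ι) :=
  coneIncl H ι ∘ insertMap H ι hv

variable [Finite V] [Finite E] [Fintype ι]

theorem isEqPtdHomotopyEquiv_identification (hv : G.NoLoopAt v) :
    IsEqPtdHomotopyEquiv (permWedge H ι) (permCone H ι) (identification H ι hv) :=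
  (isEqPtdHomotopyEquiv_coneIncl H hv ι).comp (isEqPtdHomotopyEquiv_insertMap hv)

/-- The composite is `J ∘ insertMap ∘ P`, and `insertMap ∘ P` is homotopic to the identity. -/
theorem identification_comp_forgetMap (hv : G.NoLoopAt v) :
    EqPtdHomotopic (permConeOne H ι) (permCone H ι) (identification H ι hv ∘ forgetMap H ι)
      (coneIncl H ι) :=
  have h := isEqPtdHomotopyEquiv_coneIncl H hv ι
  (insertMap_comp_forgetMap hv).comp_left h.1 h.2.1 h.2.2.1

end Identification

section Unordered

variable {H} {n : ℕ}

theorem isUForgetMap_of_wedgeToUnord {P : Cone (uinclOne H (n + 1)) → USuspWedge H n}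
    (hp : P pt = pt)
    (h : ∀ a, P (coneOneToUnord H (n + 1) a) = wedgeToUnord H n (forgetMap H (Fin (n + 1)) a)) :
    IsUForgetMap H n P := by
  refine ⟨hp, fun c t => ?_, fun c hc => ?_, fun c i k hi t ht => ?_⟩
  · obtain ⟨c, rfl⟩ := Unord.isQuotientMap_mk.surjective c
    exact h (Cone.mk _ c t)
  · exact (h (Cone.base _ c)).trans (congrArg _ (forgetBase_of_notMem c hc))
  · refine (h (Cone.base _ c)).trans ((congrArg _ (forgetBase_of_mem c (i, k) hi)).trans ?_)
    rw [← ht, projIcc_val]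
    rfl

theorem uconeIncl_coneOneToUnord (a : Cone (inclOne H (Fin n))) :
    uconeIncl H n (coneOneToUnord H n a) = coneToUnord H n (coneIncl H (Fin n) a) := by
  induction a using Cone.cases with
  | h => rfl
  | hm x t => rfl
  | hb y => rfl

theorem boundary_coneToUnord (b : Cone (incl H (Fin n))) :
    Cone.boundary (uincl H n) (coneToUnord H n b) =
      suspToUnord H n (Cone.boundary (incl H (Fin n)) b) := by
  induction b using Cone.cases with
  | h => rfl
  | hm x t => rfl
  | hb y => rfl

end Unordered

end MGraph

end GraphConf

end

open GraphConf GraphConf.MGraph in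
theorem mainTheorem4 {V E : Type*} [Finite V] [Finite E] (G : MGraph V E) (v : V)
    (hv : G.NoLoopAt v) (H : Set (G.HalfEdge v)) (n : ℕ) :
    -- unordered configurations of `n + 1` points
    (∃ (P : Cone (uinclOne H (n + 1)) → USuspWedge H n)
        (φ : USuspWedge H n → Cone (uincl H (n + 1))),
      IsUForgetMap H n P ∧ IsPtdHomotopyEquiv P ∧
      IsPtdHomotopyEquiv (uconeIncl H (n + 1)) ∧ IsPtdHomotopyEquiv φ ∧
      PtdHomotopic (φ ∘ P) (uconeIncl H (n + 1)) ∧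
      Continuous (uaddV H n hv) ∧
      ∀ h : H, Continuous (uaddH H n hv h.1) ∧
        PtdHomotopic (Cone.boundary (uincl H (n + 1)) ∘ φ ∘ Wedge.incl _ h)
          (Susp.sub (Susp.map (uaddV H n hv)) (Susp.map (uaddH H n hv h.1)) rfl rfl)) ∧
    -- ordered configurations of `n + 1` points, equivariantly for the symmetric group
    (∃ (P : Cone (inclOne H (Fin (n + 1))) → SuspWedge H (Fin (n + 1)))
        (φ : SuspWedge H (Fin (n + 1)) → Cone (incl H (Fin (n + 1)))),
      IsForgetMap H (Fin (n + 1)) P ∧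
      IsEqPtdHomotopyEquiv (permConeOne H _) (permWedge H _) P ∧
      IsEqPtdHomotopyEquiv (permConeOne H _) (permCone H _) (coneIncl H (Fin (n + 1))) ∧
      IsEqPtdHomotopyEquiv (permWedge H _) (permCone H _) φ ∧
      EqPtdHomotopic (permConeOne H _) (permCone H _) (φ ∘ P) (coneIncl H (Fin (n + 1))) ∧
      (∀ i : Fin (n + 1), Continuous (addV H hv i)) ∧
      (∀ (i : Fin (n + 1)) (h : H), Continuous (addH H hv i h.1)) ∧
      EqPtdHomotopic (permWedge H _) (permSusp H _)
        (Cone.boundary (incl H (Fin (n + 1))) ∘ φ) (diffMap H (Fin (n + 1)) hv)) := by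
  have hA := isOrbitMap_coneOneToUnord H (n + 1)
  have hB := isOrbitMap_wedgeToUnord H n
  have hC := isOrbitMap_coneToUnord H (n + 1)
  have hP := isEqPtdHomotopyEquiv_forgetMap (H := H) (ι := Fin (n + 1)) hv
  have hJ := isEqPtdHomotopyEquiv_coneIncl H hv (Fin (n + 1))
  have hφ := isEqPtdHomotopyEquiv_identification H (Fin (n + 1)) hv
  have hφP := identification_comp_forgetMap H (Fin (n + 1)) hv
  have hd := boundary_comp_insertMap (H := H) (ι := Fin (n + 1)) hv
  refine ⟨?_, forgetMap H _, identification H _ hv, isForgetMap_forgetMap H _, hP, hJ, hφ, hφP,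
    fun i => continuous_addAt hv i _ _ _, fun i h => continuous_addAt hv i _ _ _, hd⟩
  -- The unordered maps are defined as the descents of the ordered ones, so that each of their
  -- properties descends too.
  obtain ⟨P, -, hPp, hPq⟩ := hA.exists_descent hB.toIsInvariant hP.1 hP.2.1 hP.2.2.1
  obtain ⟨φ, -, -, hφq⟩ := hB.exists_descent hC.toIsInvariant hφ.1 hφ.2.1 hφ.2.2.1
  -- The boundary formula descends on the whole wedge; it is restricted to a single summand only
  -- afterwards, since relabelling mixes the ordered summands.
  have hδ : PtdHomotopic (Cone.boundary (uincl H (n + 1)) ∘ φ) (udiffMap H n hv) :=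
    hd.descend hB (isInvariant_suspToUnord H (n + 1))
      (fun a => (congrArg _ (hφq a)).trans (boundary_coneToUnord _))
      (udiffMap_wedgeToUnord H n hv)
  refine ⟨P, φ, isUForgetMap_of_wedgeToUnord hPp hPq, hP.descend hA hB hPq,
    hJ.descend hA hC uconeIncl_coneOneToUnord, hφ.descend hB hC hφq,
    hφP.descend hA hC.toIsInvariant (fun a => (congrArg φ (hPq a)).trans (hφq _))
      uconeIncl_coneOneToUnord,
    continuous_uaddAt H n hv _ _ _, fun h => ⟨continuous_uaddAt H n hv _ _ _,
      hδ.comp_right (Wedge.continuous_incl h) (Wedge.incl_pt _ h)⟩⟩
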